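/- Let $\mathbf v_0=(1,0)$, $\mathbf v_1=(-\frac12,\frac{\sqrt3}2)$, $\mathbf v_2=(-\frac12,-\frac{\sqrt3}2)$ (indices modulo $3$), let $\Lambda\subset\mathbb R^2$ be the lattice they generate, and let $\mathcal R\subset\mathbb R^2$ be the closed rhombus with vertices $\mathbf 0,-\mathbf v_1,\mathbf v_0,-\mathbf v_2$, with these four vertices removed. Label its edges counterclockwise by $1,2,3,4$, starting with the edge from $\mathbf 0$ to $-\mathbf v_1$. Let $S$ be the translation surface obtained from copies $R^i_{\mathbf c}$ of $\mathcal R$, one for each $i\in\mathbb Z/3$ and $\mathbf c\in 2\Lambda$, by gluing, by translations, edge $2$ of $R^i_{\mathbf c}$ to edge $4$ of $R^{i+1}_{\mathbf c+2\mathbf v_i}$ and edge $3$ of $R^i_{\mathbf c}$ to edge $1$ of $R^{i-1}_{\mathbf c+2\mathbf v_i}$. Let $Z^\circ=S/2\Lambda$, i.e. the thrice-punctured torus obtained from three copies $R^i$, $i\in\mathbb Z/3$, of $\mathcal R$ by gluing edge $2$ of $R^i$ to edge $4$ of $R^{i+1}$ and edge $3$ of $R^i$ to edge $1$ of $R^{i-1}$.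 For a translation surface $X$, the Veech group $V(X)\subset\mathrm{GL}(2,\mathbb R)$ is the group of derivatives of affine automorphisms of $X$ (homeomorphisms $X\to X$ which have the form $x\mapsto Mx+c$ in all local coordinates, with a single matrix $M\in \mathrm{GL}(2,\mathbb R)$, the derivative, and $c$ depending on the charts; they may reverse orientation), and $PV(X)$ is its image in $\mathrm{PGL}(2,\mathbb R)$. Let $$R=\begin{pmatrix}0&1\\1&0\end{pmatrix},\qquad P_0=\begin{pmatrix}0&1\\-1&2\end{pmatrix},\qquad P_1=\begin{pmatrix}1&3\\0&1\end{pmatrix}.$$ **Proposition.** Let $X$ be $Z^\circ$ or $S$. 1. Written in the basis $\{\mathbf v_1,\mathbf v_2\}$, the group $PV(X)$ is the subgroup of $\mathrm{PGL}(2,\mathbb R)$ generated by the classes of $R$, $RP_0$ and $P_1^{-1}RP_0$. 2. These three classes act on the upper half-plane $\mathbb H^2$ (by $z\mapsto\frac{az+b}{cz+d}$ if $ad-bc>0$ and $z\mapsto\frac{a\bar z+b}{c\bar z+d}$ if $ad-bc<0$) as the reflections in the three sides of a hyperbolic $(3,\infty,\infty)$-triangle, i.e. a hyperbolic triangle with one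 angle $\frac\pi3$ and two ideal vertices. 3. For every hyperbolic $(3,\infty,\infty)$-triangle $\Delta$, the group $PV(X)$ is isomorphic to the group of isometries of $\mathbb H^2$ generated by the reflections in the sides of $\Delta$. 4. Written in the basis $\{\mathbf v_1,\mathbf v_2\}$, the group $PV(X)$ is a subgroup of index $4$ of $\mathrm{PGL}(2,\mathbb Z)\subset\mathrm{PGL}(2,\mathbb R)$. -/

import Mathlib

open Topology
open scoped UpperHalfPlane MatrixGroups

namespace Trihex

/-! ### Translation surfaces, affine automorphisms and Veech groups -/

/-- The plane `ℝ²` in which translation surfaces have their charts. -/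
abbrev Plane : Type := Fin 2 → ℝ

/-- A surface with an atlas of charts to the plane all of whose transition functions are
(locally) translations. -/
class TranslationSurface (X : Type*) [TopologicalSpace X] [ChartedSpace Plane X] : Prop where
  transition : ∀ e ∈ atlas Plane X, ∀ e' ∈ atlas Plane X, ∀ x ∈ e.source, x ∈ e'.source →
    ∃ c : Plane, ∀ᶠ y in 𝓝 x, e' y = e y + c

/-- The homeomorphism `f` is an affine automorphism with derivative `M`: in local coordinates it
is `x ↦ M x + c`, where `c` may depend on the charts (and on the point) but `M` does not. -/
def IsAffineWithDerivative {X : Type*} [TopologicalSpace X] [ChartedSpace Plane X]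
    (f : X ≃ₜ X) (M : GL (Fin 2) ℝ) : Prop :=
  ∀ e ∈ atlas Plane X, ∀ e' ∈ atlas Plane X, ∀ x ∈ e.source, f x ∈ e'.source →
    ∃ c : Plane, ∀ᶠ y in 𝓝 x, e' (f y) = M.val.mulVec (e y) + c

/-- The Veech group: the group of derivatives of all affine automorphisms (orientation reversing
ones included). -/
def veechGroup (X : Type*) [TopologicalSpace X] [ChartedSpace Plane X] [TranslationSurface X] :
    Subgroup (GL (Fin 2) ℝ) where
  carrier := {M | ∃ f : X ≃ₜ X, IsAffineWithDerivative f M}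
  one_mem' := by
    refine ⟨Homeomorph.refl X, ?_⟩
    intro e he e' he' x hx hx'
    obtain ⟨c, hc⟩ := TranslationSurface.transition e he e' he' x hx hx'
    exact ⟨c, by simpa using hc⟩
  mul_mem' := by
    rintro M N ⟨f, hf⟩ ⟨g, hg⟩
    refine ⟨g.trans f, ?_⟩
    intro e he e' he' x hx hx'
    have hm := mem_chart_source Plane (g x)
    obtain ⟨c, hc⟩ := hg e he _ (chart_mem_atlas Plane (g x)) x hx hm
    obtain ⟨d, hd⟩ := hf _ (chart_mem_atlas Plane (g x)) e' he' (g x) hm hx'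
    refine ⟨M.val.mulVec c + d, ?_⟩
    filter_upwards [hc, g.continuous.continuousAt.eventually hd] with y h1 h2
    have h3 : (g.trans f) y = f (g y) := rfl
    rw [h3, h2, h1, Matrix.mulVec_add, Matrix.mulVec_mulVec, add_assoc]
    rfl
  inv_mem' := by
    rintro M ⟨f, hf⟩
    refine ⟨f.symm, ?_⟩
    intro e he e' he' x hx hx'
    obtain ⟨c, hc⟩ := hf e' he' e he (f.symm x) hx' (by simpa using hx)
    refine ⟨-(M⁻¹).val.mulVec c, ?_⟩
    filter_upwards [f.symm.continuous.continuousAt.eventually hc] with y h1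
    have h2 : (M⁻¹).val * M.val = 1 := by rw [← Units.val_mul]; simp
    rw [f.apply_symm_apply] at h1
    rw [h1, Matrix.mulVec_add, Matrix.mulVec_mulVec, h2, Matrix.one_mulVec]
    abel

/-- The projectivized Veech group: the image of the Veech group in `PGL(2, ℝ)`. -/
def projVeechGroup (X : Type*) [TopologicalSpace X] [ChartedSpace Plane X]
    [TranslationSurface X] : Subgroup PGL(2, ℝ) :=
  (veechGroup X).map Matrix.ProjGenLinGroup.mk

/-! ### The Eisenstein vectors and the rhombus -/

/-- The vectors `v₀ = (1, 0)`, `v₁ = (-1/2, √3/2)`, `v₂ = (-1/2, -√3/2)`, indices modulo three. -/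
noncomputable def v (i : ZMod 3) : Plane :=
  (![![1, 0], ![-1 / 2, √3 / 2], ![-1 / 2, -√3 / 2]] : Fin 3 → Plane) i

/-- The matrix whose columns are `v₁` and `v₂`. -/
noncomputable def basisMatrix : GL (Fin 2) ℝ :=
  Matrix.GeneralLinearGroup.mkOfDetNeZero !![-1 / 2, -1 / 2; √3 / 2, -√3 / 2] (by
    have h : (0 : ℝ) < √3 := Real.sqrt_pos.2 (by norm_num)
    rw [Matrix.det_fin_two_of]
    nlinarith)

/-- The linear map `(s, t) ↦ s (-v₁) + t (-v₂)`. It carries the unit square to the rhombus with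
vertices `0`, `-v₁`, `v₀`, `-v₂`. The edge `t = 0` has label 1, the edge `s = 1` label 2,
the edge `t = 1` label 3 and the edge `s = 0` label 4. -/
noncomputable def place : (ℝ × ℝ) ≃ₗ[ℝ] Plane where
  toFun p := p.1 • (-v 1) + p.2 • (-v 2)
  map_add' p q := by
    simp only [Prod.fst_add, Prod.snd_add, add_smul]
    abel
  map_smul' r p := by
    simp only [Prod.smul_fst, Prod.smul_snd, smul_eq_mul, mul_smul, smul_add, RingHom.id_apply]
  invFun x := (x 0 - x 1 / √3, x 0 + x 1 / √3)
  left_inv p := by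
    have h : (√3 : ℝ) ≠ 0 := by positivity
    have e1 : v 1 = ![-1 / 2, √3 / 2] := rfl
    have e2 : v 2 = ![-1 / 2, -√3 / 2] := rfl
    ext
    · simp [e1, e2]; field_simp; ring
    · simp [e1, e2]; field_simp; ring
  right_inv x := by
    have h : (√3 : ℝ) ≠ 0 := by positivity
    have e1 : v 1 = ![-1 / 2, √3 / 2] := rfl
    have e2 : v 2 = ![-1 / 2, -√3 / 2] := rfl
    ext i
    fin_cases i
    · simp [e1, e2]; ring
    · simp [e1, e2]; field_simp; ring

/-- The closed rhombus without its four vertices, in the coordinates `(s, t)` of `place`. -/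
def Rhombus : Set (ℝ × ℝ) :=
  {p | (0 ≤ p.1 ∧ p.1 ≤ 1) ∧ (0 ≤ p.2 ∧ p.2 ≤ 1) ∧ ¬ ((p.1 = 0 ∨ p.1 = 1) ∧ (p.2 = 0 ∨ p.2 = 1))}

/-! ### Surfaces glued from rhombi -/

/-- Gluing instructions for a family of copies, indexed by `T`, of the rhombus: edge 2 of copy `t`
is glued by translation to edge 4 of copy `right t`, and edge 3 of copy `t` to edge 1 of copy
`up t`. No copy is glued to itself. -/
structure Gluing (T : Type) where
  right : Equiv.Perm T
  up : Equiv.Perm T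
  right_ne : ∀ t, right t ≠ t
  up_ne : ∀ t, up t ≠ t

variable {T : Type}

/-- The edge identifications. -/
inductive Gluing.Glue (G : Gluing T) : (Σ _ : T, Rhombus) → (Σ _ : T, Rhombus) → Prop
  | right (t : T) (p q : Rhombus) (hp : p.val.1 = 1) (hq : q.val.1 = 0)
      (h : p.val.2 = q.val.2) : Gluing.Glue G ⟨t, p⟩ ⟨G.right t, q⟩
  | up (t : T) (p q : Rhombus) (hp : p.val.2 = 1) (hq : q.val.2 = 0)
      (h : p.val.1 = q.val.1) : Gluing.Glue G ⟨t, p⟩ ⟨G.up t, q⟩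

/-- The surface obtained from the disjoint union of the copies of the rhombus (vertices removed)
by identifying edges, with the quotient topology. -/
def Gluing.Surface (G : Gluing T) : Type := Quot G.Glue

instance (G : Gluing T) : TopologicalSpace G.Surface :=
  inferInstanceAs (TopologicalSpace (Quot G.Glue))

/-- The point `p` of copy `t`, as a point of the surface. -/
def Gluing.pt (G : Gluing T) (t : T) (p : Rhombus) : G.Surface := Quot.mk _ ⟨t, p⟩

theorem Gluing.continuous_pt (G : Gluing T) (t : T) : Continuous (G.pt t) :=
  continuous_quot_mk.comp continuous_sigmaMk

/-- Two neighbouring copies `t`, `n` of the rhombus, the second one translated by `e`,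
and an open set `V` of the plane inside their union which misses the vertices.
It parametrizes an open set of the surface and gives a chart. -/
structure Gluing.Patch (G : Gluing T) where
  t : T
  n : T
  e : ℝ × ℝ
  V : Set (ℝ × ℝ)
  ne : n ≠ t
  isOpen : IsOpen V
  cover : ∀ w ∈ V, w ∉ Rhombus → w - e ∈ Rhombus
  closed₁ : IsClosed {w : V | w.val ∈ Rhombus}
  closed₂ : IsClosed {w : V | w.val - e ∈ Rhombus}
  glue : ∀ w ∈ V, ∀ (h₁ : w ∈ Rhombus) (h₂ : w - e ∈ Rhombus),
    G.pt t ⟨w, h₁⟩ = G.pt n ⟨w - e, h₂⟩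
  sat : ∀ W ⊆ V, ∀ a b, G.Glue a b →
    (((a.1 = t ∧ a.2.val ∈ W) ∨ (a.1 = n ∧ a.2.val + e ∈ W)) ↔
      ((b.1 = t ∧ b.2.val ∈ W) ∨ (b.1 = n ∧ b.2.val + e ∈ W)))
  nonempty : V.Nonempty

namespace Gluing.Patch

variable {G : Gluing T} (P : G.Patch)

open Classical in
/-- The parametrization of a part of the surface by the open set `V`. -/
noncomputable def param (w : P.V) : G.Surface :=
  if h : w.val ∈ Rhombus then G.pt P.t ⟨w, h⟩ else G.pt P.n ⟨w.val - P.e, P.cover w w.2 h⟩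

theorem param_t (w : P.V) (h : w.val ∈ Rhombus) : P.param w = G.pt P.t ⟨w, h⟩ := by
  simp [param, h]

theorem param_n (w : P.V) (h : w.val - P.e ∈ Rhombus) :
    P.param w = G.pt P.n ⟨w.val - P.e, h⟩ := by
  by_cases h' : w.val ∈ Rhombus
  · rw [P.param_t w h', P.glue w w.2 h' h]
  · simp [param, h']

/-- Membership in the image of a subset of `V`. -/
def InImage (W : Set (ℝ × ℝ)) (hW : W ⊆ P.V) : G.Surface → Prop :=
  Quot.lift (fun a => (a.1 = P.t ∧ a.2.val ∈ W) ∨ (a.1 = P.n ∧ a.2.val + P.e ∈ W))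
    (fun a b h => propext (P.sat W hW a b h))

theorem inImage_mk (W : Set (ℝ × ℝ)) (hW : W ⊆ P.V) (t : T) (p : Rhombus) :
    P.InImage W hW (G.pt t p) ↔ (t = P.t ∧ p.val ∈ W) ∨ (t = P.n ∧ p.val + P.e ∈ W) := Iff.rfl

theorem inImage_param (W : Set (ℝ × ℝ)) (hW : W ⊆ P.V) (w : P.V) :
    P.InImage W hW (P.param w) ↔ w.val ∈ W := by
  by_cases h : w.val ∈ Rhombus
  · rw [P.param_t w h, inImage_mk]
    simp [P.ne.symm]
  · rw [P.param_n w (P.cover w w.2 h), inImage_mk]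
    simp [P.ne]

theorem exists_of_inImage (W : Set (ℝ × ℝ)) (hW : W ⊆ P.V) (s : G.Surface)
    (h : P.InImage W hW s) : ∃ w : P.V, w.val ∈ W ∧ P.param w = s := by
  induction s using Quot.ind with
  | mk a =>
    obtain ⟨t, p⟩ := a
    rcases (P.inImage_mk W hW t p).1 h with ⟨rfl, h2⟩ | ⟨rfl, h2⟩
    · exact ⟨⟨p.val, hW h2⟩, h2, P.param_t _ p.2⟩
    · have h3 : p.val + P.e - P.e ∈ Rhombus := by simp
      refine ⟨⟨p.val + P.e, hW h2⟩, h2, ?_⟩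
      rw [P.param_n _ h3]
      congr 1
      ext <;> simp

theorem injective_param : Function.Injective P.param := by
  intro w w' h
  have h1 := (P.inImage_param {w.val} (by simp) w).2 rfl
  rw [h, inImage_param] at h1
  exact Subtype.ext h1.symm

theorem continuous_param : Continuous P.param := by
  have h1 : ContinuousOn P.param {w : P.V | w.val ∈ Rhombus} := by
    rw [continuousOn_iff_continuous_domRestrict]
    have : Set.domRestrict {w : P.V | w.val ∈ Rhombus} P.param =
        fun w => G.pt P.t ⟨w.val.val, w.2⟩ := by
      funext w
      exact P.param_t _ w.2
    rw [this]
    exact (G.continuous_pt _).comp (by fun_prop)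
  have h2 : ContinuousOn P.param {w : P.V | w.val - P.e ∈ Rhombus} := by
    rw [continuousOn_iff_continuous_domRestrict]
    have : Set.domRestrict {w : P.V | w.val - P.e ∈ Rhombus} P.param =
        fun w => G.pt P.n ⟨w.val.val - P.e, w.2⟩ := by
      funext w
      exact P.param_n _ w.2
    rw [this]
    exact (G.continuous_pt _).comp (by fun_prop)
  have h3 := h1.union_of_isClosed h2 P.closed₁ P.closed₂
  have h4 : {w : P.V | w.val ∈ Rhombus} ∪ {w : P.V | w.val - P.e ∈ Rhombus} = Set.univ := by
    ext w
    simp only [Set.mem_union, Set.mem_ofPred_eq, Set.mem_univ, iff_true]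
    by_cases h : w.val ∈ Rhombus
    · exact Or.inl h
    · exact Or.inr (P.cover w w.2 h)
  rw [h4] at h3
  exact continuousOn_univ.1 h3

theorem isOpenMap_param : IsOpenMap P.param := by
  intro O hO
  have hO' : IsOpen (Subtype.val '' O) := P.isOpen.isOpenMap_subtype_val O hO
  have hW : Subtype.val '' O ⊆ P.V := by
    rintro _ ⟨w, _, rfl⟩
    exact w.2
  have h1 : P.param '' O = {s | P.InImage (Subtype.val '' O) hW s} := by
    ext s
    constructor
    · rintro ⟨w, hw, rfl⟩
      exact (P.inImage_param _ hW w).2 ⟨w, hw, rfl⟩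
    · intro h
      obtain ⟨w, ⟨w', hw', hww'⟩, rfl⟩ := P.exists_of_inImage _ hW s h
      exact ⟨w, Subtype.ext hww' ▸ hw', rfl⟩
  rw [h1]
  refine isOpen_coinduced.2 (isOpen_sigma_iff.2 fun t => ?_)
  have h2 : IsOpen {p : Rhombus | p.val ∈ Subtype.val '' O} :=
    hO'.preimage continuous_subtype_val
  have h3 : IsOpen {p : Rhombus | p.val + P.e ∈ Subtype.val '' O} :=
    hO'.preimage (continuous_subtype_val.add continuous_const)
  exact ((isOpen_const (p := t = P.t)).inter h2).union ((isOpen_const (p := t = P.n)).inter h3)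

theorem isOpenEmbedding_param : IsOpenEmbedding P.param :=
  IsOpenEmbedding.of_continuous_injective_isOpenMap P.continuous_param P.injective_param
    P.isOpenMap_param

instance : Nonempty P.V := P.nonempty.to_subtype

/-- The chart of a patch: the inverse of the parametrization, followed by the placement of
the unit square as a rhombus in the plane. -/
noncomputable def chart : OpenPartialHomeomorph G.Surface Plane :=
  ((P.isOpenEmbedding_param.toOpenPartialHomeomorph P.param).symm.trans
    (P.isOpen.isOpenEmbedding_subtypeVal.toOpenPartialHomeomorph Subtype.val)).transHomeomorph
      place.toContinuousLinearEquiv.toHomeomorph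

theorem mem_chart_source (s : G.Surface) : s ∈ P.chart.source ↔ ∃ w, P.param w = s := by
  simp [chart, OpenPartialHomeomorph.transHomeomorph]

theorem chart_param (w : P.V) : P.chart (P.param w) = place w.val := by
  have h := (P.isOpenEmbedding_param.toOpenPartialHomeomorph P.param).left_inv
    (x := w) (by simp)
  simp only [IsOpenEmbedding.toOpenPartialHomeomorph_apply] at h
  simp [chart, h]

/-- On each copy of the rhombus, a chart is the standard placement up to a translation. -/
theorem chart_mk_sub (a : T) (q q' : Rhombus) (h : G.pt a q ∈ P.chart.source)
    (h' : G.pt a q' ∈ P.chart.source) :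
    P.chart (G.pt a q') - P.chart (G.pt a q) = place (q'.val - q.val) := by
  obtain ⟨w, hw⟩ := (P.mem_chart_source _).1 h
  obtain ⟨w', hw'⟩ := (P.mem_chart_source _).1 h'
  have i1 := (P.inImage_param {w.val} (by simp) w).2 rfl
  have i2 := (P.inImage_param {w'.val} (by simp) w').2 rfl
  rw [hw, inImage_mk] at i1
  rw [hw', inImage_mk] at i2
  rw [← hw, ← hw', chart_param, chart_param, ← map_sub]
  congr 1
  simp only [Set.mem_singleton_iff] at i1 i2
  rcases i1 with ⟨h1, h2⟩ | ⟨h1, h2⟩ <;> rcases i2 with ⟨h3, h4⟩ | ⟨h3, h4⟩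
  · rw [h2, h4]
  · exact absurd (h3.symm.trans h1) P.ne
  · exact absurd (h1.symm.trans h3) P.ne
  · rw [← h2, ← h4]; abel

/-- Points near a given point in a patch lie with it in a common rhombus. -/
theorem eventually_common (s : G.Surface) (hs : s ∈ P.chart.source) :
    ∀ᶠ s' in 𝓝 s, ∃ a q q', G.pt a q = s ∧ G.pt a q' = s' := by
  obtain ⟨w, rfl⟩ := (P.mem_chart_source _).1 hs
  rw [← P.isOpenEmbedding_param.map_nhds_eq w, Filter.eventually_map]
  have key : ∀ w' : P.V, ((w.val ∈ Rhombus ∧ w'.val ∈ Rhombus) ∨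
      (w.val - P.e ∈ Rhombus ∧ w'.val - P.e ∈ Rhombus)) →
      ∃ a q q', G.pt a q = P.param w ∧ G.pt a q' = P.param w' := by
    rintro w' (⟨h, h'⟩ | ⟨h, h'⟩)
    · exact ⟨_, _, _, (P.param_t w h).symm, (P.param_t w' h').symm⟩
    · exact ⟨_, _, _, (P.param_n w h).symm, (P.param_n w' h').symm⟩
  by_cases h1 : w.val ∈ Rhombus
  · by_cases h2 : w.val - P.e ∈ Rhombus
    · refine Filter.Eventually.of_forall fun w' => key w' ?_
      by_cases h : w'.val ∈ Rhombus
      · exact Or.inl ⟨h1, h⟩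
      · exact Or.inr ⟨h2, P.cover w' w'.2 h⟩
    · filter_upwards [P.closed₂.isOpen_compl.mem_nhds (x := w) h2] with w' hw'
      refine key w' (Or.inl ⟨h1, ?_⟩)
      by_contra h
      exact hw' (P.cover w' w'.2 h)
  · filter_upwards [P.closed₁.isOpen_compl.mem_nhds (x := w) h1] with w' hw'
    exact key w' (Or.inr ⟨P.cover w w.2 h1, P.cover w' w'.2 hw'⟩)

end Gluing.Patch

/-- The patch of two copies which share an edge labelled 2 and 4. -/
def Gluing.rightPatch (G : Gluing T) (t : T) : G.Patch where
  t := t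
  n := G.right t
  e := (1, 0)
  V := {w | (0 < w.1 ∧ w.1 < 2) ∧ (0 < w.2 ∧ w.2 < 1)}
  ne := G.right_ne t
  isOpen := by
    have h : ∀ a b : ℝ, IsOpen {x : ℝ | a < x ∧ x < b} := fun a b => isOpen_Ioo
    exact ((h _ _).preimage continuous_fst).inter ((h _ _).preimage continuous_snd)
  cover := by
    rintro ⟨x, y⟩ h h'
    simp only [Rhombus, Set.mem_ofPred_eq, Prod.mk_sub_mk] at h h' ⊢
    grind
  closed₁ := by
    have : {w : {w : ℝ × ℝ | (0 < w.1 ∧ w.1 < 2) ∧ (0 < w.2 ∧ w.2 < 1)} | w.val ∈ Rhombus} =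
        {w | w.val.1 ≤ 1} := by
      ext ⟨⟨x, y⟩, h⟩
      simp only [Rhombus, Set.mem_ofPred_eq] at h ⊢
      grind
    rw [this]
    exact isClosed_le (by fun_prop) (by fun_prop)
  closed₂ := by
    have : {w : {w : ℝ × ℝ | (0 < w.1 ∧ w.1 < 2) ∧ (0 < w.2 ∧ w.2 < 1)} |
        w.val - (1, 0) ∈ Rhombus} = {w | 1 ≤ w.val.1} := by
      ext ⟨⟨x, y⟩, h⟩
      simp only [Rhombus, Set.mem_ofPred_eq, Prod.mk_sub_mk] at h ⊢
      grind
    rw [this]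
    exact isClosed_le (by fun_prop) (by fun_prop)
  glue := by
    rintro ⟨x, y⟩ h h₁ h₂
    refine Quot.sound (Gluing.Glue.right t _ _ ?_ ?_ ?_)
    all_goals
      simp only [Rhombus, Set.mem_ofPred_eq, Prod.mk_sub_mk] at h h₁ h₂ ⊢
      grind
  sat := by
    intro W hW a b hab
    have hV : ∀ x y : ℝ, (x, y) ∈ W → (0 < x ∧ x < 2) ∧ (0 < y ∧ y < 1) := fun x y h => hW h
    cases hab with
    | right s p q hp hq h =>
      obtain ⟨⟨x, y⟩, p2⟩ := p
      obtain ⟨⟨x', y'⟩, q2⟩ := q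
      simp only at hp hq h
      subst hp hq h
      simp only [Prod.mk_add_mk, EmbeddingLike.apply_eq_iff_eq, add_zero, zero_add]
      have := hV 0 y
      have := hV (1 + 1) y
      grind
    | up s p q hp hq h =>
      obtain ⟨⟨x, y⟩, p2⟩ := p
      obtain ⟨⟨x', y'⟩, q2⟩ := q
      simp only at hp hq h
      subst hp hq h
      simp only [Prod.mk_add_mk, add_zero]
      have := hV x 0
      have := hV x 1
      have := hV (x + 1) 0
      have := hV (x + 1) 1
      grind
  nonempty := ⟨(1, 1 / 2), by norm_num⟩

/-- The patch of two copies which share an edge labelled 3 and 1. -/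
def Gluing.upPatch (G : Gluing T) (t : T) : G.Patch where
  t := t
  n := G.up t
  e := (0, 1)
  V := {w | (0 < w.1 ∧ w.1 < 1) ∧ (0 < w.2 ∧ w.2 < 2)}
  ne := G.up_ne t
  isOpen := by
    have h : ∀ a b : ℝ, IsOpen {x : ℝ | a < x ∧ x < b} := fun a b => isOpen_Ioo
    exact ((h _ _).preimage continuous_fst).inter ((h _ _).preimage continuous_snd)
  cover := by
    rintro ⟨x, y⟩ h h'
    simp only [Rhombus, Set.mem_ofPred_eq, Prod.mk_sub_mk] at h h' ⊢
    grind
  closed₁ := by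
    have : {w : {w : ℝ × ℝ | (0 < w.1 ∧ w.1 < 1) ∧ (0 < w.2 ∧ w.2 < 2)} | w.val ∈ Rhombus} =
        {w | w.val.2 ≤ 1} := by
      ext ⟨⟨x, y⟩, h⟩
      simp only [Rhombus, Set.mem_ofPred_eq] at h ⊢
      grind
    rw [this]
    exact isClosed_le (by fun_prop) (by fun_prop)
  closed₂ := by
    have : {w : {w : ℝ × ℝ | (0 < w.1 ∧ w.1 < 1) ∧ (0 < w.2 ∧ w.2 < 2)} |
        w.val - (0, 1) ∈ Rhombus} = {w | 1 ≤ w.val.2} := by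
      ext ⟨⟨x, y⟩, h⟩
      simp only [Rhombus, Set.mem_ofPred_eq, Prod.mk_sub_mk] at h ⊢
      grind
    rw [this]
    exact isClosed_le (by fun_prop) (by fun_prop)
  glue := by
    rintro ⟨x, y⟩ h h₁ h₂
    refine Quot.sound (Gluing.Glue.up t _ _ ?_ ?_ ?_)
    all_goals
      simp only [Rhombus, Set.mem_ofPred_eq, Prod.mk_sub_mk] at h h₁ h₂ ⊢
      grind
  sat := by
    intro W hW a b hab
    have hV : ∀ x y : ℝ, (x, y) ∈ W → (0 < x ∧ x < 1) ∧ (0 < y ∧ y < 2) := fun x y h => hW h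
    cases hab with
    | up s p q hp hq h =>
      obtain ⟨⟨x, y⟩, p2⟩ := p
      obtain ⟨⟨x', y'⟩, q2⟩ := q
      simp only at hp hq h
      subst hp hq h
      simp only [Prod.mk_add_mk, EmbeddingLike.apply_eq_iff_eq, add_zero, zero_add]
      have := hV x 0
      have := hV x (1 + 1)
      grind
    | right s p q hp hq h =>
      obtain ⟨⟨x, y⟩, p2⟩ := p
      obtain ⟨⟨x', y'⟩, q2⟩ := q
      simp only at hp hq h
      subst hp hq h
      simp only [Prod.mk_add_mk, add_zero]
      have := hV 0 y
      have := hV 1 y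
      have := hV 0 (y + 1)
      have := hV 1 (y + 1)
      grind
  nonempty := ⟨(1 / 2, 1), by norm_num⟩

/-- The charts of the surface: one for each pair of adjacent rhombi. -/
def Gluing.charts (G : Gluing T) : Set (OpenPartialHomeomorph G.Surface Plane) :=
  {e | ∃ t, e = (G.rightPatch t).chart ∨ e = (G.upPatch t).chart}

theorem Gluing.exists_chart (G : Gluing T) (s : G.Surface) :
    ∃ e ∈ G.charts, s ∈ e.source := by
  induction s using Quot.ind with
  | mk a =>
    obtain ⟨t, ⟨⟨x, y⟩, hp⟩⟩ := a
    have hR := hp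
    simp only [Rhombus, Set.mem_ofPred_eq] at hR
    by_cases hy : 0 < y ∧ y < 1
    · by_cases hx : 0 < x
      · refine ⟨_, ⟨t, Or.inl rfl⟩, ((G.rightPatch t).mem_chart_source _).2
          ⟨⟨(x, y), ⟨hx, by linarith [hR.1.2]⟩, hy⟩, (G.rightPatch t).param_t _ hp⟩⟩
      · obtain ⟨t', rfl⟩ := G.right.surjective t
        have hx0 : x = 0 := by linarith [hR.1.1]
        subst hx0
        have h1 : ((1 : ℝ), y) - (1, 0) ∈ Rhombus := by simpa using hp
        refine ⟨_, ⟨t', Or.inl rfl⟩, ((G.rightPatch t').mem_chart_source _).2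
          ⟨⟨(1, y), by norm_num, hy⟩, ?_⟩⟩
        rw [(G.rightPatch t').param_n _ h1]
        change G.pt (G.right t') _ = G.pt _ _
        congr 1
        ext <;> simp [Gluing.rightPatch]
    · have hx : 0 < x ∧ x < 1 := by grind
      by_cases hy0 : 0 < y
      · refine ⟨_, ⟨t, Or.inr rfl⟩, ((G.upPatch t).mem_chart_source _).2
          ⟨⟨(x, y), hx, ⟨hy0, by linarith [hR.2.1.2]⟩⟩, (G.upPatch t).param_t _ hp⟩⟩
      · obtain ⟨t', rfl⟩ := G.up.surjective t
        have hy1 : y = 0 := by linarith [hR.2.1.1]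
        subst hy1
        have h1 : (x, (1 : ℝ)) - (0, 1) ∈ Rhombus := by simpa using hp
        refine ⟨_, ⟨t', Or.inr rfl⟩, ((G.upPatch t').mem_chart_source _).2
          ⟨⟨(x, 1), hx, by norm_num⟩, ?_⟩⟩
        rw [(G.upPatch t').param_n _ h1]
        change G.pt (G.up t') _ = G.pt _ _
        congr 1
        ext <;> simp [Gluing.upPatch]

noncomputable instance (G : Gluing T) : ChartedSpace Plane G.Surface where
  atlas := G.charts
  chartAt s := (G.exists_chart s).choose
  mem_chart_source s := (G.exists_chart s).choose_spec.2
  chart_mem_atlas s := (G.exists_chart s).choose_spec.1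

instance (G : Gluing T) : TranslationSurface G.Surface where
  transition := by
    intro e he e' he' s hs hs'
    obtain ⟨P, rfl⟩ : ∃ P : G.Patch, e = P.chart := by
      obtain ⟨t, h | h⟩ := he
      exacts [⟨_, h⟩, ⟨_, h⟩]
    obtain ⟨P', rfl⟩ : ∃ P : G.Patch, e' = P.chart := by
      obtain ⟨t, h | h⟩ := he'
      exacts [⟨_, h⟩, ⟨_, h⟩]
    refine ⟨P'.chart s - P.chart s, ?_⟩
    filter_upwards [P.eventually_common s hs, P.chart.open_source.mem_nhds hs,
      P'.chart.open_source.mem_nhds hs'] with y h1 h2 h3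
    obtain ⟨a, q, q', rfl, rfl⟩ := h1
    have e1 := P.chart_mk_sub a q q' hs h2
    have e2 := P'.chart_mk_sub a q q' hs' h3
    rw [sub_eq_iff_eq_add] at e1 e2
    rw [e1, e2]
    abel

/-! ### The surfaces `S` and `Z°` -/

/-- The lattice `2Λ = ⟨2 v₀, 2 v₁, 2 v₂⟩` of centers of hexagons. -/
def hexagonCenters : AddSubgroup Plane :=
  AddSubgroup.closure (Set.range fun i => (2 : ℝ) • v i)

/-- The vector `2 vᵢ` of the lattice `2Λ`. -/
noncomputable def twoV (i : ZMod 3) : hexagonCenters :=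
  ⟨(2 : ℝ) • v i, AddSubgroup.subset_closure ⟨i, rfl⟩⟩

/-- The gluings defining `S`, with `(i, c)` standing for the rhombus `Rⁱ_c` of the hexagon with
center `c`: edge 2 of `Rⁱ_c` is glued to edge 4 of the rhombus with indices `i + 1` and
`c + 2 vᵢ`, and edge 3 of `Rⁱ_c` to edge 1 of the rhombus with indices `i - 1` and `c + 2 vᵢ`. -/
noncomputable def gluingS : Gluing (ZMod 3 × hexagonCenters) where
  right :=
    { toFun := fun x => (x.1 + 1, x.2 + twoV x.1)
      invFun := fun x => (x.1 - 1, x.2 - twoV (x.1 - 1))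
      left_inv := fun x => by simp
      right_inv := fun x => by simp }
  up :=
    { toFun := fun x => (x.1 - 1, x.2 + twoV x.1)
      invFun := fun x => (x.1 + 1, x.2 - twoV (x.1 + 1))
      left_inv := fun x => by simp
      right_inv := fun x => by simp }
  right_ne := fun x h => absurd (congrArg Prod.fst h) (by
    change x.1 + 1 ≠ x.1
    generalize x.1 = i
    revert i
    decide)
  up_ne := fun x h => absurd (congrArg Prod.fst h) (by
    change x.1 - 1 ≠ x.1
    generalize x.1 = i
    revert i
    decide)

/-- The gluings defining `Z°`, the quotient of `S` by the translations in `2Λ`: three rhombi. -/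
def gluingZ : Gluing (ZMod 3) where
  right := Equiv.addRight 1
  up := Equiv.subRight 1
  right_ne := by decide
  up_ne := by decide

/-- The infinite translation surface `S`. -/
abbrev S : Type := gluingS.Surface

/-- The torus `Z°` with three punctures. -/
abbrev Z : Type := gluingZ.Surface

/-- The projectivized Veech group, written in the basis `v₁, v₂` of the plane. -/
noncomputable def projVeechGroupInBasis (X : Type*) [TopologicalSpace X] [ChartedSpace Plane X]
    [TranslationSurface X] : Subgroup PGL(2, ℝ) :=
  (projVeechGroup X).map
    (MulAut.conj (Matrix.ProjGenLinGroup.mk basisMatrix)⁻¹).toMonoidHom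

/-! ### The matrices -/

/-- The matrix `P₀`. -/
def matP₀ : GL (Fin 2) ℤ := ⟨!![0, 1; -1, 2], !![2, -1; 1, 0], by decide, by decide⟩

/-- The matrix `P₁`. -/
def matP₁ : GL (Fin 2) ℤ := ⟨!![1, 3; 0, 1], !![1, -3; 0, 1], by decide, by decide⟩

/-- The matrix `R`. -/
def matR : GL (Fin 2) ℤ := ⟨!![0, 1; 1, 0], !![0, 1; 1, 0], by decide, by decide⟩

/-- The natural map `PGL(2, ℤ) → PGL(2, ℝ)`. -/
noncomputable def intToReal : PGL(2, ℤ) →* PGL(2, ℝ) :=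
  Matrix.ProjGenLinGroup.map (Int.castRingHom ℝ)

/-- The three elements `R`, `R P₀`, `P₁⁻¹ R P₀` of `PGL(2, ℝ)`. -/
noncomputable def generator : Fin 3 → PGL(2, ℝ) :=
  ![intToReal (Matrix.ProjGenLinGroup.mk matR),
    intToReal (Matrix.ProjGenLinGroup.mk (matR * matP₀)),
    intToReal (Matrix.ProjGenLinGroup.mk (matP₁⁻¹ * matR * matP₀))]

/-! ### Hyperbolic triangles and their reflection groups -/

/-- A hyperbolic line of the upper half-plane, given by an equation `a |z|² + b Re z + c = 0`
with `b² - 4 a c > 0`: a vertical half-line or a half-circle centered on the real axis. -/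
structure HypLine where
  a : ℝ
  b : ℝ
  c : ℝ
  disc_pos : 0 < b ^ 2 - 4 * a * c

/-- The points of a hyperbolic line. -/
def HypLine.points (ℓ : HypLine) : Set ℍ :=
  {z | ℓ.a * Complex.normSq z + ℓ.b * z.re + ℓ.c = 0}

/-- The two ideal endpoints of a hyperbolic line in `ℝ ∪ {∞}`. -/
def HypLine.endpoints (ℓ : HypLine) : Set (OnePoint ℝ) :=
  {ξ | (ξ = OnePoint.infty ∧ ℓ.a = 0) ∨ ∃ x : ℝ, ξ = x ∧ ℓ.a * x ^ 2 + ℓ.b * x + ℓ.c = 0}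

/-- The isometry `σ` of the hyperbolic plane is the reflection in the line `ℓ`: its fixed points
are exactly the points of `ℓ`. -/
def HypLine.IsReflection (ℓ : HypLine) (σ : ℍ ≃ᵢ ℍ) : Prop :=
  {z | σ z = z} = ℓ.points

/-- The direction at `p` of the geodesic ray from `p` to the ideal point `ξ`, seen in the disk
model through the conformal map `z ↦ (z - p) / (z - p̄)`, which takes `p` to `0`, takes geodesic
rays from `p` to radii, and `∞` to `1`. -/
noncomputable def direction (p : ℍ) : OnePoint ℝ → ℂ
  | none => 1
  | some x => ((x : ℂ) - p) / ((x : ℂ) - (starRingEnd ℂ) p)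

/-- A hyperbolic `(3, ∞, ∞)`-triangle: one vertex `p` in the hyperbolic plane and two ideal vertices
`ξ`, `η`, with angle `π / 3` at `p` (the angles at ideal vertices are zero). -/
structure IdealTriangle where
  p : ℍ
  ξ : OnePoint ℝ
  η : OnePoint ℝ
  angle_eq : InnerProductGeometry.angle (direction p ξ) (direction p η) = Real.pi / 3

/-- The line `ℓ` contains the side `pξ`, `ξη` or `ηp`, respectively. -/
def IdealTriangle.IsSide (Δ : IdealTriangle) : Fin 3 → HypLine → Prop
  | 0, ℓ => Δ.p ∈ ℓ.points ∧ Δ.ξ ∈ ℓ.endpoints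
  | 1, ℓ => Δ.ξ ∈ ℓ.endpoints ∧ Δ.η ∈ ℓ.endpoints
  | 2, ℓ => Δ.η ∈ ℓ.endpoints ∧ Δ.p ∈ ℓ.points

/-- The reflection group of the triangle: the group of isometries of the hyperbolic plane
generated by the reflections in its three sides. -/
noncomputable def IdealTriangle.reflectionGroup (Δ : IdealTriangle) : Subgroup (ℍ ≃ᵢ ℍ) :=
  Subgroup.closure {σ | ∃ i ℓ, Δ.IsSide i ℓ ∧ ℓ.IsReflection σ}

end Trihex

/-!
Everything is read in the coordinates `(x, y)` of `place`, in which the rhombus is the unit square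
and a linear map is given by its matrix in the basis `v₁, v₂`.

**Integrality.** A surface glued from unit squares projects to the torus `ℝ² / ℤ²`; the projection
is a covering of the torus punctured at `0` (`Gluing.isCoveringMapOn_proj`). A homeomorphism is
affine with derivative `N` as soon as it changes the projection of displacements by `N`
(`Gluing.isAffine_of_proj`). Conversely, take the four straight segments from the center of a square
to its vertices. None of them can be extended in the surface, hence neither can its image under
an affine automorphism, and so the projection of the image ends at `0`
(`Gluing.proj_add_eq_zero_of_vertex`). Comparing the endpoints shows that the derivative maps
`ℤ²` to itself.

**Generators.** Both surfaces have a symmetry which swaps the two coordinates, with derivative `R`.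
They decompose into horizontal cylinders made of three squares. The maps `(x, y) ↦ (-x + m y, y)`
of the cylinders fit together along their boundaries for `m = 2` and `m = -1`
(`Gluing.ShearSymm`), which gives `R P₀` and `P₁⁻¹ R P₀`.

**The line modulo three.** The derivatives preserve the line spanned by `(1, 1)` in `(ℤ / 3)²`.
The function `x - y + i` with values in `ℝ / 3ℤ` is well defined on both surfaces, and a straight
path of direction `w ∈ ℤ²` and unit duration returns to a copy of its starting point with the same
index `i` if and only if `w` is in that line modulo three. On `Z°` this is the same as being closed,
and the trajectories in the direction `(1, 1)` go to closed trajectories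
(`preservesDiagonal_of_mem_veechGroupInBasis_Z`). On `S` such a path moves its starting point by a
translation of the lattice `2Λ`. For `w` not in `3ℤ²` it is nontrivial, because `x + y - c₀`, where
`c₀` is the first coordinate of the center of the hexagon, is also well defined modulo three. As the
lattice is torsion free, these trajectories never close up, whereas the horizontal ones do
(`not_dvd_of_mem_veechGroupInBasis_S`). Hence no element of the Veech group takes the horizontal
line modulo three to the line of `(1, 1)`. The generators move the horizontal line to the two
remaining lines, so they are not taken to the line of `(1, 1)` either.

**The group.** As `GL(2, ℤ)` is generated by `S`, `T` and `R`, a computation with representatives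
shows that the subgroup generated by the three matrices and `-1` has at most four cosets. They are
told apart by the preimage of the line of `(1, 1)`, so that the group is the full stabilizer of that
line (`mem_diagGroup_iff`), of index four.

**Triangles.** The generators fix exactly the unit circle and the lines `Re z = 1` and
`Re z = -1/2`, the sides of the triangle with vertices `e^{2πi/3}`, `1`, `∞`. An isometry is
determined by its set of fixed points when that is a line, since it preserves distances to the
points of the line (`isReflection_unique`). Every other `(3, ∞, ∞)`-triangle is the image of this
one under a Möbius or anti-Möbius transformation (`exists_mapsTo`), which conjugates one reflection
group to the other.
-/

namespace Trihex

variable {T : Type}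

/-! ### The projection to the square torus and holonomy functions -/

/-- The torus `ℝ² / ℤ²`. -/
abbrev Torus : Type := UnitAddCircle × UnitAddCircle

/-- The quotient map `ℝ² → ℝ² / ℤ²`. -/
def torusMk : ℝ × ℝ →+ Torus :=
  (QuotientAddGroup.mk' (AddSubgroup.zmultiples (1 : ℝ))).prodMap
    (QuotientAddGroup.mk' (AddSubgroup.zmultiples (1 : ℝ)))

theorem torusMk_apply (w : ℝ × ℝ) :
    torusMk w = ((w.1 : UnitAddCircle), (w.2 : UnitAddCircle)) := rfl

theorem continuous_torusMk : Continuous torusMk :=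
  ((AddCircle.continuous_mk' 1).comp continuous_fst).prodMk
    ((AddCircle.continuous_mk' 1).comp continuous_snd)

theorem isOpenMap_torusMk : IsOpenMap torusMk :=
  QuotientAddGroup.isOpenMap_coe.prodMap QuotientAddGroup.isOpenMap_coe

theorem torusMk_surjective : Function.Surjective torusMk :=
  Function.Surjective.prodMap (QuotientAddGroup.mk'_surjective _)
    (QuotientAddGroup.mk'_surjective _)

theorem torusMk_eq_zero_iff {w : ℝ × ℝ} :
    torusMk w = 0 ↔ ∃ m n : ℤ, w = ((m : ℝ), (n : ℝ)) := by
  rw [torusMk_apply, Prod.mk_eq_zero, AddCircle.coe_eq_zero_iff, AddCircle.coe_eq_zero_iff]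
  constructor
  · rintro ⟨⟨m, hm⟩, ⟨n, hn⟩⟩
    exact ⟨m, n, Prod.ext (by simpa using hm.symm) (by simpa using hn.symm)⟩
  · rintro ⟨m, n, rfl⟩
    exact ⟨⟨m, by simp⟩, ⟨n, by simp⟩⟩

theorem torusMk_eq_iff {w w' : ℝ × ℝ} :
    torusMk w = torusMk w' ↔ ∃ m n : ℤ, w = w' + ((m : ℝ), (n : ℝ)) := by
  rw [← sub_eq_zero, ← map_sub, torusMk_eq_zero_iff]
  simp only [sub_eq_iff_eq_add']

theorem torusMk_ne_zero (p : Rhombus) : torusMk p.val ≠ 0 := by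
  intro h
  obtain ⟨m, n, hmn⟩ := torusMk_eq_zero_iff.1 h
  obtain ⟨⟨x, y⟩, ⟨hx0, hx1⟩, ⟨hy0, hy1⟩, hc⟩ := p
  obtain ⟨rfl, rfl⟩ := Prod.mk.injEq .. ▸ hmn
  simp only at hx0 hx1 hy0 hy1 hc
  have a1 : 0 ≤ m := by exact_mod_cast hx0
  have a2 : m ≤ 1 := by exact_mod_cast hx1
  have a3 : 0 ≤ n := by exact_mod_cast hy0
  have a4 : n ≤ 1 := by exact_mod_cast hy1
  apply hc
  constructor
  · have : m = 0 ∨ m = 1 := by omega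
    rcases this with rfl | rfl <;> simp
  · have : n = 0 ∨ n = 1 := by omega
    rcases this with rfl | rfl <;> simp

/-- The kernel `ℤ²` of `torusMk` is discrete: a function with values in it which tends to an element
is eventually equal to it. -/
theorem eventually_eq_of_torusMk {α : Type*} {l : Filter α} {d : α → ℝ × ℝ} {c : ℝ × ℝ}
    (hd : Filter.Tendsto d l (𝓝 c)) (h : ∀ᶠ y in l, torusMk (d y) = torusMk c) :
    ∀ᶠ y in l, d y = c := by
  have h1 : ∀ᶠ y in l, dist (d y) c < 1 := hd.eventually (Metric.ball_mem_nhds c one_pos)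
  filter_upwards [h, h1] with y h2 h3
  obtain ⟨m, n, hmn⟩ := torusMk_eq_iff.1 h2
  rw [hmn, dist_eq_norm, add_sub_cancel_left, Prod.norm_def, max_lt_iff, Real.norm_eq_abs,
    Real.norm_eq_abs] at h3
  have hm : |(m : ℝ)| < 1 := h3.1
  have hn : |(n : ℝ)| < 1 := h3.2
  norm_cast at hm hn
  rw [Int.abs_lt_one_iff] at hm hn
  rw [hmn, hm, hn]
  simp

namespace Gluing
variable (G : Gluing T)

/-- The projection of the surface to the torus `ℝ² / ℤ²` which is the quotient map on every copy
of the rhombus. -/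
def proj : G.Surface → Torus :=
  Quot.lift (fun a => torusMk a.2.val) (by
    rintro _ _ (⟨t, p, q, hp, hq, h⟩ | ⟨t, p, q, hp, hq, h⟩)
    · exact torusMk_eq_iff.2 ⟨1, 0, Prod.ext (by simp [hp, hq]) (by simp [h])⟩
    · exact torusMk_eq_iff.2 ⟨0, 1, Prod.ext (by simp [h]) (by simp [hp, hq])⟩)

variable {G}

@[simp] theorem proj_pt (t : T) (p : Rhombus) : G.proj (G.pt t p) = torusMk p.val := rfl

theorem exists_pt (x : G.Surface) : ∃ t p, G.pt t p = x := by
  induction x using Quot.ind with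
  | mk a => exact ⟨a.1, a.2, rfl⟩

theorem continuous_proj : Continuous G.proj :=
  continuous_quot_lift _ (continuous_sigma fun _ => continuous_torusMk.comp continuous_subtype_val)

theorem proj_ne_zero (x : G.Surface) : G.proj x ≠ 0 := by
  obtain ⟨t, p, rfl⟩ := exists_pt x
  exact torusMk_ne_zero p

theorem exists_patch_of_mem_atlas {e : OpenPartialHomeomorph G.Surface Plane}
    (he : e ∈ atlas Plane G.Surface) : ∃ P : G.Patch, e = P.chart := by
  obtain ⟨t, h | h⟩ := he
  exacts [⟨_, h⟩, ⟨_, h⟩]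

/-- A map `κ` from the surface to a group changes, near every point, by `φ` of the displacement in
the coordinates of `place`. -/
def IsHolonomy {C : Type*} [AddCommGroup C] (κ : G.Surface → C) (φ : ℝ × ℝ →+ C) : Prop :=
  ∀ e ∈ atlas Plane G.Surface, ∀ x ∈ e.source,
    ∀ᶠ y in 𝓝 x, κ y = κ x + φ (place.symm (e y) - place.symm (e x))

theorem isHolonomy_of_pt {C : Type*} [AddCommGroup C] {κ : G.Surface → C} {φ : ℝ × ℝ →+ C}
    (k : T → C) (h : ∀ t p, κ (G.pt t p) = k t + φ p.val) : IsHolonomy κ φ := by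
  intro e he x hx
  obtain ⟨P, rfl⟩ := exists_patch_of_mem_atlas he
  filter_upwards [P.eventually_common x hx, P.chart.open_source.mem_nhds hx] with y h1 h2
  obtain ⟨a, q, q', rfl, rfl⟩ := h1
  have e1 := P.chart_mk_sub a q q' hx h2
  rw [← map_sub, e1, LinearEquiv.symm_apply_apply, map_sub, h, h]
  abel

theorem isHolonomy_proj : IsHolonomy G.proj torusMk :=
  isHolonomy_of_pt (fun _ => 0) (by simp)

end Gluing

/-- The linear map of `ℝ²` with matrix `N`. -/
def lin (N : Matrix (Fin 2) (Fin 2) ℝ) : ℝ × ℝ →ₗ[ℝ] ℝ × ℝ where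
  toFun w := (N 0 0 * w.1 + N 0 1 * w.2, N 1 0 * w.1 + N 1 1 * w.2)
  map_add' w w' := by ext <;> simp <;> ring
  map_smul' r w := by ext <;> simp <;> ring

theorem lin_apply (N : Matrix (Fin 2) (Fin 2) ℝ) (w : ℝ × ℝ) :
    lin N w = (N 0 0 * w.1 + N 0 1 * w.2, N 1 0 * w.1 + N 1 1 * w.2) := rfl

theorem continuous_lin (N : Matrix (Fin 2) (Fin 2) ℝ) : Continuous (lin N) :=
  (lin N).continuous_of_finiteDimensional

/-- The linear map of the plane whose matrix in the basis `v₁, v₂` is `N`. -/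
noncomputable def planeMat (N : GL (Fin 2) ℝ) : GL (Fin 2) ℝ := basisMatrix * N * basisMatrix⁻¹

theorem place_eq (w : ℝ × ℝ) : place w = -basisMatrix.val.mulVec ![w.1, w.2] := by
  have e1 : v 1 = ![-1 / 2, √3 / 2] := rfl
  have e2 : v 2 = ![-1 / 2, -√3 / 2] := rfl
  change w.1 • (-v 1) + w.2 • (-v 2) = _
  ext i
  fin_cases i
  · simp [e1, e2, basisMatrix, Matrix.GeneralLinearGroup.mkOfDetNeZero]; ring
  · simp [e1, e2, basisMatrix, Matrix.GeneralLinearGroup.mkOfDetNeZero]; ring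

/-- The coordinates of `place` refer to the basis `-v₁, -v₂`, in which a linear map has the same
matrix as in the basis `v₁, v₂`. -/
theorem planeMat_mulVec_place (N : GL (Fin 2) ℝ) (w : ℝ × ℝ) :
    (planeMat N).val.mulVec (place w) = place (lin N.val w) := by
  have h : basisMatrix⁻¹.val * basisMatrix.val = 1 := by rw [← Units.val_mul]; simp
  rw [place_eq, place_eq, planeMat, Units.val_mul, Units.val_mul, Matrix.mulVec_neg,
    Matrix.mulVec_mulVec, Matrix.mul_assoc, h, Matrix.mul_one, ← Matrix.mulVec_mulVec]
  congr 2
  ext i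
  fin_cases i <;> simp [lin_apply]

theorem planeMat_mulVec (N : GL (Fin 2) ℝ) (u : Plane) :
    (planeMat N).val.mulVec u = place (lin N.val (place.symm u)) := by
  rw [← planeMat_mulVec_place, LinearEquiv.apply_symm_apply]

theorem continuous_place_symm : Continuous place.symm :=
  place.symm.toContinuousLinearEquiv.continuous

namespace Gluing
variable {G : Gluing T}

/-- An affine automorphism changes the displacement of a holonomy function by its derivative. -/
theorem IsHolonomy.comp {C : Type*} [AddCommGroup C] {κ : G.Surface → C} {φ : ℝ × ℝ →+ C}
    (h : IsHolonomy κ φ) {f : G.Surface ≃ₜ G.Surface} {N : GL (Fin 2) ℝ}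
    (hf : IsAffineWithDerivative f (planeMat N)) :
    IsHolonomy (κ ∘ f) (φ.comp (lin N.val).toAddMonoidHom) := by
  intro e he x hx
  have h1 := mem_chart_source Plane (f x)
  have h2 := chart_mem_atlas Plane (f x)
  obtain ⟨c, hc⟩ := hf e he _ h2 x hx h1
  have h3 := h _ h2 _ h1
  have hx' := hc.self_of_nhds
  filter_upwards [hc, f.continuous.continuousAt.eventually h3] with y hy1 hy2
  rw [Function.comp_apply, hy2, hy1, hx', ← map_sub, add_sub_add_right_eq_sub, ← Matrix.mulVec_sub,
    planeMat_mulVec]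
  simp

/-- A homeomorphism which induces the linear map `N` on the torus is affine with derivative `N`:
in the charts, its difference from `N` is continuous with values in a coset of `ℤ²`. -/
theorem isAffine_of_proj {f : G.Surface ≃ₜ G.Surface} {N : GL (Fin 2) ℝ}
    (hf : IsHolonomy (G.proj ∘ f) (torusMk.comp (lin N.val).toAddMonoidHom)) :
    IsAffineWithDerivative f (planeMat N) := by
  intro e he e' he' x hx hx'
  refine ⟨e' (f x) - (planeMat N).val.mulVec (e x), ?_⟩
  have h1 := f.continuous.continuousAt.eventually (isHolonomy_proj (G := G) e' he' _ hx')
  have h2 := hf e he x hx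
  have ce : ContinuousAt e x := e.continuousAt hx
  have ce' : ContinuousAt (fun y => e' (f y)) x :=
    ContinuousAt.comp (e'.continuousAt hx') f.continuous.continuousAt
  set d : G.Surface → ℝ × ℝ := fun y =>
    (place.symm (e' (f y)) - place.symm (e' (f x))) -
      lin N.val (place.symm (e y) - place.symm (e x)) with hd
  have hdc : ContinuousAt d x :=
    ((continuous_place_symm.continuousAt.comp ce').sub continuousAt_const).sub
      ((continuous_lin _).continuousAt.comp
        ((continuous_place_symm.continuousAt.comp ce).sub continuousAt_const))
  have hd0 : d x = 0 := by simp [hd]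
  have hdt : Filter.Tendsto d (𝓝 x) (𝓝 0) := hd0 ▸ hdc.tendsto
  have h3 : ∀ᶠ y in 𝓝 x, torusMk (d y) = torusMk 0 := by
    filter_upwards [h1, h2] with y h1 h2
    rw [Function.comp_apply, h1, Function.comp_apply, add_right_inj] at h2
    rw [hd, map_sub torusMk, h2]
    simp
  filter_upwards [eventually_eq_of_torusMk hdt h3] with y hy
  rw [hd, sub_eq_zero, ← map_sub] at hy
  have h4 := congrArg place hy
  rw [LinearEquiv.apply_symm_apply, ← planeMat_mulVec_place, map_sub place,
    LinearEquiv.apply_symm_apply, LinearEquiv.apply_symm_apply, Matrix.mulVec_sub] at h4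
  rw [sub_eq_iff_eq_add.1 h4]
  abel

/-- A map `γ` into the surface from a space `A` with a time function `τ` is a parametrized straight
line with velocity `w`. It is enough to prescribe the projection to the torus, as `γ` is
continuous. -/
def IsTrajectory {A : Type*} [TopologicalSpace A] (τ : A → ℝ) (γ : A → G.Surface)
    (w : ℝ × ℝ) : Prop :=
  Continuous τ ∧ Continuous γ ∧
    ∀ a b, G.proj (γ b) = G.proj (γ a) + torusMk ((τ b - τ a) • w)

/-- Along a trajectory, a holonomy function changes by its value at the total displacement. -/
theorem IsHolonomy.trajectory {C : Type*} [AddCommGroup C] {κ : G.Surface → C}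
    {φ : ℝ × ℝ →+ C} (h : IsHolonomy κ φ) {A : Type*} [TopologicalSpace A] [PreconnectedSpace A]
    {τ : A → ℝ} {γ : A → G.Surface} {w : ℝ × ℝ} (hγ : IsTrajectory τ γ w) (a b : A) :
    κ (γ b) = κ (γ a) + φ ((τ b - τ a) • w) := by
  obtain ⟨hτ, hc, hp⟩ := hγ
  have key : IsLocallyConstant fun a => κ (γ a) - φ (τ a • w) := by
    rw [IsLocallyConstant.iff_eventually_eq]
    intro a
    set e := chartAt Plane (γ a)
    have hx : γ a ∈ e.source := mem_chart_source Plane (γ a)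
    have he := chart_mem_atlas Plane (γ a)
    have h1 := hc.continuousAt.eventually (h e he _ hx)
    have h2 := hc.continuousAt.eventually (isHolonomy_proj e he _ hx)
    have hdc : ContinuousAt (fun b => place.symm (e (γ b)) - place.symm (e (γ a))
        - (τ b - τ a) • w) a :=
      ((continuous_place_symm.continuousAt.comp
        (ContinuousAt.comp (e.continuousAt hx) hc.continuousAt)).sub continuousAt_const).sub
        (by fun_prop)
    have hdt := hdc.tendsto
    simp only [sub_self, zero_smul] at hdt
    have h3 := eventually_eq_of_torusMk hdt (by
      filter_upwards [h2] with b hb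
      rw [hp a b, add_right_inj] at hb
      rw [map_sub torusMk, ← hb, sub_self, map_zero])
    filter_upwards [h1, h3] with b hb1 hb2
    rw [hb1, sub_eq_zero.1 hb2, sub_smul, map_sub]
    abel
  have h1 : κ (γ a) - φ (τ a • w) = κ (γ b) - φ (τ b • w) := key.apply_eq_of_preconnectedSpace a b
  rw [sub_smul, map_sub, ← add_sub_assoc, add_sub_right_comm, h1, sub_add_cancel]

theorem IsTrajectory.comp {A : Type*} [TopologicalSpace A] [PreconnectedSpace A]
    {τ : A → ℝ} {γ : A → G.Surface} {w : ℝ × ℝ} (hγ : IsTrajectory τ γ w)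
    {f : G.Surface ≃ₜ G.Surface} {N : GL (Fin 2) ℝ}
    (hf : IsAffineWithDerivative f (planeMat N)) :
    IsTrajectory τ (f ∘ γ) (lin N.val w) := by
  refine ⟨hγ.1, f.continuous.comp hγ.2.1, fun a b => ?_⟩
  have := (isHolonomy_proj.comp hf).trajectory hγ a b
  simpa using this

end Gluing

/-! ### The surface covers the punctured torus -/

namespace Gluing
variable {G : Gluing T}

/-- The points at one position in different copies of the rhombus are different: a patch
shows this position in its two copies at coordinates which differ by `e ≠ 0`. -/
theorem pt_injective (p : Rhombus) : Function.Injective fun t => G.pt t p := by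
  have key : ∀ (P : T → G.Patch), (∀ t, (P t).t = t) → (∀ t t', (P t).n = (P t').n → t = t') →
      (∀ t, (P t).e ≠ 0) → (∀ t, ∃ n, (P n).n = t) →
      (∀ t, p.val ∈ (P t).V) ∨ (∀ t, p.val + (P t).e ∈ (P t).V) →
      Function.Injective fun t => G.pt t p := by
    intro P ht hn he hs hV t t' h
    replace h : G.pt t p = G.pt t' p := h
    rcases hV with hV | hV
    · have h1 := ((P t).inImage_mk {p.val} (by simpa using hV t) t p).2 (Or.inl ⟨(ht t).symm, rfl⟩)
      rw [h, Patch.inImage_mk] at h1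
      rcases h1 with ⟨h1, -⟩ | ⟨-, h1⟩
      · rw [h1, ht]
      · exact absurd (by simpa using h1) (he t)
    · obtain ⟨n, rfl⟩ := hs t
      have h1 := ((P n).inImage_mk {p.val + (P n).e} (by simpa using hV n) (P n).n p).2
        (Or.inr ⟨rfl, rfl⟩)
      rw [h, Patch.inImage_mk] at h1
      rcases h1 with ⟨-, h1⟩ | ⟨h1, -⟩
      · exact absurd (by simpa using h1) (he n)
      · exact h1.symm
  obtain ⟨⟨x, y⟩, hp⟩ := p
  have hR := hp
  simp only [Rhombus, Set.mem_ofPred_eq] at hR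
  by_cases hy : 0 < y ∧ y < 1
  · refine key G.rightPatch (fun _ => rfl) (fun _ _ h => G.right.injective h)
      (fun t => by simp [rightPatch]) G.right.surjective ?_
    by_cases hx : 0 < x
    · exact Or.inl fun t => ⟨⟨hx, by linarith [hR.1.2]⟩, hy⟩
    · refine Or.inr fun t => ⟨⟨?_, ?_⟩, ?_⟩ <;> simp [rightPatch] <;> grind
  · refine key G.upPatch (fun _ => rfl) (fun _ _ h => G.up.injective h)
      (fun t => by simp [upPatch]) G.up.surjective ?_
    by_cases hx : 0 < y
    · exact Or.inl fun t => ⟨by grind, ⟨hx, by linarith [hR.2.1.2]⟩⟩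
    · refine Or.inr fun t => ⟨?_, ⟨?_, ?_⟩⟩ <;> simp [upPatch] <;> grind

theorem Patch.proj_param {P : G.Patch} (he : torusMk P.e = 0) (w : P.V) :
    G.proj (P.param w) = torusMk w.val := by
  by_cases h : w.val ∈ Rhombus
  · rw [P.param_t w h, proj_pt]
  · rw [P.param_n w (P.cover w w.2 h), proj_pt, map_sub, he, sub_zero]

theorem torusMk_rightPatch (t : T) : torusMk (G.rightPatch t).e = 0 :=
  torusMk_eq_zero_iff.2 ⟨1, 0, by simp [rightPatch]⟩

theorem torusMk_upPatch (t : T) : torusMk (G.upPatch t).e = 0 :=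
  torusMk_eq_zero_iff.2 ⟨0, 1, by simp [upPatch]⟩

theorem isOpenMap_proj : IsOpenMap G.proj := by
  rw [isOpenMap_iff_nhds_le]
  intro x
  obtain ⟨P, he, w, rfl⟩ : ∃ P : G.Patch, torusMk P.e = 0 ∧ ∃ w, P.param w = x := by
    obtain ⟨e, ⟨t, rfl | rfl⟩, hx⟩ := G.exists_chart x
    · exact ⟨_, torusMk_rightPatch t, ((G.rightPatch t).mem_chart_source x).1 hx⟩
    · exact ⟨_, torusMk_upPatch t, ((G.upPatch t).mem_chart_source x).1 hx⟩
  have h1 : IsOpenMap (G.proj ∘ P.param) := by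
    have : G.proj ∘ P.param = torusMk ∘ Subtype.val := funext (Patch.proj_param he)
    rw [this]
    exact isOpenMap_torusMk.comp P.isOpen.isOpenMap_subtype_val
  rw [← P.isOpenEmbedding_param.map_nhds_eq, Filter.map_map]
  exact h1.nhds_le w

/-- A box in the plane over which all patches of a family have sections
gives an evenly covered open set of the torus. -/
theorem isEvenlyCovered_of_box [Nonempty T] (P : T → G.Patch) (B : Set (ℝ × ℝ)) (hB : IsOpen B)
    (hBV : ∀ t, B ⊆ (P t).V) (ht : ∀ t, (P t).t = t)
    (hn : ∀ t t', (P t).n = (P t').n → t = t') (he : ∀ t, torusMk (P t).e = 0)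
    (heq : ∀ t t', (P t).e = (P t').e)
    (hinj : ∀ w ∈ B, ∀ w' ∈ B, torusMk w = torusMk w' → w = w')
    (hex : ∀ t p, torusMk p.val ∈ torusMk '' B →
      ∃ t', ∃ w : (P t').V, w.val ∈ B ∧ (P t').param w = G.pt t p)
    (q : Torus) (hq : q ∈ torusMk '' B) : IsEvenlyCovered G.proj q (G.proj ⁻¹' {q}) := by
  let _ : TopologicalSpace T := ⊥
  have : DiscreteTopology T := ⟨rfl⟩
  obtain ⟨t₀⟩ := ‹Nonempty T›
  have : Nonempty (Torus → G.Surface) :=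
    ⟨fun _ => G.pt t₀ ⟨(1 / 2, 1 / 2), by simp [Rhombus]; norm_num⟩⟩
  have : Nonempty T := ⟨t₀⟩
  set U : T → Set G.Surface := fun t => (P t).param '' {w | w.val ∈ B} with hU
  have hUo : ∀ t, IsOpen (U t) := fun t =>
    (P t).isOpenMap_param _ (hB.preimage continuous_subtype_val)
  have surj : ∀ t, (U t).SurjOn G.proj (torusMk '' B) := by
    rintro t _ ⟨w, hw, rfl⟩
    exact ⟨_, ⟨⟨w, hBV t hw⟩, hw, rfl⟩, Patch.proj_param (he t) _⟩
  have hx : q ∈ (IsOpen.trivializationDiscrete (f := G.proj) U (torusMk '' B)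
      (isOpenMap_torusMk _ hB) ?_ ?_ surj ?_ ?_).baseSet := by
    rw [IsOpen.trivializationDiscrete_baseSet]
    exact hq
  · intro t W hW
    refine ⟨fun h => (h.preimage continuous_proj).inter (hUo t), fun h => ?_⟩
    have : G.proj '' (G.proj ⁻¹' W ∩ U t) = W := by
      rw [Set.image_preimage_inter]
      exact Set.inter_eq_left.2 (hW.trans (surj t))
    rw [← this]
    exact isOpenMap_proj _ h
  · rintro t _ ⟨w, hw, rfl⟩ _ ⟨w', hw', rfl⟩ h
    rw [Patch.proj_param (he t), Patch.proj_param (he t)] at h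
    rw [Subtype.ext (hinj _ hw _ hw' h)]
  · intro t t' htt'
    rw [Function.onFun, Set.disjoint_left]
    rintro _ ⟨w, hw, rfl⟩ ⟨w', hw', h⟩
    have h1 := congrArg G.proj h
    rw [Patch.proj_param (he t), Patch.proj_param (he t')] at h1
    have h2 : w'.val = w.val := hinj _ hw' _ hw h1
    apply htt'
    by_cases hR : w.val ∈ Rhombus
    · rw [(P t).param_t w hR, (P t').param_t w' (h2 ▸ hR)] at h
      simp only [h2] at h
      have h3 := pt_injective _ h
      rwa [ht, ht, eq_comm] at h3
    · have hR1 := (P t).cover _ w.2 hR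
      have hR2 : w'.val - (P t').e ∈ Rhombus := by rwa [h2, heq t' t]
      rw [(P t).param_n w hR1, (P t').param_n w' hR2] at h
      simp only [h2, heq t' t] at h
      exact (hn _ _ (pt_injective _ h)).symm
  · intro x hx
    obtain ⟨t, p, rfl⟩ := exists_pt x
    obtain ⟨t', w, hw, h⟩ := hex t p hx
    exact Set.mem_iUnion.2 ⟨t', w, hw, h⟩
  · exact (IsEvenlyCovered.of_trivialization hx).to_isEvenlyCovered_preimage

theorem eq_of_int_of_mem_Ioo {c x x' : ℝ} {m : ℤ} (h : x = x' + m) (h1 : c < x) (h2 : x < c + 1)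
    (h3 : c < x') (h4 : x' < c + 1) : m = 0 := by
  have a1 : (m : ℝ) < 1 := by linarith
  have a2 : (-1 : ℝ) < m := by linarith
  have b1 : m < 1 := by exact_mod_cast a1
  have b2 : -1 < m := by exact_mod_cast a2
  omega

theorem exists_int_mem_Ioo {c : ℝ} (x : ℝ) (h : ∀ m : ℤ, x ≠ c + m) :
    ∃ m : ℤ, c < x + m ∧ x + m < c + 1 := by
  refine ⟨-⌊x - c⌋, ?_, ?_⟩
  · have h1 := Int.floor_le (x - c)
    have h2 := h ⌊x - c⌋
    push_cast
    rcases h1.lt_or_eq with h3 | h3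
    · linarith
    · exact absurd (by linarith) h2
  · have := Int.lt_floor_add_one (x - c)
    push_cast
    linarith

theorem exists_ne_add_int (x : ℝ) : ∃ c : ℝ, 0 ≤ c ∧ c < 1 ∧ ∀ m : ℤ, x ≠ c + m := by
  refine ⟨Int.fract (x + 1 / 2), Int.fract_nonneg _, Int.fract_lt_one _, fun m h => ?_⟩
  have h1 : x + 1 / 2 = ⌊x + 1 / 2⌋ + Int.fract (x + 1 / 2) := (Int.floor_add_fract _).symm
  have h2 : (2 : ℝ) * (⌊x + 1 / 2⌋ - m) = 1 := by linarith
  have h3 : 2 * (⌊x + 1 / 2⌋ - m) = 1 := by exact_mod_cast h2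
  omega

theorem ne_of_add_int {x c : ℝ} {m : ℤ} (h1 : c < x + m) (h2 : x + m < c + 1) :
    x ≠ c ∧ x ≠ c + 1 := by
  constructor
  · rintro rfl
    have a1 : (0 : ℝ) < m := by linarith
    have a2 : (m : ℝ) < 1 := by linarith
    norm_cast at a1 a2
    omega
  · rintro rfl
    have a1 : (-1 : ℝ) < m := by linarith
    have a2 : (m : ℝ) < 0 := by linarith
    norm_cast at a1 a2
    omega

theorem mem_Ioo_of_add_int {y : ℝ} {n : ℤ} (hy : 0 ≤ y ∧ y ≤ 1) (h1 : 0 < y + n)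
    (h2 : y + n < 1) : 0 < y ∧ y < 1 := by
  obtain ⟨h3, h4⟩ := ne_of_add_int h1 (by linarith : y + n < 0 + 1)
  exact ⟨lt_of_le_of_ne hy.1 h3.symm, lt_of_le_of_ne hy.2 (by simpa using h4)⟩

/-- Away from the horizontal edges, the boxes of width one inside the right patches
cover the torus evenly. -/
theorem isEvenlyCovered_right [Nonempty T] (q : ℝ × ℝ) (hq : ∀ m : ℤ, q.2 ≠ m) :
    IsEvenlyCovered G.proj (torusMk q) (G.proj ⁻¹' {torusMk q}) := by
  obtain ⟨c, hc0, hc1, hcq⟩ := exists_ne_add_int q.1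
  refine isEvenlyCovered_of_box G.rightPatch {w | (c < w.1 ∧ w.1 < c + 1) ∧ (0 < w.2 ∧ w.2 < 1)}
    ?_ ?_ (fun _ => rfl) (fun _ _ h => G.right.injective h) torusMk_rightPatch (fun _ _ => rfl)
    ?_ ?_ _ ?_
  · have h : ∀ a b : ℝ, IsOpen {x : ℝ | a < x ∧ x < b} := fun a b => isOpen_Ioo
    exact ((h _ _).preimage continuous_fst).inter ((h _ _).preimage continuous_snd)
  · rintro t w ⟨⟨h1, h2⟩, h3⟩
    exact ⟨⟨by linarith, by linarith⟩, h3⟩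
  · rintro w ⟨⟨h1, h2⟩, h3, h4⟩ w' ⟨⟨h1', h2'⟩, h3', h4'⟩ h
    obtain ⟨m, n, rfl⟩ := torusMk_eq_iff.1 h
    simp only [Prod.fst_add, Prod.snd_add] at h1 h2 h3 h4
    rw [eq_of_int_of_mem_Ioo rfl h1 h2 h1' h2',
      eq_of_int_of_mem_Ioo (c := 0) rfl h3 (by linarith) h3' (by linarith)]
    simp
  · rintro t ⟨⟨x, y⟩, hp⟩ ⟨⟨x', y'⟩, ⟨⟨h1, h2⟩, h3, h4⟩, h⟩
    obtain ⟨m, n, hmn⟩ := torusMk_eq_iff.1 h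
    obtain ⟨rfl, rfl⟩ := Prod.mk.injEq .. ▸ hmn
    have hR := hp
    simp only [Rhombus, Set.mem_ofPred_eq] at hR h1 h2 h3 h4
    have hy : 0 < y ∧ y < 1 := mem_Ioo_of_add_int hR.2.1 h3 h4
    have hxc : x ≠ c ∧ x ≠ c + 1 := ne_of_add_int h1 h2
    by_cases hcx : c < x
    · refine ⟨t, ⟨(x, y), ⟨⟨by linarith, by linarith⟩, hy⟩⟩, ⟨⟨hcx, ?_⟩, hy⟩,
        (G.rightPatch t).param_t _ hp⟩
      exact lt_of_le_of_ne (by linarith) hxc.2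
    · obtain ⟨t', rfl⟩ := G.right.surjective t
      have hxc2 : x < c := lt_of_le_of_ne (not_lt.1 hcx) hxc.1
      have hV : (x + 1, y) ∈ (G.rightPatch t').V := ⟨⟨by linarith, by linarith⟩, hy⟩
      have h5 : ((x, y) : ℝ × ℝ) = (x + 1, y) - (1, 0) := by simp
      refine ⟨t', ⟨(x + 1, y), hV⟩, ⟨⟨by simp only; linarith, by simp only; linarith⟩, hy⟩, ?_⟩
      rw [(G.rightPatch t').param_n ⟨(x + 1, y), hV⟩ (by rw [h5] at hp; exact hp)]
      change G.pt (G.right t') _ = _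
      congr 1
      exact Subtype.ext h5.symm
  · obtain ⟨m, hm⟩ := exists_int_mem_Ioo q.1 hcq
    obtain ⟨n, hn⟩ := exists_int_mem_Ioo (c := 0) q.2 (by simpa using hq)
    rw [zero_add] at hn
    exact ⟨q + ((m : ℝ), (n : ℝ)), ⟨hm, hn⟩, torusMk_eq_iff.2 ⟨m, n, rfl⟩⟩

/-- Away from the vertical edges, the boxes of height one inside the up patches
cover the torus evenly. -/
theorem isEvenlyCovered_up [Nonempty T] (q : ℝ × ℝ) (hq : ∀ m : ℤ, q.1 ≠ m) :
    IsEvenlyCovered G.proj (torusMk q) (G.proj ⁻¹' {torusMk q}) := by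
  obtain ⟨c, hc0, hc1, hcq⟩ := exists_ne_add_int q.2
  refine isEvenlyCovered_of_box G.upPatch {w | (0 < w.1 ∧ w.1 < 1) ∧ (c < w.2 ∧ w.2 < c + 1)}
    ?_ ?_ (fun _ => rfl) (fun _ _ h => G.up.injective h) torusMk_upPatch (fun _ _ => rfl)
    ?_ ?_ _ ?_
  · have h : ∀ a b : ℝ, IsOpen {x : ℝ | a < x ∧ x < b} := fun a b => isOpen_Ioo
    exact ((h _ _).preimage continuous_fst).inter ((h _ _).preimage continuous_snd)
  · rintro t w ⟨h3, ⟨h1, h2⟩⟩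
    exact ⟨h3, ⟨by linarith, by linarith⟩⟩
  · rintro w ⟨⟨h3, h4⟩, h1, h2⟩ w' ⟨⟨h3', h4'⟩, h1', h2'⟩ h
    obtain ⟨m, n, rfl⟩ := torusMk_eq_iff.1 h
    simp only [Prod.fst_add, Prod.snd_add] at h1 h2 h3 h4
    rw [eq_of_int_of_mem_Ioo rfl h1 h2 h1' h2',
      eq_of_int_of_mem_Ioo (c := 0) rfl h3 (by linarith) h3' (by linarith)]
    simp
  · rintro t ⟨⟨y, x⟩, hp⟩ ⟨⟨y', x'⟩, ⟨⟨h3, h4⟩, h1, h2⟩, h⟩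
    obtain ⟨n, m, hmn⟩ := torusMk_eq_iff.1 h
    obtain ⟨rfl, rfl⟩ := Prod.mk.injEq .. ▸ hmn
    have hR := hp
    simp only [Rhombus, Set.mem_ofPred_eq] at hR h1 h2 h3 h4
    have hy : 0 < y ∧ y < 1 := mem_Ioo_of_add_int hR.1 h3 h4
    have hxc : x ≠ c ∧ x ≠ c + 1 := ne_of_add_int h1 h2
    by_cases hcx : c < x
    · refine ⟨t, ⟨(y, x), ⟨hy, ⟨by linarith, by linarith⟩⟩⟩, ⟨hy, ⟨hcx, ?_⟩⟩,
        (G.upPatch t).param_t _ hp⟩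
      exact lt_of_le_of_ne (by linarith) hxc.2
    · obtain ⟨t', rfl⟩ := G.up.surjective t
      have hxc2 : x < c := lt_of_le_of_ne (not_lt.1 hcx) hxc.1
      have hV : (y, x + 1) ∈ (G.upPatch t').V := ⟨hy, ⟨by linarith, by linarith⟩⟩
      have h5 : ((y, x) : ℝ × ℝ) = (y, x + 1) - (0, 1) := by simp
      refine ⟨t', ⟨(y, x + 1), hV⟩, ⟨hy, ⟨by simp only; linarith, by simp only; linarith⟩⟩, ?_⟩
      rw [(G.upPatch t').param_n ⟨(y, x + 1), hV⟩ (by rw [h5] at hp; exact hp)]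
      change G.pt (G.up t') _ = _
      congr 1
      exact Subtype.ext h5.symm
  · obtain ⟨m, hm⟩ := exists_int_mem_Ioo q.2 hcq
    obtain ⟨n, hn⟩ := exists_int_mem_Ioo (c := 0) q.1 (by simpa using hq)
    rw [zero_add] at hn
    exact ⟨q + ((n : ℝ), (m : ℝ)), ⟨hn, hm⟩, torusMk_eq_iff.2 ⟨n, m, rfl⟩⟩

theorem isCoveringMapOn_proj [Nonempty T] : IsCoveringMapOn G.proj {0}ᶜ := by
  intro q hq
  obtain ⟨w, rfl⟩ := torusMk_surjective q
  by_cases h2 : ∀ m : ℤ, w.2 ≠ m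
  · exact isEvenlyCovered_right w h2
  · refine isEvenlyCovered_up w fun m hm => hq ?_
    push Not at h2
    obtain ⟨n, hn⟩ := h2
    exact torusMk_eq_zero_iff.2 ⟨m, n, Prod.ext hm hn⟩

/-- Lifting of paths in the punctured torus. -/
theorem exists_lift [Nonempty T] (c : unitInterval → Torus) (hc : Continuous c)
    (h0 : ∀ s, c s ≠ 0) (x : G.Surface) (hx : G.proj x = c 0) :
    ∃ Γ : unitInterval → G.Surface, Continuous Γ ∧ (∀ s, G.proj (Γ s) = c s) ∧ Γ 0 = x := by
  have cov := (isCoveringMapOn_proj (G := G)).isCoveringMap_restrictPreimage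
  obtain ⟨Γ, h1, h2⟩ := cov.exists_path_lifts ⟨fun s => ⟨c s, h0 s⟩, by fun_prop⟩
    ⟨x, proj_ne_zero x⟩ (Subtype.ext hx.symm)
  refine ⟨fun s => (Γ s).val, by fun_prop, fun s => ?_, congrArg Subtype.val h2⟩
  exact congrArg Subtype.val (congrFun h1 s)

/-- Uniqueness of lifts. -/
theorem lift_unique [Nonempty T] {A : Type*} [TopologicalSpace A] [PreconnectedSpace A]
    {γ γ' : A → G.Surface} (hγ : Continuous γ) (hγ' : Continuous γ')
    (h : ∀ a, G.proj (γ a) = G.proj (γ' a)) (a : A) (ha : γ a = γ' a) : γ = γ' := by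
  have cov := (isCoveringMapOn_proj (G := G)).isCoveringMap_restrictPreimage
  have := cov.eq_of_comp_eq (g₁ := fun a => ⟨γ a, proj_ne_zero _⟩)
    (g₂ := fun a => ⟨γ' a, proj_ne_zero _⟩) (by fun_prop) (by fun_prop)
    (funext fun a => Subtype.ext (h a)) a (Subtype.ext ha)
  funext b
  exact congrArg Subtype.val (congrFun this b)

end Gluing

/-! ### Derivatives of affine automorphisms are integral -/

namespace Gluing
variable {G : Gluing T}

theorem continuous_smul_time {A : Type*} [TopologicalSpace A] {τ : A → ℝ} (hτ : Continuous τ)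
    (u w : ℝ × ℝ) : Continuous fun a => torusMk (u + τ a • w) :=
  continuous_torusMk.comp (by fun_prop)

/-- If a straight segment in a rhombus ends at a vertex, then so does its image under an affine
automorphism: otherwise the image could be extended. -/
theorem proj_add_eq_zero_of_vertex {f : G.Surface ≃ₜ G.Surface} {N : GL (Fin 2) ℝ}
    (hf : IsAffineWithDerivative f (planeMat N)) (t : T) (p : Rhombus) (w : ℝ × ℝ)
    (hw : ∀ s : ℝ, 0 ≤ s → s < 1 → p.val + s • w ∈ Rhombus) (h0 : torusMk (p.val + w) = 0) :
    G.proj (f (G.pt t p)) + torusMk (lin N.val w) = 0 := by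
  have : Nonempty T := ⟨t⟩
  by_contra hne
  -- `γ` is the segment without its endpoint, a vertex.
  have : PreconnectedSpace (Set.Ico (0 : ℝ) 1) := Subtype.preconnectedSpace isPreconnected_Ico
  set γ : Set.Ico (0 : ℝ) 1 → G.Surface :=
    fun s => G.pt t ⟨p.val + s.val • w, hw s s.2.1 s.2.2⟩ with hγ
  have hγc : Continuous γ := (G.continuous_pt t).comp (by fun_prop)
  have htr : IsTrajectory Subtype.val γ w := by
    refine ⟨continuous_subtype_val, hγc, fun a b => ?_⟩
    rw [hγ, proj_pt, proj_pt, ← map_add, sub_smul]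
    exact congrArg torusMk (by rw [add_assoc, add_sub_cancel])
  have htf := htr.comp hf
  have hstart : γ ⟨0, by simp⟩ = G.pt t p := by simp [hγ]
  obtain ⟨u, hu⟩ := torusMk_surjective (G.proj (f (G.pt t p)))
  have hval : ∀ s, G.proj (f (γ s)) = torusMk (u + s.val • lin N.val w) := by
    intro s
    have := htf.2.2 ⟨0, by simp⟩ s
    simp only [Function.comp_apply] at this
    rw [this, hstart, ← hu, map_add, sub_zero]
  -- The projection of `f ∘ γ`, with its endpoint added, misses `0` and so it lifts to the surface.
  obtain ⟨Γ, hΓ, hΓp, hΓ0⟩ := exists_lift (G := G)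
    (fun s : unitInterval => torusMk (u + s.val • lin N.val w))
    (continuous_smul_time continuous_subtype_val _ _) (by
      intro s
      rcases s.2.2.lt_or_eq with h | h
      · have h1 := hval ⟨s.val, s.2.1, h⟩
        simp only at h1
        rw [← h1]
        exact proj_ne_zero _
      · simpa [h, hu] using hne) (f (G.pt t p)) (by simp [hu])
  have hagree : f ∘ γ = fun s : Set.Ico (0 : ℝ) 1 => Γ ⟨s.val, s.2.1, s.2.2.le⟩ := by
    refine lift_unique (f.continuous.comp hγc) (hΓ.comp (by fun_prop)) (fun s => ?_)
      ⟨0, by simp⟩ ?_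
    · rw [hΓp, Function.comp_apply, hval]
    · rw [Function.comp_apply, hstart, ← hΓ0]
      rfl
  -- The inverse image of the lift extends `γ` by a point which projects to the vertex.
  have hext : (fun s => G.proj (f.symm (Γ s))) =
      fun s : unitInterval => torusMk (p.val + s.val • w) := by
    refine Continuous.ext_on (s := {s : unitInterval | s < 1}) ?_
      (continuous_proj.comp (f.symm.continuous.comp hΓ))
      (continuous_smul_time continuous_subtype_val _ _) fun s hs => ?_
    · have : {s : unitInterval | s < 1} = {1}ᶜ := by
        ext s
        simp only [Set.mem_ofPred_eq, Set.mem_compl_iff, Set.mem_singleton_iff]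
        exact ⟨fun h => h.ne, fun h => lt_of_le_of_ne s.2.2 h⟩
      rw [this]
      exact dense_compl_singleton _
    · have h1 := congrFun hagree ⟨s.val, s.2.1, hs⟩
      simp only [Function.comp_apply] at h1
      change G.proj (f.symm (Γ s)) = _
      have h2 : Γ s = f (γ ⟨s.val, s.2.1, hs⟩) := h1.symm
      rw [h2, f.symm_apply_apply, hγ, proj_pt]
  have h1 := congrFun hext 1
  simp only [Set.Icc.coe_one, one_smul] at h1
  rw [h0] at h1
  exact proj_ne_zero _ h1

/-- The center of the rhombus. -/
noncomputable def center : Rhombus := ⟨(1 / 2, 1 / 2), by simp [Rhombus]; norm_num⟩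

theorem center_add_smul_mem (w : ℝ × ℝ) (h1 : |w.1| = 1 / 2) (h2 : |w.2| = 1 / 2) (s : ℝ)
    (hs : 0 ≤ s) (hs1 : s < 1) : center.val + s • w ∈ Rhombus := by
  have key : ∀ x : ℝ, |x| = 1 / 2 → 0 < 1 / 2 + s * x ∧ 1 / 2 + s * x < 1 := by
    intro x hx
    rcases (abs_eq (by norm_num)).1 hx with rfl | rfl <;> constructor <;> linarith
  obtain ⟨a1, a2⟩ := key _ h1
  obtain ⟨b1, b2⟩ := key _ h2
  refine ⟨⟨a1.le, a2.le⟩, ⟨b1.le, b2.le⟩, fun h => ?_⟩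
  rcases h.1 with h | h
  · exact a1.ne' h
  · exact a2.ne h

theorem proj_add_eq_zero_of_corner {f : G.Surface ≃ₜ G.Surface} {N : GL (Fin 2) ℝ}
    (hf : IsAffineWithDerivative f (planeMat N)) (t : T) (a b : ℤ) (ha : a = 0 ∨ a = 1)
    (hb : b = 0 ∨ b = 1) :
    G.proj (f (G.pt t center)) + torusMk (lin N.val ((a : ℝ) - 1 / 2, (b : ℝ) - 1 / 2)) = 0 := by
  have key : ∀ a : ℤ, a = 0 ∨ a = 1 → |(a : ℝ) - 1 / 2| = 1 / 2 := by
    rintro a (rfl | rfl)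
    · simp
    · norm_num
  exact proj_add_eq_zero_of_vertex hf t center _
    (center_add_smul_mem _ (key a ha) (key b hb))
    (torusMk_eq_zero_iff.2 ⟨a, b, by simp [center]⟩)

theorem torusMk_lin_eq_zero {f : G.Surface ≃ₜ G.Surface} {N : GL (Fin 2) ℝ}
    (hf : IsAffineWithDerivative f (planeMat N)) (t : T) :
    torusMk (lin N.val (1, 0)) = 0 ∧ torusMk (lin N.val (0, 1)) = 0 := by
  have h00 := proj_add_eq_zero_of_corner hf t 0 0 (Or.inl rfl) (Or.inl rfl)
  have h10 := proj_add_eq_zero_of_corner hf t 1 0 (Or.inr rfl) (Or.inl rfl)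
  have h01 := proj_add_eq_zero_of_corner hf t 0 1 (Or.inl rfl) (Or.inr rfl)
  constructor
  · have h : ((1, 0) : ℝ × ℝ) = (((1 : ℤ) : ℝ) - 1 / 2, ((0 : ℤ) : ℝ) - 1 / 2) -
        (((0 : ℤ) : ℝ) - 1 / 2, ((0 : ℤ) : ℝ) - 1 / 2) := by ext <;> simp
    rw [h, map_sub, map_sub, sub_eq_zero]
    exact add_left_cancel (h10.trans h00.symm)
  · have h : ((0, 1) : ℝ × ℝ) = (((0 : ℤ) : ℝ) - 1 / 2, ((1 : ℤ) : ℝ) - 1 / 2) -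
        (((0 : ℤ) : ℝ) - 1 / 2, ((0 : ℤ) : ℝ) - 1 / 2) := by ext <;> simp
    rw [h, map_sub, map_sub, sub_eq_zero]
    exact add_left_cancel (h01.trans h00.symm)

theorem exists_int_entries {f : G.Surface ≃ₜ G.Surface} {N : GL (Fin 2) ℝ}
    (hf : IsAffineWithDerivative f (planeMat N)) (t : T) :
    ∃ A : Matrix (Fin 2) (Fin 2) ℤ, A.map (Int.castRingHom ℝ) = N.val := by
  obtain ⟨h1, h2⟩ := torusMk_lin_eq_zero hf t
  obtain ⟨a, c, h1⟩ := torusMk_eq_zero_iff.1 h1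
  obtain ⟨b, d, h2⟩ := torusMk_eq_zero_iff.1 h2
  simp only [lin_apply, mul_one, mul_zero, add_zero, zero_add, Prod.mk.injEq] at h1 h2
  refine ⟨!![a, b; c, d], ?_⟩
  ext i j
  fin_cases i <;> fin_cases j <;> simp [h1, h2]

end Gluing

/-- The Veech group in the basis `v₁, v₂` of the plane. -/
noncomputable def veechGroupInBasis (X : Type*) [TopologicalSpace X] [ChartedSpace Plane X]
    [TranslationSurface X] : Subgroup (GL (Fin 2) ℝ) :=
  (veechGroup X).comap (MulAut.conj basisMatrix).toMonoidHom

theorem mem_veechGroupInBasis {X : Type*} [TopologicalSpace X] [ChartedSpace Plane X]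
    [TranslationSurface X] {N : GL (Fin 2) ℝ} :
    N ∈ veechGroupInBasis X ↔ ∃ f : X ≃ₜ X, IsAffineWithDerivative f (planeMat N) := Iff.rfl

theorem projVeechGroupInBasis_eq (X : Type*) [TopologicalSpace X] [ChartedSpace Plane X]
    [TranslationSurface X] :
    projVeechGroupInBasis X = (veechGroupInBasis X).map Matrix.ProjGenLinGroup.mk := by
  ext g
  simp only [projVeechGroupInBasis, projVeechGroup, Subgroup.mem_map, veechGroupInBasis,
    Subgroup.mem_comap]
  constructor
  · rintro ⟨_, ⟨M, hM, rfl⟩, rfl⟩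
    refine ⟨basisMatrix⁻¹ * M * basisMatrix, ?_, ?_⟩
    · simpa [mul_assoc] using hM
    · simp
  · rintro ⟨N, hN, rfl⟩
    refine ⟨_, ⟨_, hN, rfl⟩, ?_⟩
    simp [mul_assoc]

/-- The inclusion of `GL(2, ℤ)` in `GL(2, ℝ)`. -/
noncomputable abbrev castGL : GL (Fin 2) ℤ →* GL (Fin 2) ℝ :=
  Matrix.GeneralLinearGroup.map (Int.castRingHom ℝ)

theorem castGL_apply (N : GL (Fin 2) ℤ) (i j : Fin 2) : (castGL N).val i j = (N.val i j : ℝ) := rfl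

theorem castGL_injective : Function.Injective castGL := by
  intro M N h
  ext i j
  have := congrArg (fun g : GL (Fin 2) ℝ => g.val i j) h
  simpa [castGL_apply] using this

/-- The elements of the Veech group have integral entries in the basis `v₁, v₂`. -/
theorem exists_castGL_eq {G : Gluing T} [Nonempty T] {N : GL (Fin 2) ℝ}
    (h : N ∈ veechGroupInBasis G.Surface) : ∃ A : GL (Fin 2) ℤ, castGL A = N := by
  obtain ⟨t⟩ := ‹Nonempty T›
  have h' := inv_mem h
  obtain ⟨f, hf⟩ := mem_veechGroupInBasis.1 h
  obtain ⟨g, hg⟩ := mem_veechGroupInBasis.1 h'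
  obtain ⟨A, hA⟩ := Gluing.exists_int_entries hf t
  obtain ⟨B, hB⟩ := Gluing.exists_int_entries hg t
  have inj : Function.Injective
      fun M : Matrix (Fin 2) (Fin 2) ℤ => M.map (Int.castRingHom ℝ) :=
    Matrix.map_injective Int.cast_injective
  have h1 : A * B = 1 := inj (by
    simp only
    rw [Matrix.map_mul, hA, hB, ← Units.val_mul]
    simp)
  have h2 : B * A = 1 := inj (by
    simp only
    rw [Matrix.map_mul, hA, hB, ← Units.val_mul]
    simp)
  exact ⟨⟨A, B, h1, h2⟩, Units.ext hA⟩

/-! ### Affine automorphisms -/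

/-- Involutions are enough: all three generators are reflections. -/
theorem mem_veechGroupInBasis_of_proj {G : Gluing T} (f : G.Surface → G.Surface)
    (hc : Continuous f) (hinv : ∀ x, f (f x) = x) (N : GL (Fin 2) ℝ)
    (hp : ∀ t p, G.proj (f (G.pt t p)) = torusMk (lin N.val p.val)) :
    N ∈ veechGroupInBasis G.Surface :=
  mem_veechGroupInBasis.2 ⟨⟨⟨f, f, hinv, hinv⟩, hc, hc⟩,
    Gluing.isAffine_of_proj (Gluing.isHolonomy_of_pt (fun _ => 0) fun t p => by
      simp only [zero_add]
      exact hp t p)⟩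

/-- The infinite horizontal strip of height one, without the integral points on its boundary. -/
def Strip : Set (ℝ × ℝ) :=
  {w | (0 ≤ w.2 ∧ w.2 ≤ 1) ∧ ((w.2 = 0 ∨ w.2 = 1) → ∀ m : ℤ, w.1 ≠ m)}

theorem mem_strip_of_mem_rhombus {p : ℝ × ℝ} (hp : p ∈ Rhombus) (n : ℤ) :
    ((n : ℝ) + p.1, p.2) ∈ Strip := by
  obtain ⟨⟨h1, h2⟩, h3, h4⟩ := hp
  refine ⟨h3, fun h m hm => h4 ⟨?_, h⟩⟩
  simp only at hm
  have h5 : p.1 = ((m - n : ℤ) : ℝ) := by push_cast; linarith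
  rw [h5] at h1 h2
  have a1 : 0 ≤ m - n := by exact_mod_cast h1
  have a2 : m - n ≤ 1 := by exact_mod_cast h2
  have a3 : m - n = 0 ∨ m - n = 1 := by omega
  rw [h5]
  exact_mod_cast a3

theorem fract_mem_rhombus {w : ℝ × ℝ} (hw : w ∈ Strip) : (Int.fract w.1, w.2) ∈ Rhombus := by
  refine ⟨⟨Int.fract_nonneg _, (Int.fract_lt_one _).le⟩, hw.1, ?_⟩
  rintro ⟨h1 | h1, h2⟩
  · obtain ⟨m, hm⟩ := Int.fract_eq_zero_iff.1 h1
    exact hw.2 h2 m hm.symm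
  · exact (Int.fract_lt_one w.1).ne h1

theorem shear_mem_strip (m : ℤ) {w : ℝ × ℝ} (hw : w ∈ Strip) : (-w.1 + m * w.2, w.2) ∈ Strip := by
  refine ⟨hw.1, fun h k hk => ?_⟩
  simp only at h hk
  rcases h with h | h
  · exact hw.2 (Or.inl h) (-k) (by push_cast; rw [h] at hk; linarith)
  · exact hw.2 (Or.inr h) (m - k) (by push_cast; rw [h] at hk; linarith)

theorem locallyFinite_unit_intervals :
    LocallyFinite fun n : ℤ => {w : Strip | (n : ℝ) ≤ w.val.1 ∧ w.val.1 ≤ n + 1} := by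
  intro w
  refine ⟨{w' : Strip | |w'.val.1 - w.val.1| < 1}, ?_, ?_⟩
  · have : IsOpen {w' : Strip | |w'.val.1 - w.val.1| < 1} :=
      isOpen_lt (by fun_prop) continuous_const
    exact this.mem_nhds (by simp)
  · refine (Set.finite_Icc (⌊w.val.1⌋ - 2) (⌊w.val.1⌋ + 2)).subset ?_
    rintro n ⟨w', ⟨h1, h2⟩, h3⟩
    rw [Set.mem_ofPred_eq, abs_lt] at h3
    have h4 := Int.floor_le w.val.1
    have h5 := Int.lt_floor_add_one w.val.1
    constructor
    · have : ((⌊w.val.1⌋ - 2 : ℤ) : ℝ) ≤ n := by push_cast; linarith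
      exact_mod_cast this
    · have : (n : ℝ) ≤ ((⌊w.val.1⌋ + 2 : ℤ) : ℝ) := by push_cast; linarith
      exact_mod_cast this

namespace Gluing
variable {G : Gluing T}

/-- The horizontal strip through the copy `t` of the rhombus, wrapped around the surface. -/
noncomputable def strip (G : Gluing T) (t : T) (w : Strip) : G.Surface :=
  G.pt ((G.right ^ ⌊w.val.1⌋) t) ⟨_, fract_mem_rhombus w.2⟩

/-- The strip agrees with the `n`-th rhombus also on its edges, because of the gluings. -/
theorem strip_eq (t : T) (n : ℤ) (p : Rhombus) (w : Strip) (hw : w.val = (n + p.val.1, p.val.2)) :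
    G.strip t w = G.pt ((G.right ^ n) t) p := by
  obtain ⟨⟨x, y⟩, hp⟩ := p
  obtain ⟨_, hS⟩ := w
  simp only at hw
  subst hw
  simp only [strip]
  rcases hp.1.2.lt_or_eq with h1 | h1
  · have hf : ⌊(n : ℝ) + x⌋ = n := by
      rw [Int.floor_eq_iff]
      exact ⟨by linarith [hp.1.1], by simpa using h1⟩
    have hfr : Int.fract ((n : ℝ) + x) = x := by rw [Int.fract, hf]; ring
    simp only [hf, hfr]
  · simp only at h1
    subst h1
    have hf : ⌊(n : ℝ) + 1⌋ = n + 1 := by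
      rw [Int.floor_add_one, Int.floor_intCast]
    have hfr : Int.fract ((n : ℝ) + 1) = 0 := by rw [Int.fract, hf]; push_cast; ring
    simp only [hf, hfr]
    rw [zpow_add_one, ← (Commute.refl G.right).zpow_right n |>.eq, Equiv.Perm.mul_apply]
    exact (Quot.sound (Glue.right ((G.right ^ n) t) ⟨(1, y), hp⟩
      ⟨(0, y), by simpa [Rhombus] using hp⟩ rfl rfl rfl)).symm

theorem strip_rhombus (t : T) (p : Rhombus) (w : Strip) (hw : w.val = p.val) :
    G.strip t w = G.pt t p := by
  simpa using strip_eq (G := G) t 0 p w (by simp [hw])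

theorem strip_shift (t : T) (n : ℤ) (w w' : Strip) (h : w'.val = (w.val.1 + n, w.val.2)) :
    G.strip ((G.right ^ n) t) w = G.strip t w' := by
  have h1 : w'.val = (((⌊w.val.1⌋ + n : ℤ) : ℝ) + Int.fract w.val.1, w.val.2) := by
    rw [h]
    ext
    · push_cast
      linarith [Int.floor_add_fract w.val.1]
    · rfl
  rw [strip_eq t (⌊w.val.1⌋ + n) ⟨_, fract_mem_rhombus w.2⟩ w' h1, zpow_add,
    Equiv.Perm.mul_apply]
  rfl

theorem proj_strip (t : T) (w : Strip) : G.proj (G.strip t w) = torusMk w.val := by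
  rw [strip, proj_pt, torusMk_eq_iff]
  refine ⟨-⌊w.val.1⌋, 0, ?_⟩
  ext
  · simp [Int.fract, sub_eq_add_neg]
  · simp

theorem continuous_strip (t : T) : Continuous (G.strip t) := by
  refine locallyFinite_unit_intervals.continuous ?_ (fun n => ?_) (fun n => ?_)
  · ext w
    simp only [Set.mem_iUnion, Set.mem_univ, iff_true]
    exact ⟨⌊w.val.1⌋, Int.floor_le _, (Int.lt_floor_add_one _).le⟩
  · have h1 : IsClosed {w : Strip | (n : ℝ) ≤ w.val.1} := isClosed_le (by fun_prop) (by fun_prop)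
    have h2 : IsClosed {w : Strip | w.val.1 ≤ (n : ℝ) + 1} :=
      isClosed_le (by fun_prop) (by fun_prop)
    exact h1.inter h2
  · have hR : ∀ w : {w : Strip | (n : ℝ) ≤ w.val.1 ∧ w.val.1 ≤ n + 1},
        (w.val.val.1 - n, w.val.val.2) ∈ Rhombus := by
      rintro ⟨w, h1, h2⟩
      refine ⟨⟨by simp only; linarith, by simp only; linarith⟩, w.2.1, ?_⟩
      rintro ⟨h3 | h3, h4⟩
      · exact w.2.2 h4 n (by simp only at h3; linarith)
      · exact w.2.2 h4 (n + 1) (by simp only at h3; push_cast; linarith)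
    rw [continuousOn_iff_continuous_domRestrict]
    have : Set.domRestrict {w : Strip | (n : ℝ) ≤ w.val.1 ∧ w.val.1 ≤ n + 1} (G.strip t) =
        fun w => G.pt ((G.right ^ n) t) ⟨_, hR w⟩ := by
      funext w
      exact strip_eq t n ⟨_, hR w⟩ w.val (by simp)
    rw [this]
    exact (G.continuous_pt _).comp (by fun_prop)

/-- The shear `(x, y) ↦ (-x + m y, y)` of the strip. -/
def shear (m : ℤ) (w : Strip) : Strip := ⟨_, shear_mem_strip m w.2⟩

theorem continuous_shear (m : ℤ) : Continuous (shear m) := by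
  unfold shear
  fun_prop

/-- The rhombus, as a part of the strip. -/
def inStrip (p : Rhombus) : Strip := ⟨p.val, by simpa using mem_strip_of_mem_rhombus p.2 0⟩

theorem continuous_inStrip : Continuous inStrip := by
  unfold inStrip
  fun_prop

/-- An involution of the copies of the rhombus along which the shear `(x, y) ↦ (-x + m y, y)` of the
horizontal strips is compatible with all the gluings. As to `up`, the lower edge of copy `t`
goes to that of the left neighbour of `σ t`, and its upper edge to that of the copy `m - 1` steps
to the right of `σ t`. -/
structure ShearSymm (G : Gluing T) (m : ℤ) where
  σ : T → T
  right : ∀ t, σ (G.right t) = G.right⁻¹ (σ t)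
  up : ∀ t, G.right⁻¹ (σ (G.up t)) = G.up ((G.right ^ (m - 1)) (σ t))
  invol : ∀ t, σ (σ t) = t

namespace ShearSymm
variable {m : ℤ} (s : G.ShearSymm m)

/-- The affine automorphism which shears the horizontal strips. -/
noncomputable def map : G.Surface → G.Surface :=
  Quot.lift (fun a => G.strip (s.σ a.1) (shear m (inStrip a.2))) (by
    rintro _ _ (⟨t, p, q, hp, hq, h⟩ | ⟨t, p, q, hp, hq, h⟩)
    · simp only
      rw [s.right, ← zpow_neg_one, strip_shift]
      simp [shear, inStrip, hp, hq, h]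
      ring
    · have hq1 : q.val.1 ≠ 0 ∧ q.val.1 ≠ 1 :=
        ⟨fun h0 => q.2.2.2 ⟨Or.inl h0, Or.inl hq⟩, fun h0 => q.2.2.2 ⟨Or.inr h0, Or.inl hq⟩⟩
      have h1 : (1 - q.val.1, (1 : ℝ)) ∈ Rhombus :=
        ⟨⟨by linarith [q.2.1.2], by linarith [q.2.1.1]⟩, by norm_num, by simp; grind⟩
      have h2 : (1 - q.val.1, (0 : ℝ)) ∈ Rhombus :=
        ⟨⟨by linarith [q.2.1.2], by linarith [q.2.1.1]⟩, by norm_num, by simp; grind⟩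
      simp only
      rw [strip_eq _ (m - 1) ⟨_, h1⟩, strip_eq _ (-1) ⟨_, h2⟩, zpow_neg_one, s.up]
      · exact Quot.sound (Glue.up _ _ _ rfl rfl rfl)
      · simp [shear, inStrip, hq]
        ring
      · simp [shear, inStrip, hp, h]
        ring)

theorem map_pt (t : T) (p : Rhombus) :
    s.map (G.pt t p) = G.strip (s.σ t) (shear m (inStrip p)) := rfl

theorem σ_zpow (n : ℤ) (t : T) : s.σ ((G.right ^ n) t) = (G.right ^ (-n)) (s.σ t) := by
  have h : SemiconjBy (⟨s.σ, s.σ, s.invol, s.invol⟩ : Equiv.Perm T) G.right G.right⁻¹ :=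
    Equiv.ext s.right
  have h1 := congrArg (fun e : Equiv.Perm T => e t) (h.zpow_right n).eq
  rw [inv_zpow'] at h1
  exact h1

theorem map_strip (t : T) (w : Strip) : s.map (G.strip t w) = G.strip (s.σ t) (shear m w) := by
  rw [strip, map_pt, s.σ_zpow, strip_shift]
  ext
  · simp only [shear, inStrip, Int.fract]
    push_cast
    ring
  · rfl

theorem map_map (x : G.Surface) : s.map (s.map x) = x := by
  obtain ⟨t, p, rfl⟩ := exists_pt x
  rw [map_pt, map_strip, s.invol]
  exact strip_rhombus t p _ (by ext <;> simp [shear, inStrip])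

theorem continuous_map : Continuous s.map :=
  continuous_quot_lift _ (continuous_sigma fun t =>
    (continuous_strip (s.σ t)).comp ((continuous_shear m).comp continuous_inStrip) :
    Continuous fun a : Σ _ : T, Rhombus => G.strip (s.σ a.1) (shear m (inStrip a.2)))

theorem mem_veechGroupInBasis (s : G.ShearSymm m) {N : GL (Fin 2) ℤ}
    (hN : N.val = !![-1, m; 0, 1]) : castGL N ∈ veechGroupInBasis G.Surface := by
  refine mem_veechGroupInBasis_of_proj s.map s.continuous_map s.map_map _ fun t p => ?_
  rw [map_pt, proj_strip]
  congr 1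
  simp [lin_apply, hN, shear, inStrip]

end ShearSymm

/-- An involution of the copies of the rhombus along which the reflection in the diagonal through
`0` and `v₀` is compatible with all the gluings. -/
structure SwapSymm (G : Gluing T) where
  σ : T → T
  right : ∀ t, σ (G.right t) = G.up (σ t)
  up : ∀ t, σ (G.up t) = G.right (σ t)
  invol : ∀ t, σ (σ t) = t

/-- The reflection of the rhombus in the diagonal through `0` and `v₀`. -/
def swapRhombus (p : Rhombus) : Rhombus :=
  ⟨p.val.swap, p.2.2.1, p.2.1, fun h => p.2.2.2 h.symm⟩

theorem continuous_swapRhombus : Continuous swapRhombus := by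
  unfold swapRhombus
  fun_prop

namespace SwapSymm
variable (s : G.SwapSymm)

/-- The affine automorphism which reflects the rhombi in that diagonal. -/
def map : G.Surface → G.Surface :=
  Quot.lift (fun a => G.pt (s.σ a.1) (swapRhombus a.2)) (by
    rintro _ _ (⟨t, p, q, hp, hq, h⟩ | ⟨t, p, q, hp, hq, h⟩)
    · simp only
      rw [s.right]
      exact Quot.sound (Glue.up _ _ _ hp hq h)
    · simp only
      rw [s.up]
      exact Quot.sound (Glue.right _ _ _ hp hq h))

theorem map_pt (t : T) (p : Rhombus) : s.map (G.pt t p) = G.pt (s.σ t) (swapRhombus p) := rfl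

theorem mem_veechGroupInBasis (s : G.SwapSymm) : castGL matR ∈ veechGroupInBasis G.Surface := by
  refine mem_veechGroupInBasis_of_proj s.map ?_ ?_ _ fun t p => ?_
  · exact continuous_quot_lift _ (continuous_sigma fun t =>
      (G.continuous_pt (s.σ t)).comp continuous_swapRhombus :
      Continuous fun a : Σ _ : T, Rhombus => G.pt (s.σ a.1) (swapRhombus a.2))
  · intro x
    obtain ⟨t, p, rfl⟩ := exists_pt x
    rw [map_pt, map_pt, s.invol]
    rfl
  · rw [map_pt, proj_pt]
    congr 1
    simp [lin_apply, matR, swapRhombus, Prod.swap]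

end SwapSymm
end Gluing

/-! ### Symmetries of `Z°` and `S` -/

theorem coe_twoV (i : ZMod 3) : (twoV i : Plane) = (2 : ℝ) • v i := rfl

theorem twoV_zero : twoV 0 = -twoV 1 - twoV 2 := by
  ext i
  have e0 : v 0 = ![1, 0] := rfl
  have e1 : v 1 = ![-1 / 2, √3 / 2] := rfl
  have e2 : v 2 = ![-1 / 2, -√3 / 2] := rfl
  fin_cases i <;> simp [coe_twoV, e0, e1, e2] <;> ring

/-- The reflection in the horizontal axis. -/
def axisReflection : Plane →+ Plane where
  toFun u := ![u 0, -u 1]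
  map_zero' := by ext i; fin_cases i <;> simp
  map_add' u u' := by ext i; fin_cases i <;> simp; ring

theorem axisReflection_two_smul_v (i : ZMod 3) :
    axisReflection ((2 : ℝ) • v i) = (2 : ℝ) • v (-i) := by
  have e0 : v 0 = ![1, 0] := rfl
  have e1 : v 1 = ![-1 / 2, √3 / 2] := rfl
  have e2 : v 2 = ![-1 / 2, -√3 / 2] := rfl
  have n1 : (-1 : ZMod 3) = 2 := by decide
  have n2 : (-2 : ZMod 3) = 1 := by decide
  obtain rfl | rfl | rfl : i = 0 ∨ i = 1 ∨ i = 2 := by revert i; decide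
  all_goals
    ext j
    fin_cases j <;> simp [axisReflection, e0, e1, e2, n1, n2] <;> ring

/-- The reflection in the horizontal axis, on the lattice `2Λ`. -/
def centerReflection : hexagonCenters →+ hexagonCenters :=
  (axisReflection.comp hexagonCenters.subtype).codRestrict hexagonCenters (by
    rintro ⟨c, hc⟩
    have : hexagonCenters ≤ hexagonCenters.comap axisReflection := by
      refine (AddSubgroup.closure_le _).2 ?_
      rintro _ ⟨i, rfl⟩
      simp only [AddSubgroup.coe_comap, Set.mem_preimage, axisReflection_two_smul_v]
      exact AddSubgroup.subset_closure ⟨-i, rfl⟩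
    exact this hc)

theorem centerReflection_twoV (i : ZMod 3) : centerReflection (twoV i) = twoV (-i) :=
  Subtype.ext (axisReflection_two_smul_v i)

theorem centerReflection_centerReflection (c : hexagonCenters) :
    centerReflection (centerReflection c) = c := by
  ext i
  change axisReflection (axisReflection c.val) i = c.val i
  fin_cases i <;> simp [axisReflection]

/-- The reflection of the rhombi exchanges the indices `1` and `2` on `Z°`. -/
def swapSymmZ : gluingZ.SwapSymm where
  σ i := -i
  right := by decide
  up := by decide
  invol := by decide

/-- The shears of the single horizontal cylinder of `Z°`. The condition at the edges is `m = 2`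
modulo three. -/
def shearSymmZ (m : ℤ) (hm : m = 2 ∨ m = -1) : gluingZ.ShearSymm m where
  σ i := -i
  right := by decide
  up := by rcases hm with rfl | rfl <;> decide
  invol := by decide

/-- The reflection of `S` in the horizontal axis. -/
noncomputable def swapSymmS : gluingS.SwapSymm where
  σ x := (-x.1, centerReflection x.2)
  right x := by
    change (-(x.1 + 1), centerReflection (x.2 + twoV x.1)) =
      (-x.1 - 1, centerReflection x.2 + twoV (-x.1))
    rw [map_add, centerReflection_twoV, neg_add, sub_eq_add_neg]
  up x := by
    change (-(x.1 - 1), centerReflection (x.2 + twoV x.1)) =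
      (-x.1 + 1, centerReflection x.2 + twoV (-x.1))
    rw [map_add, centerReflection_twoV, neg_sub, sub_eq_add_neg, add_comm]
  invol x := by simp [centerReflection_centerReflection]

/-- The translation of the hexagons which is needed, besides the reflection, to reverse each
horizontal cylinder of `S`. -/
noncomputable def shearShift (i : ZMod 3) : hexagonCenters :=
  (![0, twoV 1, -twoV 2] : Fin 3 → hexagonCenters) i

theorem gluingS_right (i : ZMod 3) (c : hexagonCenters) :
    gluingS.right (i, c) = (i + 1, c + twoV i) := rfl

theorem gluingS_right_inv (i : ZMod 3) (c : hexagonCenters) :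
    gluingS.right⁻¹ (i, c) = (i - 1, c - twoV (i - 1)) := rfl

theorem gluingS_up (i : ZMod 3) (c : hexagonCenters) :
    gluingS.up (i, c) = (i - 1, c + twoV i) := rfl

theorem zmod_three_cases (i : ZMod 3) : i = 0 ∨ i = 1 ∨ i = 2 := by
  revert i
  decide

/-- The horizontal cylinders of `S` consist of three rhombi. -/
theorem gluingS_right_pow_three : gluingS.right ^ (3 : ℕ) = 1 := by
  refine Equiv.ext ?_
  rintro ⟨i, c⟩
  have n3 : ((2 : ZMod 3) + 1) = 0 := by decide
  simp only [pow_succ, pow_zero, one_mul, Equiv.Perm.mul_apply, gluingS_right,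
    Equiv.Perm.one_apply]
  obtain rfl | rfl | rfl := zmod_three_cases i
  all_goals
    refine Prod.ext (by simp only; decide) ?_
    simp only [zero_add, one_add_one_eq_two, n3, twoV_zero]
    abel

theorem centerReflection_shearShift (i : ZMod 3) :
    centerReflection (shearShift i) + shearShift (-i) = 0 := by
  have n1 : (-1 : ZMod 3) = 2 := by decide
  have n2 : (-2 : ZMod 3) = 1 := by decide
  obtain rfl | rfl | rfl := zmod_three_cases i
  · simp [shearShift]
  · simp [shearShift, n1, centerReflection_twoV]
  · simp [shearShift, n2, centerReflection_twoV]

/-- The shears of the horizontal cylinders of `S`. -/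
noncomputable def shearSymmS (m : ℤ) (hm : m = 2 ∨ m = -1) : gluingS.ShearSymm m where
  σ x := (-x.1, centerReflection x.2 + shearShift x.1)
  right := by
    rintro ⟨i, c⟩
    rw [gluingS_right, gluingS_right_inv, map_add, centerReflection_twoV]
    have n1 : (-1 : ZMod 3) = 2 := by decide
    have n2 : (-2 : ZMod 3) = 1 := by decide
    have n3 : ((2 : ZMod 3) + 1) = 0 := by decide
    have n4 : ((2 : ZMod 3) - 1) = 1 := by decide
    obtain rfl | rfl | rfl := zmod_three_cases i
    all_goals
      refine Prod.ext (by simp only; decide) ?_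
      simp [n1, n2, n3, n4, shearShift, twoV_zero, one_add_one_eq_two]
      try abel
  up := by
    rintro ⟨i, c⟩
    -- The exponents `m - 1 = 1` and `m - 1 = -2` agree modulo the length three of the cylinders.
    have hr : gluingS.right ^ (m - 1) = gluingS.right := by
      rcases hm with rfl | rfl
      · simp
      · have h : (-1 - 1 : ℤ) = 1 + -((3 : ℕ) : ℤ) := by norm_num
        rw [h, zpow_add, zpow_neg, zpow_natCast, gluingS_right_pow_three]
        simp
    rw [hr, gluingS_right, gluingS_up, gluingS_up, gluingS_right_inv, map_add,
      centerReflection_twoV]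
    have n1 : (-1 : ZMod 3) = 2 := by decide
    have n2 : (-2 : ZMod 3) = 1 := by decide
    have n3 : ((2 : ZMod 3) + 1) = 0 := by decide
    have n4 : ((2 : ZMod 3) - 1) = 1 := by decide
    obtain rfl | rfl | rfl := zmod_three_cases i
    all_goals
      refine Prod.ext (by simp only; decide) ?_
      simp [n1, n2, n3, n4, shearShift, twoV_zero, one_add_one_eq_two]
      try abel
  invol := by
    rintro ⟨i, c⟩
    refine Prod.ext (neg_neg i) ?_
    simp only
    rw [map_add, centerReflection_centerReflection, add_assoc, centerReflection_shearShift,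
      add_zero]

/-! ### The derivatives preserve a line modulo three -/

namespace Gluing
variable {G : Gluing T}

/-- The function on the surface which is `φ` up to a constant on each copy of the rhombus. -/
def potential {C : Type*} [AddCommGroup C] (φ : ℝ × ℝ →+ C) (k : T → C)
    (hr : ∀ t, k (G.right t) = k t + φ (1, 0)) (hu : ∀ t, k (G.up t) = k t + φ (0, 1)) :
    G.Surface → C :=
  Quot.lift (fun a => k a.1 + φ a.2.val) (by
    rintro _ _ (⟨t, p, q, hp, hq, h⟩ | ⟨t, p, q, hp, hq, h⟩)
    · have : p.val = (1, 0) + q.val := Prod.ext (by simp [hp, hq]) (by simp [h])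
      simp only
      rw [hr, this, map_add, add_assoc]
    · have : p.val = (0, 1) + q.val := Prod.ext (by simp [h]) (by simp [hp, hq])
      simp only
      rw [hu, this, map_add, add_assoc])

theorem isHolonomy_potential {C : Type*} [AddCommGroup C] (φ : ℝ × ℝ →+ C) (k : T → C)
    (hr : ∀ t, k (G.right t) = k t + φ (1, 0)) (hu : ∀ t, k (G.up t) = k t + φ (0, 1)) :
    IsHolonomy (potential φ k hr hu) φ :=
  isHolonomy_of_pt k fun _ _ => rfl

/-- If a point projects to the same point as `p`, it is `p` in some copy: when it was given by
an opposite point on the boundary, pass to the neighbouring copy. -/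
theorem exists_pt_of_proj_eq (y : G.Surface) (p : Rhombus) (h : G.proj y = torusMk p.val) :
    ∃ t, G.pt t p = y := by
  obtain ⟨t, q, rfl⟩ := exists_pt y
  obtain ⟨m, n, hmn⟩ := torusMk_eq_iff.1 h
  obtain ⟨⟨x, y⟩, hp⟩ := p
  obtain ⟨⟨x', y'⟩, hq⟩ := q
  simp only [Prod.mk_add_mk, Prod.mk.injEq] at hmn
  obtain ⟨hx, hy⟩ := hmn
  have hP := hp
  have hQ := hq
  simp only [Rhombus, Set.mem_ofPred_eq] at hP hQ
  have a1 : (-1 : ℝ) ≤ m := by linarith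
  have a2 : (m : ℝ) ≤ 1 := by linarith
  have a3 : (-1 : ℝ) ≤ n := by linarith
  have a4 : (n : ℝ) ≤ 1 := by linarith
  norm_cast at a1 a2 a3 a4
  obtain rfl | rfl | rfl : m = -1 ∨ m = 0 ∨ m = 1 := by omega
  · have e1 : x' = 0 := by push_cast at hx; linarith
    have e2 : x = 1 := by push_cast at hx; linarith
    obtain rfl | rfl | rfl : n = -1 ∨ n = 0 ∨ n = 1 := by omega
    · push_cast at hy; grind
    · obtain ⟨t, rfl⟩ := G.right.surjective t
      exact ⟨t, Quot.sound (Glue.right t _ _ e2 e1 (by simp [hy]))⟩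
    · push_cast at hy; grind
  · obtain rfl | rfl | rfl : n = -1 ∨ n = 0 ∨ n = 1 := by omega
    · obtain ⟨t, rfl⟩ := G.up.surjective t
      push_cast at hx hy
      exact ⟨t, Quot.sound (Glue.up t _ _ (by simp only; linarith) (by simp only; linarith)
        (by simp [hx]))⟩
    · simp only [Int.cast_zero, add_zero] at hx hy
      subst hx hy
      exact ⟨t, rfl⟩
    · push_cast at hx hy
      exact ⟨G.up t, (Quot.sound (Glue.up t _ _ (by simp only; linarith) (by simp only; linarith)
        (by simp [hx]))).symm⟩
  · have e1 : x' = 1 := by push_cast at hx; linarith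
    have e2 : x = 0 := by push_cast at hx; linarith
    obtain rfl | rfl | rfl : n = -1 ∨ n = 0 ∨ n = 1 := by omega
    · push_cast at hy; grind
    · exact ⟨G.right t, (Quot.sound (Glue.right t _ _ e1 e2 (by simp [hy]))).symm⟩
    · push_cast at hy; grind

end Gluing

/-- The linear form `a x + b y`, with values in `ℝ / 3ℤ`. -/
noncomputable def circleForm (a b : ℝ) : ℝ × ℝ →+ AddCircle (3 : ℝ) where
  toFun w := ((a * w.1 + b * w.2 : ℝ) : AddCircle (3 : ℝ))
  map_zero' := by simp
  map_add' w w' := by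
    rw [← AddCircle.coe_add]
    congr 1
    simp
    ring

theorem circleForm_apply (a b : ℝ) (w : ℝ × ℝ) :
    circleForm a b w = ((a * w.1 + b * w.2 : ℝ) : AddCircle (3 : ℝ)) := rfl

theorem addCircle_three_eq_zero_iff (n : ℤ) : (((n : ℝ)) : AddCircle (3 : ℝ)) = 0 ↔ 3 ∣ n := by
  rw [AddCircle.coe_eq_zero_iff]
  constructor
  · rintro ⟨m, hm⟩
    refine ⟨m, ?_⟩
    have : ((m * 3 : ℤ) : ℝ) = n := by simpa using hm
    rw [mul_comm]
    exact_mod_cast this.symm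
  · rintro ⟨m, rfl⟩
    exact ⟨m, by simp [mul_comm]⟩

/-- The embedding of `ℤ / 3` in `ℝ / 3ℤ`. -/
noncomputable def zmodCircle : ZMod 3 →+ AddCircle (3 : ℝ) :=
  ZMod.lift 3 ⟨zmultiplesHom _ ((1 : ℝ) : AddCircle (3 : ℝ)), by
    rw [zmultiplesHom_apply, ← AddCircle.coe_zsmul]
    simp⟩

theorem zmodCircle_intCast (n : ℤ) : zmodCircle n = ((n : ℝ) : AddCircle (3 : ℝ)) := by
  rw [zmodCircle, ZMod.lift_coe]
  simp only [zmultiplesHom_apply]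
  rw [← AddCircle.coe_zsmul]
  simp

theorem zmodCircle_one : zmodCircle 1 = ((1 : ℝ) : AddCircle (3 : ℝ)) := by
  simpa using zmodCircle_intCast 1

theorem zmodCircle_injective : Function.Injective zmodCircle := by
  rw [injective_iff_map_eq_zero]
  intro i hi
  obtain ⟨n, rfl⟩ := ZMod.intCast_surjective i
  rw [zmodCircle_intCast, addCircle_three_eq_zero_iff] at hi
  exact (ZMod.intCast_zmod_eq_zero_iff_dvd n 3).2 (by exact_mod_cast hi)

/-- The function `x - y + i`, with values in `ℝ / 3ℤ`, on `Z°`. -/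
noncomputable def levelZ : Z → AddCircle (3 : ℝ) :=
  Gluing.potential (G := gluingZ) (circleForm 1 (-1)) zmodCircle
    (fun i => by
      change zmodCircle (i + 1) = _
      rw [map_add, zmodCircle_one, circleForm_apply]
      simp)
    (fun i => by
      change zmodCircle (i - 1) = _
      rw [map_sub, zmodCircle_one, circleForm_apply]
      simp [sub_eq_add_neg])

theorem isHolonomy_levelZ : Gluing.IsHolonomy levelZ (circleForm 1 (-1)) :=
  Gluing.isHolonomy_potential _ _ _ _

/-- The level tells apart the three points of a fiber of the projection. -/
theorem eq_of_levelZ {x y : Z} (h : gluingZ.proj x = gluingZ.proj y) (h' : levelZ x = levelZ y) :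
    x = y := by
  obtain ⟨i, p, rfl⟩ := Gluing.exists_pt x
  obtain ⟨j, rfl⟩ := Gluing.exists_pt_of_proj_eq y p h.symm
  have : zmodCircle i = zmodCircle j := add_right_cancel h'
  rw [zmodCircle_injective this]

/-- The matrix preserves the line spanned by `(1, 1)` modulo three. -/
def PreservesDiagonal (A : GL (Fin 2) ℤ) : Prop :=
  (3 : ℤ) ∣ A.val 0 0 + A.val 0 1 - A.val 1 0 - A.val 1 1

/-- The trajectories of `Z°` in the direction `(1, 1)` are closed after unit time, and the level
does not change along their images. -/
theorem preservesDiagonal_of_mem_veechGroupInBasis_Z {A : GL (Fin 2) ℤ}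
    (h : castGL A ∈ veechGroupInBasis Z) : PreservesDiagonal A := by
  obtain ⟨f, hf⟩ := mem_veechGroupInBasis.1 h
  -- A trajectory which keeps away from the punctures.
  have hne : ∀ s : unitInterval,
      torusMk (((3 / 4 : ℝ), (1 / 4 : ℝ)) + s.val • ((1 : ℝ), (1 : ℝ))) ≠ 0 := by
    intro s hs
    obtain ⟨m, n, hmn⟩ := torusMk_eq_zero_iff.1 hs
    simp only [Prod.smul_mk, smul_eq_mul, mul_one, Prod.mk_add_mk, Prod.mk.injEq] at hmn
    have h1 : (2 : ℝ) * (m - n) = 1 := by linarith [hmn.1, hmn.2]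
    have h2 : 2 * (m - n) = 1 := by exact_mod_cast h1
    omega
  have hp : ((3 / 4 : ℝ), (1 / 4 : ℝ)) ∈ Rhombus := by simp [Rhombus]; norm_num
  obtain ⟨γ, hγ, hγp, -⟩ := Gluing.exists_lift (G := gluingZ) _
    (Gluing.continuous_smul_time continuous_subtype_val _ _) hne
    (gluingZ.pt 0 ⟨_, hp⟩) (by simp)
  have htr : Gluing.IsTrajectory (G := gluingZ) Subtype.val γ ((1 : ℝ), (1 : ℝ)) := by
    refine ⟨continuous_subtype_val, hγ, fun a b => ?_⟩
    rw [hγp, hγp, ← map_add, add_assoc, ← add_smul, add_sub_cancel]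
  have hclosed : γ 1 = γ 0 := by
    refine eq_of_levelZ ?_ ?_
    · rw [htr.2.2 0 1]
      simp only [Set.Icc.coe_one, Set.Icc.coe_zero, sub_zero, one_smul, add_eq_left]
      exact torusMk_eq_zero_iff.2 ⟨1, 1, by simp⟩
    · have := isHolonomy_levelZ.trajectory htr 0 1
      refine this.trans ?_
      simp [circleForm_apply]
  have h1 := isHolonomy_levelZ.trajectory (htr.comp hf) 0 1
  rw [Function.comp_apply, Function.comp_apply, hclosed, left_eq_add] at h1
  have h2 : circleForm 1 (-1) (((1 : unitInterval).val - (0 : unitInterval).val) •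
      lin (castGL A).val ((1 : ℝ), (1 : ℝ))) =
      ((((A.val 0 0 + A.val 0 1 - A.val 1 0 - A.val 1 1 : ℤ)) : ℝ) : AddCircle (3 : ℝ)) := by
    rw [circleForm_apply]
    congr 1
    simp [lin_apply]
    ring
  rw [h2, addCircle_three_eq_zero_iff] at h1
  exact h1

/-- The function `x - y + i`, with values in `ℝ / 3ℤ`, on `S`. -/
noncomputable def levelS : S → AddCircle (3 : ℝ) :=
  Gluing.potential (G := gluingS) (circleForm 1 (-1)) (fun x => zmodCircle x.1)
    (fun x => by
      change zmodCircle (x.1 + 1) = _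
      rw [map_add, zmodCircle_one, circleForm_apply]
      simp)
    (fun x => by
      change zmodCircle (x.1 - 1) = _
      rw [map_sub, zmodCircle_one, circleForm_apply]
      simp [sub_eq_add_neg])

theorem isHolonomy_levelS : Gluing.IsHolonomy levelS (circleForm 1 (-1)) :=
  Gluing.isHolonomy_potential _ _ _ _

/-- The first coordinate of `2 vᵢ` is `-1` modulo three. -/
theorem coe_twoV_zero (i : ZMod 3) :
    ((-(twoV i).val 0 : ℝ) : AddCircle (3 : ℝ)) = ((1 : ℝ) : AddCircle (3 : ℝ)) := by
  have e0 : v 0 = ![1, 0] := rfl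
  have e1 : v 1 = ![-1 / 2, √3 / 2] := rfl
  have e2 : v 2 = ![-1 / 2, -√3 / 2] := rfl
  obtain rfl | rfl | rfl := zmod_three_cases i
  · rw [← sub_eq_zero, ← AddCircle.coe_sub]
    have h := (addCircle_three_eq_zero_iff (-3)).2 (by norm_num)
    convert h using 2
    simp [coe_twoV, e0]
    norm_num
  · congr 1
    simp [coe_twoV, e1]
    norm_num
  · congr 1
    simp [coe_twoV, e2]
    norm_num

/-- The function `x + y - c₀`, with values in `ℝ / 3ℤ`, on `S`, where `c₀` is the first coordinate
of the center of the hexagon. -/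
noncomputable def heightS : S → AddCircle (3 : ℝ) :=
  Gluing.potential (G := gluingS) (circleForm 1 1)
    (fun x => ((-x.2.val 0 : ℝ) : AddCircle (3 : ℝ)))
    (fun x => by
      change ((-(x.2.val 0 + (twoV x.1).val 0) : ℝ) : AddCircle (3 : ℝ)) = _
      rw [neg_add, AddCircle.coe_add, coe_twoV_zero, circleForm_apply]
      simp)
    (fun x => by
      change ((-(x.2.val 0 + (twoV x.1).val 0) : ℝ) : AddCircle (3 : ℝ)) = _
      rw [neg_add, AddCircle.coe_add, coe_twoV_zero, circleForm_apply]
      simp)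

theorem isHolonomy_heightS : Gluing.IsHolonomy heightS (circleForm 1 1) :=
  Gluing.isHolonomy_potential _ _ _ _

/-- The translations of `S` by elements of `2Λ`. -/
noncomputable def deck (τ : hexagonCenters) : S → S :=
  Quot.map (fun a => ⟨(a.1.1, a.1.2 + τ), a.2⟩) (by
    rintro _ _ (⟨t, p, q, hp, hq, h⟩ | ⟨t, p, q, hp, hq, h⟩)
    · have := Gluing.Glue.right (G := gluingS) (t.1, t.2 + τ) p q hp hq h
      have h1 : gluingS.right (t.1, t.2 + τ) =
          ((gluingS.right t).1, (gluingS.right t).2 + τ) :=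
        Prod.ext rfl (add_right_comm _ _ _)
      rw [h1] at this
      exact this
    · have := Gluing.Glue.up (G := gluingS) (t.1, t.2 + τ) p q hp hq h
      have h1 : gluingS.up (t.1, t.2 + τ) =
          ((gluingS.up t).1, (gluingS.up t).2 + τ) :=
        Prod.ext rfl (add_right_comm _ _ _)
      rw [h1] at this
      exact this)

theorem deck_pt (τ : hexagonCenters) (i : ZMod 3) (c : hexagonCenters) (p : Rhombus) :
    deck τ (gluingS.pt (i, c) p) = gluingS.pt (i, c + τ) p := rfl

theorem continuous_deck (τ : hexagonCenters) : Continuous (deck τ) :=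
  continuous_quot_lift _ (continuous_sigma fun t => gluingS.continuous_pt (t.1, t.2 + τ))

theorem proj_deck (τ : hexagonCenters) (x : S) : gluingS.proj (deck τ x) = gluingS.proj x := by
  obtain ⟨t, p, rfl⟩ := Gluing.exists_pt x
  rfl

/-- Points of one fiber at one level differ by a translation in `2Λ`. -/
theorem exists_deck_eq {x y : S} (h : gluingS.proj x = gluingS.proj y) (h' : levelS x = levelS y) :
    ∃ τ, y = deck τ x := by
  obtain ⟨⟨i, c⟩, p, rfl⟩ := Gluing.exists_pt x
  obtain ⟨⟨j, d⟩, rfl⟩ := Gluing.exists_pt_of_proj_eq y p h.symm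
  have : zmodCircle i = zmodCircle j := add_right_cancel h'
  rw [zmodCircle_injective this]
  exact ⟨d - c, by rw [deck_pt, add_sub_cancel]⟩

theorem eq_zero_of_deck_three {τ : hexagonCenters} {x : S} (h : deck τ (deck τ (deck τ x)) = x) :
    τ = 0 := by
  obtain ⟨⟨i, c⟩, p, rfl⟩ := Gluing.exists_pt x
  rw [deck_pt, deck_pt, deck_pt] at h
  have h1 := congrArg Prod.snd (Gluing.pt_injective p h)
  simp only [add_assoc, add_eq_left] at h1
  ext j
  have h2 := congrFun (congrArg Subtype.val h1) j
  have h3 : τ.val j + (τ.val j + τ.val j) = 0 := h2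
  change τ.val j = 0
  linarith

theorem deck_zero (x : S) : deck 0 x = x := by
  obtain ⟨⟨i, c⟩, p, rfl⟩ := Gluing.exists_pt x
  rw [deck_pt, add_zero]

/-- In the direction of the line of `(1, 1)` modulo three no trajectory of `S` is closed, whereas
the horizontal trajectories are: an affine automorphism cannot take the horizontal direction
to that line. -/
theorem not_dvd_of_mem_veechGroupInBasis_S {A : GL (Fin 2) ℤ}
    (h : castGL A ∈ veechGroupInBasis S) : ¬ (3 : ℤ) ∣ A.val 0 0 - A.val 1 0 := by
  intro hd
  obtain ⟨f, hf⟩ := mem_veechGroupInBasis.1 h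
  have hS : ∀ s : ℝ, (s, (1 / 2 : ℝ)) ∈ Strip := by
    intro s
    simp only [Strip, Set.mem_ofPred_eq]
    norm_num
  set γ : ℝ → S := fun s => gluingS.strip (0, 0) ⟨_, hS s⟩ with hγ
  have hγc : Continuous γ := (Gluing.continuous_strip _).comp (by fun_prop)
  have htr : Gluing.IsTrajectory (G := gluingS) id γ ((1 : ℝ), (0 : ℝ)) := by
    refine ⟨continuous_id, hγc, fun a b => ?_⟩
    simp only [hγ]
    rw [Gluing.proj_strip, Gluing.proj_strip, ← map_add]
    simp
  have hclosed : γ 3 = γ 0 := by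
    simp only [hγ]
    have := Gluing.strip_shift (G := gluingS) (0, 0) 3 ⟨_, hS 0⟩ ⟨_, hS 3⟩ (by simp)
    have h3 : gluingS.right ^ (3 : ℤ) = 1 := by exact_mod_cast gluingS_right_pow_three
    rw [h3] at this
    exact this.symm
  -- After unit time, the image `δ` of `γ` has moved by a translation `τ`.
  set δ : ℝ → S := f ∘ γ with hδ
  have htr' : Gluing.IsTrajectory (G := gluingS) id δ (lin (castGL A).val ((1 : ℝ), (0 : ℝ))) :=
    htr.comp hf
  have hw : lin (castGL A).val ((1 : ℝ), (0 : ℝ)) = ((A.val 0 0 : ℝ), (A.val 1 0 : ℝ)) := by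
    simp [lin_apply]
  rw [hw] at htr'
  have hstep : ∀ s, gluingS.proj (δ (s + 1)) = gluingS.proj (δ s) := by
    intro s
    rw [htr'.2.2 s (s + 1)]
    simp only [id, add_sub_cancel_left, one_smul, add_eq_left]
    exact torusMk_eq_zero_iff.2 ⟨_, _, rfl⟩
  have hlevel : levelS (δ 0) = levelS (δ (0 + 1)) := by
    rw [isHolonomy_levelS.trajectory htr' 0 (0 + 1), left_eq_add]
    have := (addCircle_three_eq_zero_iff _).2 hd
    rw [← this, circleForm_apply]
    congr 1
    simp
    ring
  obtain ⟨τ, hτ⟩ := exists_deck_eq (hstep 0).symm hlevel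
  have hδc : Continuous δ := htr'.2.1
  -- By uniqueness of lifts, `δ` moves by `τ` in every unit of time, hence `3 τ = 0`.
  have hall := Gluing.lift_unique (G := gluingS) (γ := fun s : ℝ => δ (s + 1))
    (γ' := fun s => deck τ (δ s)) (hδc.comp (by fun_prop)) ((continuous_deck τ).comp hδc)
    (fun s => by rw [proj_deck, hstep]) 0 hτ
  have hall' : ∀ s, δ (s + 1) = deck τ (δ s) := congrFun hall
  have h3 : deck τ (deck τ (deck τ (δ 0))) = δ 0 := by
    rw [← hall', ← hall', ← hall']
    have : (0 + 1 + 1 + 1 : ℝ) = 3 := by norm_num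
    rw [this, hδ, Function.comp_apply, hclosed, Function.comp_apply]
  rw [eq_zero_of_deck_three h3, deck_zero] at hτ
  -- So `δ` closes up after unit time, and its height does not change.
  have hheight := isHolonomy_heightS.trajectory htr' 0 (0 + 1)
  rw [hτ, left_eq_add] at hheight
  have hsum : (3 : ℤ) ∣ A.val 0 0 + A.val 1 0 := by
    rw [← addCircle_three_eq_zero_iff, ← hheight, circleForm_apply]
    congr 1
    simp
  have hdet : IsUnit (A.val 0 0 * A.val 1 1 - A.val 0 1 * A.val 1 0) := by
    rw [← Matrix.det_fin_two]
    exact (Matrix.isUnit_iff_isUnit_det _).1 A.isUnit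
  have h00 : (3 : ℤ) ∣ A.val 0 0 := by omega
  have h10 : (3 : ℤ) ∣ A.val 1 0 := by omega
  have hdvd : (3 : ℤ) ∣ A.val 0 0 * A.val 1 1 - A.val 0 1 * A.val 1 0 :=
    dvd_sub (h00.mul_right _) (h10.mul_left _)
  have := isUnit_of_dvd_unit hdvd hdet
  rw [Int.isUnit_iff] at this
  omega

/-- The generator `R P₀`. -/
def matA : GL (Fin 2) ℤ := matR * matP₀

/-- The generator `P₁⁻¹ R P₀`. -/
def matB : GL (Fin 2) ℤ := matP₁⁻¹ * matR * matP₀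

theorem val_matA : matA.val = !![-1, 2; 0, 1] := by decide

theorem val_matB : matB.val = !![-1, -1; 0, 1] := by decide

theorem generators_mem_Z : castGL matR ∈ veechGroupInBasis Z ∧
    castGL matA ∈ veechGroupInBasis Z ∧ castGL matB ∈ veechGroupInBasis Z :=
  ⟨swapSymmZ.mem_veechGroupInBasis,
    (shearSymmZ 2 (Or.inl rfl)).mem_veechGroupInBasis val_matA,
    (shearSymmZ (-1) (Or.inr rfl)).mem_veechGroupInBasis val_matB⟩

theorem generators_mem_S : castGL matR ∈ veechGroupInBasis S ∧
    castGL matA ∈ veechGroupInBasis S ∧ castGL matB ∈ veechGroupInBasis S :=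
  ⟨swapSymmS.mem_veechGroupInBasis,
    (shearSymmS 2 (Or.inl rfl)).mem_veechGroupInBasis val_matA,
    (shearSymmS (-1) (Or.inr rfl)).mem_veechGroupInBasis val_matB⟩

/-- The horizontal line modulo three and its images under `R` and `P₁⁻¹ R P₀ R` are three of the
four lines of `(ℤ / 3)²`. None of them goes to the line of `(1, 1)`, so the fourth one does,
which is that line itself. -/
theorem preservesDiagonal_of_mem_veechGroupInBasis_S {A : GL (Fin 2) ℤ}
    (h : castGL A ∈ veechGroupInBasis S) : PreservesDiagonal A := by
  obtain ⟨hR, -, hB⟩ := generators_mem_S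
  have h1 := not_dvd_of_mem_veechGroupInBasis_S h
  have h2 := not_dvd_of_mem_veechGroupInBasis_S (A := A * matR) (by
    rw [map_mul]; exact mul_mem h hR)
  have h3 := not_dvd_of_mem_veechGroupInBasis_S (A := A * (matB * matR)) (by
    rw [map_mul, map_mul]; exact mul_mem h (mul_mem hB hR))
  have e2 : matR.val = !![0, 1; 1, 0] := rfl
  have e3 : (matB * matR).val = !![-1, -1; 1, 0] := by decide
  rw [Units.val_mul] at h2 h3
  rw [e2] at h2
  rw [e3] at h3
  simp only [Matrix.mul_apply, Fin.sum_univ_two, Matrix.of_apply, Matrix.cons_val',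
    Matrix.cons_val_zero, Matrix.cons_val_one, Matrix.cons_val_fin_one, mul_zero,
    mul_one, zero_add, mul_neg] at h2 h3
  rw [PreservesDiagonal]
  have c1 : (A.val 0 0 - A.val 1 0) % 3 = 1 ∨ (A.val 0 0 - A.val 1 0) % 3 = 2 := by omega
  have c2 : (A.val 0 1 - A.val 1 1) % 3 = 1 ∨ (A.val 0 1 - A.val 1 1) % 3 = 2 := by omega
  rcases c1 with c1 | c1 <;> rcases c2 with c2 | c2 <;> omega

/-! ### The group of integral matrices preserving the diagonal modulo three -/

/-- The group generated by `R`, `R P₀`, `P₁⁻¹ R P₀` and `-1`. -/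
def diagGroup : Subgroup (GL (Fin 2) ℤ) := Subgroup.closure {matR, matA, matB, -1}

theorem matR_mem : matR ∈ diagGroup := Subgroup.subset_closure (by simp)
theorem matA_mem : matA ∈ diagGroup := Subgroup.subset_closure (by simp)
theorem matB_mem : matB ∈ diagGroup := Subgroup.subset_closure (by simp)
theorem neg_one_mem_diagGroup : -1 ∈ diagGroup := Subgroup.subset_closure (by simp)

theorem neg_mem_diagGroup {g : GL (Fin 2) ℤ} (hg : g ∈ diagGroup) : -g ∈ diagGroup := by
  rw [← neg_one_mul]
  exact mul_mem neg_one_mem_diagGroup hg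

theorem preservesDiagonal_one : PreservesDiagonal 1 := by
  simp [PreservesDiagonal]

theorem PreservesDiagonal.mul {A B : GL (Fin 2) ℤ} (hA : PreservesDiagonal A)
    (hB : PreservesDiagonal B) : PreservesDiagonal (A * B) := by
  obtain ⟨k, hk⟩ := hA
  obtain ⟨l, hl⟩ := hB
  refine ⟨(A.val 0 0 - A.val 1 0) * l + k * (B.val 1 0 + B.val 1 1), ?_⟩
  rw [Units.val_mul]
  simp only [Matrix.mul_apply, Fin.sum_univ_two]
  linear_combination (A.val 0 0 - A.val 1 0) * hl + (B.val 1 0 + B.val 1 1) * hk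

theorem PreservesDiagonal.inv {A : GL (Fin 2) ℤ} (hA : PreservesDiagonal A) :
    PreservesDiagonal A⁻¹ := by
  set B := A⁻¹ with hB
  have h1 : A.val * B.val = 1 := by rw [hB, ← Units.val_mul]; simp
  have e00 := congrFun (congrFun h1 0) 0
  have e01 := congrFun (congrFun h1 0) 1
  have e10 := congrFun (congrFun h1 1) 0
  have e11 := congrFun (congrFun h1 1) 1
  simp [Matrix.mul_apply, Fin.sum_univ_two] at e00 e01 e10 e11
  obtain ⟨k, hk⟩ := hA
  have h2 : (3 : ℤ) ∣
      (A.val 0 0 - A.val 1 0) * (B.val 0 0 + B.val 0 1 - B.val 1 0 - B.val 1 1) := by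
    refine ⟨-k * (B.val 1 0 + B.val 1 1), ?_⟩
    linear_combination e00 + e01 - e10 - e11 - (B.val 1 0 + B.val 1 1) * hk
  rcases (Int.prime_three.dvd_or_dvd h2) with ⟨l, hl⟩ | h
  · exfalso
    have h3 : (3 : ℤ) * (l * B.val 0 0 + (k - l) * B.val 1 0) = 1 := by
      linear_combination e00 - e10 - B.val 0 0 * hl - B.val 1 0 * (hk - hl)
    omega
  · exact h

theorem preservesDiagonal_of_mem {A : GL (Fin 2) ℤ} (h : A ∈ diagGroup) : PreservesDiagonal A := by
  induction h using Subgroup.closure_induction with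
  | mem x hx =>
    simp only [Set.mem_insert_iff, Set.mem_singleton_iff] at hx
    rcases hx with rfl | rfl | rfl | rfl <;> unfold PreservesDiagonal <;> decide
  | one => exact preservesDiagonal_one
  | mul x y _ _ hx hy => exact hx.mul hy
  | inv x _ hx => exact hx.inv

/-- The generator `T` of `SL(2, ℤ)`. -/
def matT : GL (Fin 2) ℤ := ⟨!![1, 1; 0, 1], !![1, -1; 0, 1], by decide, by decide⟩

/-- The generator `S` of `SL(2, ℤ)`. -/
def matS : GL (Fin 2) ℤ := ⟨!![0, -1; 1, 0], !![0, 1; -1, 0], by decide, by decide⟩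

/-- Representatives of the four cosets: they pull the line spanned by `(1, 1)` modulo three back to
the four lines of `(ℤ / 3)²`. -/
def cosetRep : Fin 4 → GL (Fin 2) ℤ := ![1, matT, matT⁻¹, matT * matR]

/-- The union of the cosets of the representatives. -/
def cosetUnion : Set (GL (Fin 2) ℤ) := {N | ∃ h ∈ diagGroup, ∃ i, N = h * cosetRep i}

/-- The union of the cosets is stable under right multiplication by `s` if the representatives
stay in it. -/
theorem mul_mem_cosetUnion_of_rep {s : GL (Fin 2) ℤ}
    (hs : ∀ i, cosetRep i * s ∈ cosetUnion) {N : GL (Fin 2) ℤ} (hN : N ∈ cosetUnion) :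
    N * s ∈ cosetUnion := by
  obtain ⟨h, hh, i, rfl⟩ := hN
  obtain ⟨h', hh', j, hj⟩ := hs i
  exact ⟨h * h', mul_mem hh hh', j, by rw [mul_assoc, hj, mul_assoc]⟩

theorem cosetRep_mul_T (i : Fin 4) : cosetRep i * matT ∈ cosetUnion := by
  fin_cases i
  · exact ⟨1, one_mem _, 1, by decide⟩
  · exact ⟨matA * matB, mul_mem matA_mem matB_mem, 2, by decide⟩
  · exact ⟨1, one_mem _, 0, by decide⟩
  · exact ⟨matA * matR, mul_mem matA_mem matR_mem, 3, by decide⟩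

theorem cosetRep_mul_T_inv (i : Fin 4) : cosetRep i * matT⁻¹ ∈ cosetUnion := by
  fin_cases i
  · exact ⟨1, one_mem _, 2, by decide⟩
  · exact ⟨1, one_mem _, 0, by decide⟩
  · exact ⟨matB * matA, mul_mem matB_mem matA_mem, 1, by decide⟩
  · exact ⟨matR * matA, mul_mem matR_mem matA_mem, 3, by decide⟩

theorem cosetRep_mul_R (i : Fin 4) : cosetRep i * matR ∈ cosetUnion := by
  fin_cases i
  · exact ⟨matR, matR_mem, 0, by decide⟩
  · exact ⟨1, one_mem _, 3, by decide⟩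
  · exact ⟨-(matR * matB * matR),
      neg_mem_diagGroup (mul_mem (mul_mem matR_mem matB_mem) matR_mem), 2, by decide⟩
  · exact ⟨1, one_mem _, 1, by decide⟩

theorem cosetRep_mul_S (i : Fin 4) : cosetRep i * matS ∈ cosetUnion := by
  fin_cases i
  · exact ⟨-(matR * matB), neg_mem_diagGroup (mul_mem matR_mem matB_mem), 2, by decide⟩
  · exact ⟨matA, matA_mem, 3, by decide⟩
  · exact ⟨matB * matR, mul_mem matB_mem matR_mem, 0, by decide⟩
  · exact ⟨-matA, neg_mem_diagGroup matA_mem, 1, by decide⟩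

theorem neg_mem_cosetUnion {N : GL (Fin 2) ℤ} (hN : N ∈ cosetUnion) : -N ∈ cosetUnion := by
  obtain ⟨h, hh, i, rfl⟩ := hN
  exact ⟨-h, neg_mem_diagGroup hh, i, by rw [neg_mul]⟩

theorem toGL_mem_cosetUnion (g : Matrix.SpecialLinearGroup (Fin 2) ℤ) :
    ∀ N ∈ cosetUnion, N * Matrix.SpecialLinearGroup.toGL g ∈ cosetUnion := by
  have hg : g ∈ Subgroup.closure {ModularGroup.S, ModularGroup.T} := by
    rw [SpecialLinearGroup.SL2Z_generators]
    trivial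
  have hS : Matrix.SpecialLinearGroup.toGL ModularGroup.S = matS := by
    ext i j; fin_cases i <;> fin_cases j <;> rfl
  have hT : Matrix.SpecialLinearGroup.toGL ModularGroup.T = matT := by
    ext i j; fin_cases i <;> fin_cases j <;> rfl
  induction hg using Subgroup.closure_induction'' with
  | mem x hx =>
    rcases hx with rfl | rfl
    · exact fun N hN => hS ▸ mul_mem_cosetUnion_of_rep cosetRep_mul_S hN
    · exact fun N hN => hT ▸ mul_mem_cosetUnion_of_rep cosetRep_mul_T hN
  | inv_mem x hx =>
    rcases hx with rfl | rfl
    · intro N hN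
      have h : matS⁻¹ = -matS := by decide
      rw [map_inv, hS, h, mul_neg]
      exact neg_mem_cosetUnion (mul_mem_cosetUnion_of_rep cosetRep_mul_S hN)
    · intro N hN
      rw [map_inv, hT]
      exact mul_mem_cosetUnion_of_rep cosetRep_mul_T_inv hN
  | one => simp
  | mul x y _ _ hx hy =>
    intro N hN
    rw [map_mul, ← mul_assoc]
    exact hy _ (hx _ hN)

theorem mem_cosetUnion (N : GL (Fin 2) ℤ) : N ∈ cosetUnion := by
  have h1 : (1 : GL (Fin 2) ℤ) ∈ cosetUnion := ⟨1, one_mem _, 0, by decide⟩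
  have key : ∀ M : GL (Fin 2) ℤ, M.val.det = 1 → M ∈ cosetUnion := by
    intro M hM
    have h2 := toGL_mem_cosetUnion ⟨M.val, hM⟩ 1 h1
    rw [one_mul] at h2
    convert h2
    ext i j
    rfl
  rcases Int.isUnit_iff.1 ((Matrix.isUnit_iff_isUnit_det _).1 N.isUnit) with h | h
  · exact key N h
  · have h2 : N * matR ∈ cosetUnion := key _ (by
      rw [Units.val_mul, Matrix.det_mul, h]
      decide)
    have h3 := mul_mem_cosetUnion_of_rep cosetRep_mul_R h2
    have h4 : matR * matR = 1 := by decide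
    rwa [mul_assoc, h4, mul_one] at h3

/-- The four representatives lie in different cosets of the stabilizer of the line. -/
theorem cosetRep_injective_mod (i j : Fin 4) (h : PreservesDiagonal (cosetRep i * (cosetRep j)⁻¹)) :
    i = j := by
  unfold PreservesDiagonal at h
  revert i j
  decide

theorem mem_diagGroup_iff {A : GL (Fin 2) ℤ} : A ∈ diagGroup ↔ PreservesDiagonal A := by
  refine ⟨preservesDiagonal_of_mem, fun hA => ?_⟩
  obtain ⟨h, hh, i, rfl⟩ := mem_cosetUnion A
  have h1 : PreservesDiagonal (cosetRep i * (cosetRep 0)⁻¹) := by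
    have := (preservesDiagonal_of_mem hh).inv.mul hA
    have h0 : cosetRep 0 = 1 := rfl
    rw [h0]
    simpa using this
  rw [cosetRep_injective_mod _ _ h1]
  exact mul_mem hh (one_mem _)

theorem index_diagGroup : diagGroup.index = 4 := by
  have hbij : Function.Bijective
      (fun i : Fin 4 => (QuotientGroup.mk (cosetRep i)⁻¹ : GL (Fin 2) ℤ ⧸ diagGroup)) := by
    constructor
    · intro i j h
      rw [QuotientGroup.eq, inv_inv] at h
      exact cosetRep_injective_mod i j (preservesDiagonal_of_mem h)
    · intro x
      obtain ⟨N, rfl⟩ := QuotientGroup.mk_surjective x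
      obtain ⟨h, hh, i, hN⟩ := mem_cosetUnion N⁻¹
      refine ⟨i, ?_⟩
      simp only
      rw [QuotientGroup.eq, inv_inv]
      rw [← inv_inv N, hN]
      simpa using inv_mem hh
  rw [Subgroup.index, ← Nat.card_congr (Equiv.ofBijective _ hbij)]
  simp

theorem intToReal_mk (A : GL (Fin 2) ℤ) :
    intToReal (Matrix.ProjGenLinGroup.mk A) = Matrix.ProjGenLinGroup.mk (castGL A) := rfl

theorem closure_generator :
    Subgroup.closure (Set.range generator) =
      (diagGroup.map Matrix.ProjGenLinGroup.mk).map intToReal := by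
  have h0 : generator 0 = intToReal (Matrix.ProjGenLinGroup.mk matR) := rfl
  have h1 : generator 1 = intToReal (Matrix.ProjGenLinGroup.mk matA) := rfl
  have h2 : generator 2 = intToReal (Matrix.ProjGenLinGroup.mk matB) := rfl
  have hneg : Matrix.ProjGenLinGroup.mk (-1 : GL (Fin 2) ℤ) = 1 := by
    rw [Matrix.ProjGenLinGroup.mk_eq_one, Subgroup.mem_center_iff]
    simp
  refine le_antisymm ((Subgroup.closure_le _).2 ?_) ?_
  · rintro _ ⟨i, rfl⟩
    fin_cases i
    · exact ⟨_, ⟨_, matR_mem, rfl⟩, rfl⟩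
    · exact ⟨_, ⟨_, matA_mem, rfl⟩, rfl⟩
    · exact ⟨_, ⟨_, matB_mem, rfl⟩, rfl⟩
  · rw [Subgroup.map_map, Subgroup.map_le_iff_le_comap, diagGroup, Subgroup.closure_le]
    intro x hx
    simp only [Set.mem_insert_iff, Set.mem_singleton_iff] at hx
    rw [SetLike.mem_coe, Subgroup.mem_comap, MonoidHom.comp_apply]
    rcases hx with rfl | rfl | rfl | rfl
    · exact Subgroup.subset_closure ⟨0, h0⟩
    · exact Subgroup.subset_closure ⟨1, h1⟩
    · exact Subgroup.subset_closure ⟨2, h2⟩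
    · rw [hneg, map_one]
      exact one_mem _

/-- The projectivized Veech group is determined by the two facts that the generators belong to the
Veech group, and that the Veech group preserves the diagonal modulo three. -/
theorem projVeechGroupInBasis_eq_closure {T : Type} {G : Gluing T} [Nonempty T]
    (hgen : castGL matR ∈ veechGroupInBasis G.Surface ∧ castGL matA ∈ veechGroupInBasis G.Surface ∧
      castGL matB ∈ veechGroupInBasis G.Surface)
    (hdiag : ∀ A : GL (Fin 2) ℤ, castGL A ∈ veechGroupInBasis G.Surface → PreservesDiagonal A) :
    projVeechGroupInBasis G.Surface = Subgroup.closure (Set.range generator) := by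
  rw [projVeechGroupInBasis_eq]
  refine le_antisymm ?_ ((Subgroup.closure_le _).2 ?_)
  · rw [closure_generator]
    rintro _ ⟨N, hN, rfl⟩
    obtain ⟨A, rfl⟩ := exists_castGL_eq hN
    exact ⟨_, ⟨A, mem_diagGroup_iff.2 (hdiag A hN), rfl⟩, rfl⟩
  · rintro _ ⟨i, rfl⟩
    fin_cases i
    · exact ⟨_, hgen.1, rfl⟩
    · exact ⟨_, hgen.2.1, rfl⟩
    · exact ⟨_, hgen.2.2, rfl⟩

theorem projVeechGroupInBasis_Z :
    projVeechGroupInBasis Z = Subgroup.closure (Set.range generator) :=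
  projVeechGroupInBasis_eq_closure generators_mem_Z
    fun _ => preservesDiagonal_of_mem_veechGroupInBasis_Z

theorem projVeechGroupInBasis_S :
    projVeechGroupInBasis S = Subgroup.closure (Set.range generator) :=
  projVeechGroupInBasis_eq_closure generators_mem_S
    fun _ => preservesDiagonal_of_mem_veechGroupInBasis_S

theorem intToReal_injective : Function.Injective intToReal := by
  rw [injective_iff_map_eq_one]
  intro x hx
  obtain ⟨A, rfl⟩ := Matrix.ProjGenLinGroup.mk_surjective x
  rw [intToReal_mk, Matrix.ProjGenLinGroup.mk_eq_one, Subgroup.mem_center_iff] at hx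
  rw [Matrix.ProjGenLinGroup.mk_eq_one, Subgroup.mem_center_iff]
  intro g
  apply castGL_injective
  rw [map_mul, map_mul, hx]

theorem closure_generator_le_range :
    Subgroup.closure (Set.range generator) ≤ intToReal.range := by
  rw [closure_generator]
  exact Subgroup.map_le_range _ _

theorem index_closure_generator :
    ((Subgroup.closure (Set.range generator)).comap intToReal).index = 4 := by
  rw [closure_generator, Subgroup.comap_map_eq_self_of_injective intToReal_injective,
    ← Subgroup.index_comap_of_surjective _ Matrix.ProjGenLinGroup.mk_surjective,
    Subgroup.comap_map_eq, Matrix.ProjGenLinGroup.ker_mk, sup_eq_left.2, index_diagGroup]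
  rw [Matrix.GeneralLinearGroup.center_eq_range_scalar]
  rintro _ ⟨u, rfl⟩
  rcases Int.units_eq_one_or u with rfl | rfl
  · rw [map_one]
    exact one_mem _
  · convert neg_one_mem_diagGroup
    decide

/-! ### Isometries of the hyperbolic plane -/

open UpperHalfPlane in
/-- The effect of a Möbius or anti-Möbius transformation on Euclidean distances. -/
theorem dist_coe_smul_sq (g : GL (Fin 2) ℝ) (z w : ℍ) :
    dist ((g • z : ℍ) : ℂ) (g • w : ℍ) ^ 2 * (Complex.normSq (denom g z) *
      Complex.normSq (denom g w)) = g.val.det ^ 2 * dist (z : ℂ) w ^ 2 := by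
  have hz := denom_ne_zero g z
  have hw := denom_ne_zero g w
  have key : num g z / denom g z - num g w / denom g w =
      (g.val.det : ℂ) * (z - w) / (denom g z * denom g w) := by
    rw [div_sub_div _ _ hz hw]
    congr 1
    simp [num, denom, Matrix.det_fin_two]
    ring
  rw [dist_eq_norm, coe_smul, coe_smul, ← map_sub, norm_σ, key, norm_div, norm_mul, norm_mul,
    dist_eq_norm, div_pow, mul_pow, Complex.norm_real, Real.norm_eq_abs, sq_abs,
    Complex.normSq_eq_norm_sq, Complex.normSq_eq_norm_sq, ← mul_pow]
  have : (‖denom g z‖ * ‖denom g w‖) ^ 2 ≠ 0 :=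
    pow_ne_zero _ (mul_ne_zero (norm_ne_zero_iff.2 hz) (norm_ne_zero_iff.2 hw))
  field_simp

theorem dist_eq_of_cosh {z w z' w' : ℍ} (h : Real.cosh (dist z w) = Real.cosh (dist z' w')) :
    dist z w = dist z' w' :=
  Real.cosh_strictMonoOn.injOn (Set.mem_Ici.2 dist_nonneg) (Set.mem_Ici.2 dist_nonneg) h

open UpperHalfPlane in
instance : IsIsometricSMul PGL(2, ℝ) ℍ where
  isometry_smul g := by
    obtain ⟨g, rfl⟩ := Matrix.ProjGenLinGroup.mk_surjective g
    refine Isometry.of_dist_eq fun z w => dist_eq_of_cosh ?_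
    rw [pglMk_smul, pglMk_smul, cosh_dist, cosh_dist, im_smul_eq_div_normSq,
      im_smul_eq_div_normSq]
    have hz := Complex.normSq_pos.2 (denom_ne_zero g z)
    have hw := Complex.normSq_pos.2 (denom_ne_zero g w)
    have hd : |g.det.val| ≠ 0 := abs_ne_zero.2 g.det.ne_zero
    have hd2 : |g.det.val| ^ 2 = g.val.det ^ 2 := sq_abs _
    have h := dist_coe_smul_sq g z w
    rw [← hd2] at h
    have iz := z.im_pos
    have iw := w.im_pos
    rw [add_right_inj, div_eq_div_iff (by positivity) (by positivity)]
    field_simp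
    linear_combination h

/-- The action of `PGL(2, ℝ)` on the hyperbolic plane by isometries. -/
noncomputable def isometryHom : PGL(2, ℝ) →* (ℍ ≃ᵢ ℍ) where
  toFun g := IsometryEquiv.constSMul g
  map_one' := by ext z; simp
  map_mul' g h := by
    apply IsometryEquiv.ext
    intro z
    exact mul_smul g h z

theorem isometryHom_apply (g : PGL(2, ℝ)) (z : ℍ) : isometryHom g z = g • z := rfl

theorem isometryHom_injective : Function.Injective isometryHom := by
  rw [injective_iff_map_eq_one]
  intro g hg
  obtain ⟨g, rfl⟩ := Matrix.ProjGenLinGroup.mk_surjective g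
  rw [Matrix.ProjGenLinGroup.mk_eq_one, ← UpperHalfPlane.forall_smul_eq_self_iff_mem_center]
  intro z
  rw [← UpperHalfPlane.pglMk_smul, ← isometryHom_apply, hg]
  rfl

/-! ### The triangle with vertices `e^{2πi/3}`, `1`, `∞` -/

/-- The primitive cube root of unity in the upper half-plane. -/
noncomputable def omega : ℍ := ⟨⟨-1 / 2, √3 / 2⟩, by positivity⟩

theorem re_omega : omega.re = -1 / 2 := rfl
theorem im_omega : omega.im = √3 / 2 := rfl

theorem direction_infty (p : ℍ) : direction p OnePoint.infty = 1 := rfl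

theorem direction_coe (p : ℍ) (x : ℝ) :
    direction p (x : OnePoint ℝ) = ((x : ℂ) - p) / ((x : ℂ) - (starRingEnd ℂ) p) := rfl

theorem coe_sub_conj_ne_zero (p : ℍ) (x : ℝ) : (x : ℂ) - (starRingEnd ℂ) (p : ℂ) ≠ 0 := by
  intro h
  have := congrArg Complex.im h
  simp at this
  exact p.im_pos.ne' this

theorem norm_direction (p : ℍ) (x : ℝ) : ‖direction p (x : OnePoint ℝ)‖ = 1 := by
  rw [direction_coe, norm_div]
  have : ‖(x : ℂ) - (starRingEnd ℂ) (p : ℂ)‖ = ‖(x : ℂ) - p‖ := by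
    rw [← Complex.norm_conj ((x : ℂ) - p)]
    simp
  rw [← this, div_self (norm_ne_zero_iff.2 (coe_sub_conj_ne_zero p x))]

theorem re_direction (p : ℍ) (x : ℝ) : (direction p (x : OnePoint ℝ)).re =
    ((x - p.re) ^ 2 - p.im ^ 2) / ((x - p.re) ^ 2 + p.im ^ 2) := by
  rw [direction_coe, Complex.div_re, ← add_div]
  congr 1
  · simp
    ring
  · simp [Complex.normSq_apply]
    ring

theorem cos_angle_direction_infty (p : ℍ) (x : ℝ) :
    Real.cos (InnerProductGeometry.angle (direction p (x : OnePoint ℝ))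
      (direction p OnePoint.infty)) =
      ((x - p.re) ^ 2 - p.im ^ 2) / ((x - p.re) ^ 2 + p.im ^ 2) := by
  rw [InnerProductGeometry.cos_angle, norm_direction, direction_infty, ← re_direction]
  simp [Complex.inner]

theorem angle_direction_infty_iff (p : ℍ) (x : ℝ) :
    InnerProductGeometry.angle (direction p (x : OnePoint ℝ)) (direction p OnePoint.infty) =
      Real.pi / 3 ↔ (x - p.re) ^ 2 = 3 * p.im ^ 2 := by
  have hp := p.im_pos
  have hpos : 0 < (x - p.re) ^ 2 + p.im ^ 2 := by positivity
  have h1 : ((x - p.re) ^ 2 - p.im ^ 2) / ((x - p.re) ^ 2 + p.im ^ 2) = 1 / 2 ↔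
      (x - p.re) ^ 2 = 3 * p.im ^ 2 := by
    rw [div_eq_div_iff hpos.ne' two_ne_zero]
    constructor <;> intro h <;> linarith
  rw [← h1, ← cos_angle_direction_infty, ← Real.cos_pi_div_three]
  constructor
  · intro h
    rw [h]
  · refine fun h => Real.injOn_cos ⟨InnerProductGeometry.angle_nonneg _ _,
      InnerProductGeometry.angle_le_pi _ _⟩ ⟨by positivity, by linarith [Real.pi_pos]⟩ h

/-- The hyperbolic triangle with vertices `e^{2πi/3}`, `1` and `∞`. -/
noncomputable def stdTriangle : IdealTriangle where
  p := omega
  ξ := ((1 : ℝ) : OnePoint ℝ)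
  η := OnePoint.infty
  angle_eq := by
    rw [angle_direction_infty_iff, re_omega, im_omega, div_pow, Real.sq_sqrt (by norm_num)]
    norm_num

/-- The sides of the triangle: the unit circle and the lines `Re z = 1` and `Re z = -1/2`. -/
noncomputable def stdLine : Fin 3 → HypLine :=
  ![⟨1, 0, -1, by norm_num⟩, ⟨0, 1, -1, by norm_num⟩, ⟨0, 2, 1, by norm_num⟩]

theorem normSq_omega : Complex.normSq omega = 1 := by
  rw [Complex.normSq_apply]
  change -1 / 2 * (-1 / 2) + √3 / 2 * (√3 / 2) = 1
  nlinarith [Real.mul_self_sqrt (show (0 : ℝ) ≤ 3 by norm_num)]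

theorem isSide_stdLine (i : Fin 3) : stdTriangle.IsSide i (stdLine i) := by
  fin_cases i
  · refine ⟨?_, Or.inr ⟨1, rfl, ?_⟩⟩
    · change 1 * Complex.normSq omega + 0 * omega.re + -1 = 0
      rw [normSq_omega]
      norm_num
    · change (1 : ℝ) * 1 ^ 2 + 0 * 1 + -1 = 0
      norm_num
  · refine ⟨Or.inr ⟨1, rfl, ?_⟩, Or.inl ⟨rfl, rfl⟩⟩
    change (0 : ℝ) * 1 ^ 2 + 1 * 1 + -1 = 0
    norm_num
  · refine ⟨Or.inl ⟨rfl, rfl⟩, ?_⟩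
    change 0 * Complex.normSq omega + 2 * omega.re + 1 = 0
    rw [re_omega]
    norm_num

theorem points_stdLine_zero : (stdLine 0).points = {z : ℍ | Complex.normSq z = 1} := by
  ext z
  change 1 * Complex.normSq z + 0 * z.re + -1 = 0 ↔ Complex.normSq z = 1
  constructor <;> intro h <;> linarith

theorem points_stdLine_one : (stdLine 1).points = {z | z.re = 1} := by
  ext z
  change 0 * Complex.normSq z + 1 * z.re + -1 = 0 ↔ z.re = 1
  constructor <;> intro h <;> linarith

theorem points_stdLine_two : (stdLine 2).points = {z | z.re = -1 / 2} := by
  ext z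
  change 0 * Complex.normSq z + 2 * z.re + 1 = 0 ↔ z.re = -1 / 2
  constructor <;> intro h <;> linarith

theorem a_eq_zero_of_infty_mem_endpoints {ℓ : HypLine} (h : OnePoint.infty ∈ ℓ.endpoints) :
    ℓ.a = 0 := by
  rcases h with ⟨-, h⟩ | ⟨x, h, -⟩
  · exact h
  · exact absurd h (OnePoint.infty_ne_coe x)

theorem coe_mem_endpoints {ℓ : HypLine} {x : ℝ} :
    (x : OnePoint ℝ) ∈ ℓ.endpoints ↔ ℓ.a * x ^ 2 + ℓ.b * x + ℓ.c = 0 := by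
  constructor
  · rintro (⟨h, -⟩ | ⟨y, h, h'⟩)
    · exact absurd h (OnePoint.coe_ne_infty x)
    · rw [OnePoint.coe_eq_coe.1 h]
      exact h'
  · exact fun h => Or.inr ⟨x, rfl, h⟩

/-- The line through a side of the triangle is unique. -/
theorem points_eq_of_isSide {i : Fin 3} {ℓ : HypLine} (h : stdTriangle.IsSide i ℓ) :
    ℓ.points = (stdLine i).points := by
  have hd := ℓ.disc_pos
  fin_cases i
  · obtain ⟨h1, h2⟩ := h
    replace h1 : ℓ.a * Complex.normSq omega + ℓ.b * omega.re + ℓ.c = 0 := h1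
    replace h2 := coe_mem_endpoints.1 h2
    rw [normSq_omega, re_omega] at h1
    have hb : ℓ.b = 0 := by linarith
    have hc : ℓ.c = -ℓ.a := by rw [hb] at h2; linarith
    have ha : ℓ.a ≠ 0 := by
      intro h0
      rw [hb, hc, h0] at hd
      norm_num at hd
    change ℓ.points = (stdLine 0).points
    rw [points_stdLine_zero]
    ext z
    change ℓ.a * Complex.normSq z + ℓ.b * z.re + ℓ.c = 0 ↔ Complex.normSq z = 1
    rw [hb, hc]
    constructor
    · intro h
      have : ℓ.a * (Complex.normSq z - 1) = 0 := by linarith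
      have := (mul_eq_zero.1 this).resolve_left ha
      linarith
    · intro h
      rw [h]
      ring
  · obtain ⟨h1, h2⟩ := h
    replace h1 := coe_mem_endpoints.1 h1
    replace h2 : ℓ.a = 0 := a_eq_zero_of_infty_mem_endpoints h2
    have hb : ℓ.b ≠ 0 := by
      intro h0
      rw [h0, h2] at hd
      norm_num at hd
    change ℓ.points = (stdLine 1).points
    rw [points_stdLine_one]
    ext z
    change ℓ.a * Complex.normSq z + ℓ.b * z.re + ℓ.c = 0 ↔ z.re = 1
    rw [h2] at h1 ⊢
    constructor
    · intro h
      have : ℓ.b * (z.re - 1) = 0 := by linarith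
      have := (mul_eq_zero.1 this).resolve_left hb
      linarith
    · intro h
      rw [h]
      linarith
  · obtain ⟨h1, h2⟩ := h
    replace h1 : ℓ.a = 0 := a_eq_zero_of_infty_mem_endpoints h1
    replace h2 : ℓ.a * Complex.normSq omega + ℓ.b * omega.re + ℓ.c = 0 := h2
    have hb : ℓ.b ≠ 0 := by
      intro h0
      rw [h0, h1] at hd
      norm_num at hd
    change ℓ.points = (stdLine 2).points
    rw [points_stdLine_two]
    ext z
    change ℓ.a * Complex.normSq z + ℓ.b * z.re + ℓ.c = 0 ↔ z.re = -1 / 2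
    rw [h1, re_omega] at h2
    rw [h1]
    constructor
    · intro h
      have : ℓ.b * (z.re + 1 / 2) = 0 := by linarith
      have := (mul_eq_zero.1 this).resolve_left hb
      linarith
    · intro h
      rw [h]
      linarith

/-- The generators act as the reflections in the sides of the triangle. -/
theorem isReflection_generator (i : Fin 3) :
    (stdLine i).IsReflection (isometryHom (generator i)) := by
  have h0 : generator 0 = Matrix.ProjGenLinGroup.mk (castGL matR) := rfl
  have h1 : generator 1 = Matrix.ProjGenLinGroup.mk (castGL matA) := rfl
  have h2 : generator 2 = Matrix.ProjGenLinGroup.mk (castGL matB) := rfl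
  fin_cases i
  · change {z | isometryHom (generator 0) z = z} = (stdLine 0).points
    rw [points_stdLine_zero, h0]
    ext z
    change Matrix.ProjGenLinGroup.mk (castGL matR) • z = z ↔ Complex.normSq z = 1
    rw [UpperHalfPlane.pglMk_smul, UpperHalfPlane.gl_smul_eq_self_iff_dist_sq_eq]
    · simp [Matrix.det_fin_two, matR, dist_eq_norm, Complex.normSq_eq_norm_sq]
    · simp [Matrix.det_fin_two, matR]
    · simp [Matrix.trace_fin_two, matR]
    · simp [matR]
  · change {z | isometryHom (generator 1) z = z} = (stdLine 1).points
    rw [points_stdLine_one, h1]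
    ext z
    change Matrix.ProjGenLinGroup.mk (castGL matA) • z = z ↔ z.re = 1
    rw [UpperHalfPlane.pglMk_smul, UpperHalfPlane.gl_smul_eq_self_iff_re_eq]
    · simp [val_matA]
    · simp [Matrix.trace_fin_two, val_matA]
    · simp [val_matA]
  · change {z | isometryHom (generator 2) z = z} = (stdLine 2).points
    rw [points_stdLine_two, h2]
    ext z
    change Matrix.ProjGenLinGroup.mk (castGL matB) • z = z ↔ z.re = -1 / 2
    rw [UpperHalfPlane.pglMk_smul, UpperHalfPlane.gl_smul_eq_self_iff_re_eq]
    · simp [val_matB]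
    · simp [Matrix.trace_fin_two, val_matB]
    · simp [val_matB]

/-! ### Uniqueness of reflections -/

theorem dist_coe_sq (z u : ℍ) :
    dist (z : ℂ) u ^ 2 = (z.re - u.re) ^ 2 + (z.im - u.im) ^ 2 := by
  rw [dist_eq_norm, ← Complex.normSq_eq_norm_sq, Complex.normSq_apply]
  simp
  ring

/-- The equation of the perpendicular bisector of two points. -/
theorem eq_of_dist_eq {z w u : ℍ} (h : dist z u = dist w u) :
    ((z.re - u.re) ^ 2 + (z.im - u.im) ^ 2) * w.im =
      ((w.re - u.re) ^ 2 + (w.im - u.im) ^ 2) * z.im := by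
  have h1 := congrArg Real.cosh h
  have hz := z.im_pos
  have hw := w.im_pos
  have hu := u.im_pos
  rw [UpperHalfPlane.cosh_dist, UpperHalfPlane.cosh_dist, dist_coe_sq, dist_coe_sq, add_right_inj,
    div_eq_div_iff (by positivity) (by positivity)] at h1
  have h2 : (2 * u.im) * (((z.re - u.re) ^ 2 + (z.im - u.im) ^ 2) * w.im) =
      (2 * u.im) * (((w.re - u.re) ^ 2 + (w.im - u.im) ^ 2) * z.im) := by linear_combination h1
  exact mul_left_cancel₀ (by positivity) h2

theorem ext_re_im {z w : ℍ} (h1 : z.re = w.re) (h2 : z.im = w.im) : z = w :=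
  UpperHalfPlane.ext (Complex.ext h1 h2)

/-- A point off the line `Re z = a` is determined, up to reflection, by its distances to
the points of the line. -/
theorem eq_of_dist_vertical {a : ℝ} {z w : ℍ} (h : ∀ u : ℍ, u.re = a → dist z u = dist w u)
    (hne : w ≠ z) : w.re = 2 * a - z.re ∧ w.im = z.im := by
  have h1 := eq_of_dist_eq (h ⟨⟨a, 1⟩, one_pos⟩ rfl)
  have h2 := eq_of_dist_eq (h ⟨⟨a, 2⟩, two_pos⟩ rfl)
  change ((z.re - a) ^ 2 + (z.im - 1) ^ 2) * w.im = ((w.re - a) ^ 2 + (w.im - 1) ^ 2) * z.im at h1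
  change ((z.re - a) ^ 2 + (z.im - 2) ^ 2) * w.im = ((w.re - a) ^ 2 + (w.im - 2) ^ 2) * z.im at h2
  have him : w.im = z.im := by linarith
  have hz := z.im_pos
  rw [him] at h1
  have h3 := mul_right_cancel₀ hz.ne' h1
  have h4 : (z.re - w.re) * (z.re + w.re - 2 * a) = 0 := by linear_combination h3
  rcases mul_eq_zero.1 h4 with h5 | h5
  · exact absurd (ext_re_im (by linarith) him) hne
  · exact ⟨by linarith, him⟩

/-- A point off the unit circle is determined, up to inversion, by its distances to the points of
the circle. -/
theorem eq_of_dist_circle {z w : ℍ} (h : ∀ u : ℍ, Complex.normSq u = 1 → dist z u = dist w u)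
    (hne : w ≠ z) : w.re * (z.re ^ 2 + z.im ^ 2) = z.re ∧
      w.im * (z.re ^ 2 + z.im ^ 2) = z.im := by
  have h1 := eq_of_dist_eq (h ⟨⟨0, 1⟩, one_pos⟩ (by simp [Complex.normSq_apply]))
  have h2 := eq_of_dist_eq (h ⟨⟨3 / 5, 4 / 5⟩, by norm_num⟩
    (by simp [Complex.normSq_apply]; norm_num))
  change ((z.re - 0) ^ 2 + (z.im - 1) ^ 2) * w.im = ((w.re - 0) ^ 2 + (w.im - 1) ^ 2) * z.im at h1
  change ((z.re - 3 / 5) ^ 2 + (z.im - 4 / 5) ^ 2) * w.im =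
    ((w.re - 3 / 5) ^ 2 + (w.im - 4 / 5) ^ 2) * z.im at h2
  have hz := z.im_pos
  have hw := w.im_pos
  -- both points lie on one ray from the origin
  have h3 : z.re * w.im = w.re * z.im := by linarith
  have h4 : (w.im - z.im) * (w.im * (z.re ^ 2 + z.im ^ 2) - z.im) = 0 := by
    linear_combination (-z.im) * h1 + (z.re * w.im + w.re * z.im) * h3
  rcases mul_eq_zero.1 h4 with h5 | h5
  · have him : w.im = z.im := by linarith
    rw [him] at h3
    exact absurd (ext_re_im (mul_right_cancel₀ hz.ne' h3).symm him) hne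
  · have h6 : w.im * (z.re ^ 2 + z.im ^ 2) = z.im := by linarith
    refine ⟨?_, h6⟩
    have : (w.re * (z.re ^ 2 + z.im ^ 2)) * z.im = z.re * z.im := by
      linear_combination (-(z.re ^ 2 + z.im ^ 2)) * h3 + z.re * h6
    exact mul_right_cancel₀ hz.ne' this

/-- The reflection in a side of the standard triangle is determined by its fixed points. -/
theorem isReflection_unique {ℓ : HypLine} {i : Fin 3} (hℓ : ℓ.points = (stdLine i).points)
    {σ σ' : ℍ ≃ᵢ ℍ} (h : ℓ.IsReflection σ) (h' : ℓ.IsReflection σ') : σ = σ' := by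
  apply IsometryEquiv.ext
  intro z
  have fix : ∀ u, u ∈ ℓ.points → σ u = u := fun u hu => by rw [← h] at hu; exact hu
  have fix' : ∀ u, u ∈ ℓ.points → σ' u = u := fun u hu => by rw [← h'] at hu; exact hu
  by_cases hz : z ∈ ℓ.points
  · rw [fix z hz, fix' z hz]
  · have hne : σ z ≠ z := fun e => hz (h ▸ e)
    have hne' : σ' z ≠ z := fun e => hz (h' ▸ e)
    have hd : ∀ u ∈ ℓ.points, dist z u = dist (σ z) u := fun u hu => by
      conv_rhs => rw [← fix u hu]
      exact (σ.isometry.dist_eq z u).symm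
    have hd' : ∀ u ∈ ℓ.points, dist z u = dist (σ' z) u := fun u hu => by
      conv_rhs => rw [← fix' u hu]
      exact (σ'.isometry.dist_eq z u).symm
    rw [hℓ] at hd hd'
    fin_cases i
    · replace hd : ∀ u ∈ (stdLine 0).points, dist z u = dist (σ z) u := hd
      replace hd' : ∀ u ∈ (stdLine 0).points, dist z u = dist (σ' z) u := hd'
      rw [points_stdLine_zero] at hd hd'
      obtain ⟨e1, e2⟩ := eq_of_dist_circle hd hne
      obtain ⟨e1', e2'⟩ := eq_of_dist_circle hd' hne'
      have hz := z.im_pos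
      have hpos : z.re ^ 2 + z.im ^ 2 ≠ 0 := by positivity
      exact ext_re_im (mul_right_cancel₀ hpos (e1.trans e1'.symm))
        (mul_right_cancel₀ hpos (e2.trans e2'.symm))
    · replace hd : ∀ u ∈ (stdLine 1).points, dist z u = dist (σ z) u := hd
      replace hd' : ∀ u ∈ (stdLine 1).points, dist z u = dist (σ' z) u := hd'
      rw [points_stdLine_one] at hd hd'
      obtain ⟨e1, e2⟩ := eq_of_dist_vertical hd hne
      obtain ⟨e1', e2'⟩ := eq_of_dist_vertical hd' hne'
      exact ext_re_im (e1.trans e1'.symm) (e2.trans e2'.symm)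
    · replace hd : ∀ u ∈ (stdLine 2).points, dist z u = dist (σ z) u := hd
      replace hd' : ∀ u ∈ (stdLine 2).points, dist z u = dist (σ' z) u := hd'
      rw [points_stdLine_two] at hd hd'
      obtain ⟨e1, e2⟩ := eq_of_dist_vertical hd hne
      obtain ⟨e1', e2'⟩ := eq_of_dist_vertical hd' hne'
      exact ext_re_im (e1.trans e1'.symm) (e2.trans e2'.symm)

theorem reflectionGroup_stdTriangle :
    stdTriangle.reflectionGroup = (Subgroup.closure (Set.range generator)).map isometryHom := by
  rw [MonoidHom.map_closure, IdealTriangle.reflectionGroup]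
  congr 1
  ext σ
  constructor
  · rintro ⟨i, ℓ, hs, hr⟩
    have hℓ := points_eq_of_isSide hs
    refine ⟨generator i, ⟨i, rfl⟩, isReflection_unique hℓ ?_ hr⟩
    exact (isReflection_generator i).trans hℓ.symm
  · rintro ⟨_, ⟨i, rfl⟩, rfl⟩
    exact ⟨i, stdLine i, isSide_stdLine i, isReflection_generator i⟩

/-! ### Congruence of triangles -/

/-- The preimage of a line under a Möbius or anti-Möbius transformation: the quadratic form is
composed with the matrix. -/
def HypLine.pullback (g : GL (Fin 2) ℝ) (ℓ : HypLine) : HypLine where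
  a := ℓ.a * g.val 0 0 ^ 2 + ℓ.b * g.val 0 0 * g.val 1 0 + ℓ.c * g.val 1 0 ^ 2
  b := 2 * ℓ.a * g.val 0 0 * g.val 0 1 +
    ℓ.b * (g.val 0 0 * g.val 1 1 + g.val 0 1 * g.val 1 0) + 2 * ℓ.c * g.val 1 0 * g.val 1 1
  c := ℓ.a * g.val 0 1 ^ 2 + ℓ.b * g.val 0 1 * g.val 1 1 + ℓ.c * g.val 1 1 ^ 2
  disc_pos := by
    have h1 := ℓ.disc_pos
    have h2 : 0 < g.val.det ^ 2 := by
      have := g.det_ne_zero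
      positivity
    have h3 := mul_pos h1 h2
    rw [Matrix.det_fin_two] at h3
    refine lt_of_lt_of_eq h3 ?_
    ring

open UpperHalfPlane in
theorem HypLine.mem_points_pullback (g : GL (Fin 2) ℝ) (ℓ : HypLine) (z : ℍ) :
    z ∈ (ℓ.pullback g).points ↔ g • z ∈ ℓ.points := by
  have hz := Complex.normSq_pos.2 (denom_ne_zero g z)
  have e1 : Complex.normSq (g • z : ℍ) = Complex.normSq (num g z) / Complex.normSq (denom g z) := by
    rw [coe_smul, Complex.normSq_eq_norm_sq, norm_σ, ← Complex.normSq_eq_norm_sq,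
      Complex.normSq_div]
  have e2 : (g • z).re = (num g z * (starRingEnd ℂ) (denom g z)).re /
      Complex.normSq (denom g z) := by
    rw [re_smul, Complex.div_re, ← add_div]
    simp
  change _ = 0 ↔ ℓ.a * Complex.normSq (g • z : ℍ) + ℓ.b * (g • z).re + ℓ.c = 0
  rw [e1, e2]
  have e3 : ℓ.a * (Complex.normSq (num g z) / Complex.normSq (denom g z)) +
      ℓ.b * ((num g z * (starRingEnd ℂ) (denom g z)).re / Complex.normSq (denom g z)) + ℓ.c =
      ((ℓ.pullback g).a * Complex.normSq z + (ℓ.pullback g).b * z.re + (ℓ.pullback g).c) /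
        Complex.normSq (denom g z) := by
    rw [eq_div_iff hz.ne']
    field_simp
    simp only [Complex.normSq_apply, num, denom, HypLine.pullback]
    simp
    ring
  rw [e3, div_eq_zero_iff, or_iff_left hz.ne']

theorem HypLine.mem_endpoints_pullback {g : GL (Fin 2) ℝ} {ℓ : HypLine} {ξ : OnePoint ℝ}
    (h : g • ξ ∈ ℓ.endpoints) : ξ ∈ (ℓ.pullback g).endpoints := by
  cases ξ with
  | infty =>
    refine Or.inl ⟨rfl, ?_⟩
    rw [OnePoint.smul_infty_eq_ite] at h
    split_ifs at h with h0
    · rw [HypLine.pullback]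
      simp [h0, a_eq_zero_of_infty_mem_endpoints h]
    · rw [coe_mem_endpoints] at h
      rw [HypLine.pullback]
      field_simp at h
      simp only
      linear_combination h
  | coe x =>
    rw [coe_mem_endpoints]
    rw [OnePoint.smul_some_eq_ite] at h
    split_ifs at h with h0
    · have ha := a_eq_zero_of_infty_mem_endpoints h
      simp only [HypLine.pullback, ha]
      linear_combination (ℓ.b * (g.val 0 0 * x + g.val 0 1) +
        ℓ.c * (g.val 1 0 * x + g.val 1 1)) * h0
    · rw [coe_mem_endpoints] at h
      have h1 : x * g.val 1 0 + g.val 1 1 ≠ 0 := by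
        rw [mul_comm]
        exact h0
      field_simp at h
      simp only [HypLine.pullback]
      linear_combination h

/-- The transformation `g` takes the vertices of `Δ` to those of `Δ'`. -/
def IdealTriangle.MapsTo (g : GL (Fin 2) ℝ) (Δ Δ' : IdealTriangle) : Prop :=
  g • Δ.p = Δ'.p ∧ g • Δ.ξ = Δ'.ξ ∧ g • Δ.η = Δ'.η

theorem IdealTriangle.MapsTo.inv {g : GL (Fin 2) ℝ} {Δ Δ' : IdealTriangle} (h : MapsTo g Δ Δ') :
    MapsTo g⁻¹ Δ' Δ :=
  ⟨inv_smul_eq_iff.2 h.1.symm, inv_smul_eq_iff.2 h.2.1.symm, inv_smul_eq_iff.2 h.2.2.symm⟩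

theorem IdealTriangle.MapsTo.isSide {g : GL (Fin 2) ℝ} {Δ Δ' : IdealTriangle} (h : MapsTo g Δ Δ')
    {i : Fin 3} {ℓ : HypLine} (hs : Δ'.IsSide i ℓ) : Δ.IsSide i (ℓ.pullback g) := by
  obtain ⟨hp, hξ, hη⟩ := h
  have key1 : Δ'.p ∈ ℓ.points → Δ.p ∈ (ℓ.pullback g).points := fun h => by
    rw [HypLine.mem_points_pullback, hp]
    exact h
  have key2 : Δ'.ξ ∈ ℓ.endpoints → Δ.ξ ∈ (ℓ.pullback g).endpoints := fun h =>
    HypLine.mem_endpoints_pullback (hξ ▸ h)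
  have key3 : Δ'.η ∈ ℓ.endpoints → Δ.η ∈ (ℓ.pullback g).endpoints := fun h =>
    HypLine.mem_endpoints_pullback (hη ▸ h)
  fin_cases i
  · exact ⟨key1 hs.1, key2 hs.2⟩
  · exact ⟨key2 hs.1, key3 hs.2⟩
  · exact ⟨key3 hs.1, key1 hs.2⟩

/-- The isometry of the hyperbolic plane given by a matrix. -/
noncomputable def glIsometry : GL (Fin 2) ℝ →* (ℍ ≃ᵢ ℍ) :=
  isometryHom.comp Matrix.ProjGenLinGroup.mk

theorem glIsometry_apply (g : GL (Fin 2) ℝ) (z : ℍ) : glIsometry g z = g • z :=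
  UpperHalfPlane.pglMk_smul g z

theorem HypLine.IsReflection.pullback {ℓ : HypLine} {σ : ℍ ≃ᵢ ℍ} (h : ℓ.IsReflection σ)
    (g : GL (Fin 2) ℝ) :
    (ℓ.pullback g).IsReflection ((glIsometry g)⁻¹ * σ * glIsometry g) := by
  ext z
  rw [HypLine.mem_points_pullback, ← h]
  change (glIsometry g).symm (σ (glIsometry g z)) = z ↔ σ (g • z) = g • z
  rw [IsometryEquiv.symm_apply_eq, glIsometry_apply]

theorem IdealTriangle.MapsTo.map_reflectionGroup_le {g : GL (Fin 2) ℝ} {Δ Δ' : IdealTriangle}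
    (h : MapsTo g Δ Δ') :
    Δ'.reflectionGroup.map (MulAut.conj (glIsometry g)⁻¹).toMonoidHom ≤ Δ.reflectionGroup := by
  rw [IdealTriangle.reflectionGroup, MonoidHom.map_closure, Subgroup.closure_le]
  rintro _ ⟨σ, ⟨i, ℓ, hs, hr⟩, rfl⟩
  refine Subgroup.subset_closure ⟨i, ℓ.pullback g, h.isSide hs, ?_⟩
  have := hr.pullback g
  simpa using this

theorem IdealTriangle.MapsTo.map_reflectionGroup {g : GL (Fin 2) ℝ} {Δ Δ' : IdealTriangle}
    (h : MapsTo g Δ Δ') :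
    Δ.reflectionGroup.map (MulAut.conj (glIsometry g)).toMonoidHom = Δ'.reflectionGroup := by
  refine le_antisymm ?_ ?_
  · simpa using h.inv.map_reflectionGroup_le
  · intro σ hσ
    refine ⟨_, h.map_reflectionGroup_le ⟨σ, hσ, rfl⟩, ?_⟩
    simp [mul_assoc]

/-- The matrix of `z ↦ a z + b`. For `a < 0` it acts as `z ↦ a z̄ + b`. -/
noncomputable def affineMat (a b : ℝ) (ha : a ≠ 0) : GL (Fin 2) ℝ :=
  Matrix.GeneralLinearGroup.mkOfDetNeZero !![a, b; 0, 1] (by simpa using ha)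

/-- The matrix of `z ↦ -1 / (z - x)`, which takes `x` to `∞`. -/
noncomputable def inversionMat (x : ℝ) : GL (Fin 2) ℝ :=
  Matrix.GeneralLinearGroup.mkOfDetNeZero !![0, -1; 1, -x] (by simp)

theorem val_affineMat (a b : ℝ) (ha : a ≠ 0) : (affineMat a b ha).val = !![a, b; 0, 1] := rfl
theorem val_inversionMat (x : ℝ) : (inversionMat x).val = !![0, -1; 1, -x] := rfl

/-- A triangle with a vertex at `∞` is the image of the standard one under an affine map. -/
theorem exists_mapsTo_of_infty (p : ℍ) (ξ : OnePoint ℝ)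
    (h : InnerProductGeometry.angle (direction p ξ) (direction p OnePoint.infty) = Real.pi / 3) :
    ∃ g : GL (Fin 2) ℝ, g • omega = p ∧ g • ((1 : ℝ) : OnePoint ℝ) = ξ ∧
      g • (OnePoint.infty : OnePoint ℝ) = OnePoint.infty := by
  cases ξ with
  | infty =>
    rw [direction_infty, InnerProductGeometry.angle_self one_ne_zero] at h
    exact absurd h (by positivity)
  | coe x =>
    rw [angle_direction_infty_iff] at h
    have hp := p.im_pos
    -- The slope `a` and intercept `b` solve `a + b = x` and `-a / 2 + b = Re p`.
    have ha : 2 * (x - p.re) / 3 ≠ 0 := by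
      intro h0
      have h1 : x - p.re = 0 := by linarith
      rw [h1] at h
      have : 0 < 3 * p.im ^ 2 := by positivity
      linarith
    refine ⟨affineMat (2 * (x - p.re) / 3) (x - 2 * (x - p.re) / 3) ha, ?_, ?_, ?_⟩
    · apply ext_re_im
      · rw [UpperHalfPlane.re_smul]
        simp [UpperHalfPlane.num, UpperHalfPlane.denom, val_affineMat, re_omega]
        ring
      · rw [UpperHalfPlane.im_smul]
        simp only [UpperHalfPlane.num, UpperHalfPlane.denom, val_affineMat]
        simp [im_omega]
        have h2 : |x - p.re| = √3 * p.im := by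
          rw [← abs_of_pos hp, ← Real.sqrt_sq_eq_abs, h, Real.sqrt_mul (by norm_num),
            Real.sqrt_sq_eq_abs]
        have h3 : √3 * √3 = 3 := Real.mul_self_sqrt (by norm_num)
        rw [← abs_mul]
        rw [show 2 * (x - p.re) / 3 * (√3 / 2) = (x - p.re) * (√3 / 3) by ring, abs_mul, h2,
          abs_of_pos (by positivity)]
        linear_combination p.im / 3 * h3
    · rw [OnePoint.smul_some_eq_ite]
      simp [val_affineMat]
    · rw [OnePoint.smul_infty_eq_ite]
      simp [val_affineMat]

theorem coe_inversionMat_smul (x : ℝ) (p : ℍ) :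
    ((inversionMat x • p : ℍ) : ℂ) = -1 / ((p : ℂ) - x) := by
  rw [UpperHalfPlane.coe_smul_of_det_pos]
  · simp [UpperHalfPlane.num, UpperHalfPlane.denom, val_inversionMat, sub_eq_add_neg]
  · simp [val_inversionMat, Matrix.det_fin_two]

/-- The angle at `p` is preserved when an ideal vertex is moved to `∞`. -/
theorem angle_inversionMat (x : ℝ) (p : ℍ) (ξ : OnePoint ℝ) :
    InnerProductGeometry.angle (direction (inversionMat x • p) (inversionMat x • ξ))
      (direction (inversionMat x • p) OnePoint.infty) =
    InnerProductGeometry.angle (direction p ξ) (direction p (x : OnePoint ℝ)) := by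
  have h1 : (p : ℂ) - x ≠ 0 := by
    intro h
    have := congrArg Complex.im h
    simp at this
    exact p.im_pos.ne' this
  have h2 := coe_sub_conj_ne_zero p x
  have h2' : (starRingEnd ℂ) (p : ℂ) - x ≠ 0 := by rwa [← neg_sub, neg_ne_zero]
  have h1' : (x : ℂ) - p ≠ 0 := by rwa [← neg_sub, neg_ne_zero]
  set k : ℂ := ((starRingEnd ℂ) (p : ℂ) - x) / ((p : ℂ) - x) with hk
  have hk0 : k ≠ 0 := div_ne_zero h2' h1
  have e1 : direction (inversionMat x • p) OnePoint.infty = k * direction p (x : OnePoint ℝ) := by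
    rw [direction_infty, direction_coe, hk]
    field_simp
    ring
  have e2 : direction (inversionMat x • p) (inversionMat x • ξ) = k * direction p ξ := by
    cases ξ with
    | infty =>
      have : inversionMat x • (OnePoint.infty : OnePoint ℝ) = ((0 : ℝ) : OnePoint ℝ) := by
        rw [OnePoint.smul_infty_eq_ite]
        simp [val_inversionMat]
      rw [this, direction_infty, direction_coe, coe_inversionMat_smul, hk]
      simp
      field_simp
    | coe y =>
      by_cases hy : y = x
      · subst hy
        rw [← e1]
        congr 1
        rw [OnePoint.smul_some_eq_ite]
        simp [val_inversionMat]
      · have h3 : y - x ≠ 0 := sub_ne_zero.2 hy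
        have : inversionMat x • (y : OnePoint ℝ) = ((-1 / (y - x) : ℝ) : OnePoint ℝ) := by
          rw [OnePoint.smul_some_eq_ite]
          simp [val_inversionMat, ← sub_eq_add_neg, h3]
        have h4 := coe_sub_conj_ne_zero p y
        have h5 : (y : ℂ) - x ≠ 0 := by exact_mod_cast h3
        have h6 := coe_sub_conj_ne_zero (inversionMat x • p) (-1 / (y - x))
        rw [this, direction_coe, direction_coe, div_eq_iff h6, coe_inversionMat_smul, hk]
        push_cast
        simp only [map_div₀, map_neg, map_one, map_sub, Complex.conj_ofReal]
        field_simp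
        ring
  rw [e1, e2, Complex.angle_mul_left hk0]

/-- Every `(3, ∞, ∞)`-triangle is congruent to the standard one. -/
theorem exists_mapsTo (Δ : IdealTriangle) : ∃ g, IdealTriangle.MapsTo g stdTriangle Δ := by
  obtain ⟨p, ξ, η, hang⟩ := Δ
  cases η with
  | infty =>
    obtain ⟨g, h1, h2, h3⟩ := exists_mapsTo_of_infty p ξ hang
    exact ⟨g, h1, h2, h3⟩
  | coe x =>
    rw [← angle_inversionMat] at hang
    obtain ⟨g, h1, h2, h3⟩ := exists_mapsTo_of_infty _ _ hang
    refine ⟨(inversionMat x)⁻¹ * g, ?_, ?_, ?_⟩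
    · rw [mul_smul, inv_smul_eq_iff]
      exact h1
    · rw [mul_smul, inv_smul_eq_iff]
      exact h2
    · rw [mul_smul, inv_smul_eq_iff]
      refine h3.trans ?_
      rw [OnePoint.smul_some_eq_ite]
      simp [val_inversionMat]

/-- The group generated by the three classes is the reflection group of any `(3, ∞, ∞)`-triangle. -/
theorem nonempty_closure_equiv (Δ : IdealTriangle) :
    Nonempty (Subgroup.closure (Set.range generator) ≃* Δ.reflectionGroup) := by
  obtain ⟨g, hg⟩ := exists_mapsTo Δ
  rw [← hg.map_reflectionGroup, reflectionGroup_stdTriangle]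
  exact ⟨(Subgroup.equivMapOfInjective _ _ isometryHom_injective).trans
    (Subgroup.equivMapOfInjective _ _ (MulAut.conj (glIsometry g)).injective)⟩

theorem nonempty_projVeechGroup_equiv (X : Type*) [TopologicalSpace X] [ChartedSpace Plane X]
    [TranslationSurface X]
    (h : projVeechGroupInBasis X = Subgroup.closure (Set.range generator)) (Δ : IdealTriangle) :
    Nonempty (projVeechGroup X ≃* Δ.reflectionGroup) := by
  obtain ⟨e⟩ := nonempty_closure_equiv Δ
  rw [← h] at e
  exact ⟨(Subgroup.equivMapOfInjective _ _ (MulAut.conj _).injective).trans e⟩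

end Trihex

theorem proposition4p7 :
    -- the generators, for both surfaces
    Trihex.projVeechGroupInBasis Trihex.Z = Subgroup.closure (Set.range Trihex.generator) ∧
    Trihex.projVeechGroupInBasis Trihex.S = Subgroup.closure (Set.range Trihex.generator) ∧
    -- they act on the upper half-plane as the reflections in the sides of a triangle
    (∃ Δ : Trihex.IdealTriangle, ∀ i : Fin 3, ∃ ℓ : Trihex.HypLine, ∃ σ : ℍ ≃ᵢ ℍ,
      Δ.IsSide i ℓ ∧ ℓ.IsReflection σ ∧ ∀ z : ℍ, σ z = Trihex.generator i • z) ∧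
    -- the isomorphisms with the reflection group of any such triangle
    (∀ Δ : Trihex.IdealTriangle,
      Nonempty (Trihex.projVeechGroup Trihex.Z ≃* Δ.reflectionGroup) ∧
      Nonempty (Trihex.projVeechGroup Trihex.S ≃* Δ.reflectionGroup)) ∧
    -- subgroups of index four of `PGL(2, ℤ)`
    (Trihex.projVeechGroupInBasis Trihex.Z ≤ Trihex.intToReal.range ∧
      ((Trihex.projVeechGroupInBasis Trihex.Z).comap Trihex.intToReal).index = 4) ∧
    (Trihex.projVeechGroupInBasis Trihex.S ≤ Trihex.intToReal.range ∧
      ((Trihex.projVeechGroupInBasis Trihex.S).comap Trihex.intToReal).index = 4) := by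
  refine ⟨Trihex.projVeechGroupInBasis_Z, Trihex.projVeechGroupInBasis_S,
    ⟨Trihex.stdTriangle, fun i => ⟨Trihex.stdLine i, Trihex.isometryHom (Trihex.generator i),
      Trihex.isSide_stdLine i, Trihex.isReflection_generator i, fun _ => rfl⟩⟩,
    fun Δ => ⟨Trihex.nonempty_projVeechGroup_equiv _ Trihex.projVeechGroupInBasis_Z Δ,
      Trihex.nonempty_projVeechGroup_equiv _ Trihex.projVeechGroupInBasis_S Δ⟩, ?_, ?_⟩
  · rw [Trihex.projVeechGroupInBasis_Z]
    exact ⟨Trihex.closure_generator_le_range, Trihex.index_closure_generator⟩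
  · rw [Trihex.projVeechGroupInBasis_S]
    exact ⟨Trihex.closure_generator_le_range, Trihex.index_closure_generator⟩
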